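/- Let $\mathbb K$ be an algebraically closed field of characteristic zero and let $n\ge 2$. Let $\mathbb P(V)=\operatorname{Proj}\mathbb K[a_0,\dots,a_n]$, whose closed points are the nonzero binary forms $f=a_0x^n+a_1x^{n-1}y+\cdots+a_ny^n$ up to scalars, let $\mathbb P(W)=\operatorname{Proj}\mathbb K[x,y]$, and let $\mathbf P=\mathbb P(V)\times_{\mathbb K}\mathbb P(W)$ with its projections $p_V,p_W$. Let $$F=a_0x^n+a_1x^{n-1}y+\cdots+a_ny^n\in H^0(\mathbf P,\mathcal O(1,n))$$ be the universal form. Let $\Delta\subset\mathbb P(V)$ be the discriminant, that is, the locus of forms with a root of multiplicity at least two (forms divisible by $(\beta x-\alpha y)^2$ for some $(\alpha,\beta)\ne(0,0)$), with its reduced scheme structure. Let $\bar\Delta\subset\mathbf P$ be the closed subscheme defined by the sections $F_x,F_y$ of $\mathcal O(1,n-1)$, and let $\bar\Gamma\subset\mathbf P$ be the closed subscheme defined by the sections $F_{xx},F_{xy},F_{yy}$ of $\mathcal O(1,n-2)$. (Background, not part of the statement: $p_V$ exhibits $\bar\Delta$ as the normalization of $\Delta$, and, for $n\ge 3$, $\bar\Gamma$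 as the normalization of the caustic, the locus of forms with a root of multiplicity at least three. For $n=2$ the scheme $\bar\Gamma$ is empty.) **Theorem.** The projection $p_V$ restricts to a morphism $\pi:\bar\Delta\to\Delta$, and $\bar\Gamma$ is contained in $\bar\Delta$ as a closed subscheme. Write $j:\bar\Gamma\hookrightarrow\bar\Delta$ for the inclusion and $p=p_W|_{\bar\Delta}:\bar\Delta\to\mathbb P(W)$ for the root projection. Then $$\Omega^1_{\bar\Delta/\Delta}\;\cong\; j_*j^*p^*\Omega^1_{\mathbb P(W)/\mathbb K}$$ as $\mathcal O_{\bar\Delta}$-modules, where $\Omega^1_{\bar\Delta/\Delta}$ is the sheaf of relative differentials of $\pi$. Moreover $j^*p^*\Omega^1_{\mathbb P(W)/\mathbb K}$ is a line bundle on $\bar\Gamma$, so that $\Omega^1_{\bar\Delta/\Delta}$ is the direct image of a line bundle on $\bar\Gamma$. -/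

import Mathlib

open CategoryTheory AlgebraicGeometry MvPolynomial TopologicalSpace

universe u

noncomputable section

namespace OpenSwallowtail

attribute [local instance] MvPolynomial.gradedAlgebra

/-! ### Sheaves of relative differentials and line bundles -/

/-- The morphism `f⁻¹ 𝒪_Y ⟶ 𝒪_X` of presheaves of rings attached to `f : X ⟶ Y`, where `f⁻¹` is the
presheaf inverse image. -/
def pullbackStructure {X Y : Scheme.{u}} (f : X ⟶ Y) :
    (TopCat.Presheaf.pullback CommRingCat.{u} f.base).obj Y.presheaf ⟶ X.presheaf :=
  ((TopCat.Presheaf.pullbackPushforwardAdjunction CommRingCat.{u} f.base).homEquiv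
    Y.presheaf X.presheaf).symm f.c

/-- The presheaf of modules `U ↦ Ω_{𝒪_X(U) / (f⁻¹ 𝒪_Y)(U)}`. -/
def presheafDifferentials {X Y : Scheme.{u}} (f : X ⟶ Y) : X.PresheafOfModules :=
  PresheafOfModules.DifferentialsConstruction.relativeDifferentials' (pullbackStructure f)

/-- The sheaf of relative differentials `Ω¹_{X/Y}` of a morphism `f : X ⟶ Y`: the sheaf of
`𝒪_X`-modules associated with the presheaf `U ↦ Ω_{𝒪_X(U) / (f⁻¹ 𝒪_Y)(U)}`. -/
def Omega {X Y : Scheme.{u}} (f : X ⟶ Y) : X.Modules :=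
  (PresheafOfModules.sheafification (𝟙 X.ringCatSheaf.obj)).obj (presheafDifferentials f)

/-- The structure sheaf of a scheme as a sheaf of modules over itself. -/
def structureModule (X : Scheme.{u}) : X.Modules := SheafOfModules.unit X.ringCatSheaf

/-- A line bundle is a sheaf of modules which is locally isomorphic to the structure sheaf. -/
def IsLineBundle {X : Scheme.{u}} (M : X.Modules) : Prop :=
  ∀ x : X, ∃ U : X.Opens, x ∈ U ∧ Nonempty (M.restrict U.ι ≅ structureModule U.toScheme)

/-! ### Projective spaces -/

/-- The projective space `Proj K[X_i : i ∈ ι]`. -/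
def ProjSpace (K : Type u) [Field K] (ι : Type) : Scheme.{u} :=
  Proj (homogeneousSubmodule ι K)

/-- The structure morphism of projective space over `Spec K`. -/
def ProjSpace.toSpec (K : Type u) [Field K] (ι : Type) :
    ProjSpace K ι ⟶ Spec (CommRingCat.of K) :=
  Proj.toSpecZero (homogeneousSubmodule ι K) ≫
    Spec.map (CommRingCat.ofHom (algebraMap K (homogeneousSubmodule ι K 0)))

/-- The standard chart `{X_i ≠ 0}`. -/
def ProjSpace.chart (K : Type u) [Field K] {ι : Type} (i : ι) : (ProjSpace K ι).Opens :=
  Proj.basicOpen (homogeneousSubmodule ι K) (X i)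

/-- The function `X_k / X_i` on the chart `{X_i ≠ 0}`. -/
def ProjSpace.ratio (K : Type u) [Field K] {ι : Type} (i k : ι) :
    Γ(ProjSpace K ι, ProjSpace.chart K i) :=
  (Proj.awayToSection (homogeneousSubmodule ι K) (X i)).hom
    (HomogeneousLocalization.Away.mk (homogeneousSubmodule ι K) (isHomogeneous_X K i) 1 (X k)
      (isHomogeneous_X K k))

/-! ### The product `P(V) × P(W)` and zero schemes of bihomogeneous polynomials -/

variable (K : Type u) [Field K] (n : ℕ)

/-- `P(V)`, the space of binary forms `a_0 x^n + a_1 x^(n-1) y + ⋯ + a_n y^n`, with homogeneous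
coordinates `a_0, …, a_n`. -/
abbrev PV : Scheme.{u} := ProjSpace K (Fin (n + 1))

/-- `P(W)`, the projective line with homogeneous coordinates `x` (index `0`), `y` (index `1`). -/
abbrev PW : Scheme.{u} := ProjSpace K (Fin 2)

/-- The product `P = P(V) × P(W)` over `K`. -/
def PP : Scheme.{u} :=
  Limits.pullback (ProjSpace.toSpec K (Fin (n + 1))) (ProjSpace.toSpec K (Fin 2))

/-- The projection `P ⟶ P(V)`. -/
def prV : PP K n ⟶ PV K n := Limits.pullback.fst _ _

/-- The projection `P ⟶ P(W)`. -/
def prW : PP K n ⟶ PW K := Limits.pullback.snd _ _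

/-- The chart of `P` on which the `i`-th coordinate of `P(V)` and the `j`-th coordinate of `P(W)`
do not vanish. -/
def PPchart (i : Fin (n + 1)) (j : Fin 2) : (PP K n).Opens :=
  (prV K n ⁻¹ᵁ ProjSpace.chart K i) ⊓ (prW K n ⁻¹ᵁ ProjSpace.chart K j)

/-- The inclusion of constants `K → Γ(P, U)`. -/
def PPconst (U : (PP K n).Opens) : K →+* Γ(PP K n, U) :=
  ((Scheme.ΓSpecIso (CommRingCat.of K)).inv ≫
    (prW K n ≫ ProjSpace.toSpec K (Fin 2)).appTop ≫
    (PP K n).presheaf.map (homOfLE (le_top : U ≤ ⊤)).op).hom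

/-- The functions `a_k / a_i` (for `inl k`) and `x / z_j`, `y / z_j` (for `inr 0`, `inr 1`, where
`z_0 = x`, `z_1 = y`) on the `(i, j)`-chart of `P`. -/
def PPcoord (i : Fin (n + 1)) (j : Fin 2) :
    Fin (n + 1) ⊕ Fin 2 → Γ(PP K n, PPchart K n i j) :=
  Sum.elim
    (fun k => ((PP K n).presheaf.map (homOfLE inf_le_left).op).hom
      (((prV K n).app (ProjSpace.chart K i)).hom (ProjSpace.ratio K i k)))
    (fun l => ((PP K n).presheaf.map (homOfLE inf_le_right).op).hom
      (((prW K n).app (ProjSpace.chart K j)).hom (ProjSpace.ratio K j l)))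

variable {K n} in
/-- The dehomogenization of a polynomial `G` in `a_0, …, a_n` and `x, y` on the `(i, j)`-chart. If `G`
is bihomogeneous of bidegree `(d, e)`, this is `G / (a_i^d z_j^e)`, that is, the expression of the
section `G` of `𝒪(d, e)` in the standard trivialization. -/
def dehomogenize (G : MvPolynomial (Fin (n + 1) ⊕ Fin 2) K) (i : Fin (n + 1)) (j : Fin 2) :
    Γ(PP K n, PPchart K n i j) :=
  eval₂ (PPconst K n _) (PPcoord K n i j) G

variable {K n} in
/-- The ideal sheaf on `P` generated by a set `S` of bihomogeneous polynomials, viewed as sections of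
the sheaves `𝒪(d, e)`. On an affine open subset of a chart it is generated by the dehomogenizations
of the members of `S` (for bihomogeneous polynomials the choice of the chart does not matter); it is
written as the largest ideal sheaf which is contained in these ideals. -/
def idealSheaf (S : Set (MvPolynomial (Fin (n + 1) ⊕ Fin 2) K)) : (PP K n).IdealSheafData :=
  .ofIdeals fun U => ⨅ (i : Fin (n + 1)) (j : Fin 2) (h : U.1 ≤ PPchart K n i j),
    Ideal.span ((fun G => ((PP K n).presheaf.map (homOfLE h).op).hom (dehomogenize G i j)) '' S)

/-! ### The universal form and the incidence varieties -/

/-- The universal form `F = a_0 x^n + a_1 x^(n-1) y + ⋯ + a_n y^n`, where `a_i` is the variable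
`inl i`, `x` is the variable `inr 0` and `y` is the variable `inr 1`. -/
def universalForm : MvPolynomial (Fin (n + 1) ⊕ Fin 2) K :=
  ∑ i : Fin (n + 1), X (Sum.inl i) * X (Sum.inr 0) ^ (n - (i : ℕ)) * X (Sum.inr 1) ^ (i : ℕ)

/-- The ideal sheaf generated by `F_x` and `F_y`. -/
def idealDeltaBar : (PP K n).IdealSheafData :=
  idealSheaf {pderiv (Sum.inr 0) (universalForm K n), pderiv (Sum.inr 1) (universalForm K n)}

/-- The incidence variety `Δ̄ ⊆ P` defined by `F_x = F_y = 0`. -/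
def DeltaBar : Scheme.{u} := (idealDeltaBar K n).subscheme

/-- The closed embedding `Δ̄ ⟶ P`. -/
def DeltaBar.incl : DeltaBar K n ⟶ PP K n := (idealDeltaBar K n).subschemeι

/-- The ideal sheaf generated by `F_xx`, `F_xy` and `F_yy`. -/
def idealGammaBar : (PP K n).IdealSheafData :=
  idealSheaf {pderiv (Sum.inr 0) (pderiv (Sum.inr 0) (universalForm K n)),
    pderiv (Sum.inr 0) (pderiv (Sum.inr 1) (universalForm K n)),
    pderiv (Sum.inr 1) (pderiv (Sum.inr 1) (universalForm K n))}

/-- The incidence variety `Γ̄ ⊆ P` defined by `F_xx = F_xy = F_yy = 0`. -/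
def GammaBar : Scheme.{u} := (idealGammaBar K n).subscheme

/-- The closed embedding `Γ̄ ⟶ P`. -/
def GammaBar.incl : GammaBar K n ⟶ PP K n := (idealGammaBar K n).subschemeι

/-- The root projection `p : Δ̄ ⟶ P(W)`. -/
def rootProj : DeltaBar K n ⟶ PW K := DeltaBar.incl K n ≫ prW K n

/-! ### The discriminant -/

variable {K n}

/-- The binary form `c_0 x^n + c_1 x^(n-1) y + ⋯ + c_n y^n` in the variables `x = X 0`, `y = X 1`. -/
def formOf (c : Fin (n + 1) → K) : MvPolynomial (Fin 2) K :=
  ∑ i : Fin (n + 1), C (c i) * X 0 ^ (n - (i : ℕ)) * X 1 ^ (i : ℕ)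

/-- The form `f` has a root `[α : β]` of multiplicity at least `k`. -/
def HasRootOfMultiplicity (f : MvPolynomial (Fin 2) K) (k : ℕ) : Prop :=
  ∃ α β : K, (α ≠ 0 ∨ β ≠ 0) ∧ (C β * X 0 - C α * X 1) ^ k ∣ f

variable (K n)

/-- The polynomials in `a_0, …, a_n` which vanish at all nonzero forms of degree `n` with a root of
multiplicity at least two. -/
def discriminantEquations : Set (MvPolynomial (Fin (n + 1)) K) :=
  {D | ∀ c : Fin (n + 1) → K, c ≠ 0 → HasRootOfMultiplicity (formOf c) 2 → eval c D = 0}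

/-- The closed subset of `P(V)` formed by the forms with a root of multiplicity at least two. -/
def discriminantLocus : Closeds (PV K n) :=
  ⟨ProjectiveSpectrum.zeroLocus (homogeneousSubmodule (Fin (n + 1)) K) (discriminantEquations K n),
    ProjectiveSpectrum.isClosed_zeroLocus _ _⟩

/-- The discriminant `Δ`: the locus of forms with a root of multiplicity at least two, as a reduced
closed subscheme of `P(V)`. -/
def Delta : Scheme.{u} :=
  (Scheme.IdealSheafData.vanishingIdeal (discriminantLocus K n)).subscheme

/-- The closed embedding `Δ ⟶ P(V)`. -/
def Delta.incl : Delta K n ⟶ PV K n :=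
  (Scheme.IdealSheafData.vanishingIdeal (discriminantLocus K n)).subschemeι

end OpenSwallowtail

end

/-! On a chart where `a_i` and one of `x`, `y` are invertible, let `t` be the affine coordinate of
the root. The functions on `Δ̄` are generated by `t` and by functions pulled back from `P(V)`, and
the latter come from `Δ`. Hence `Ω¹` of `π` is generated by `dt`, and everything rests on the
annihilator of `dt`.

The annihilator is the ideal of `Γ̄`. Differentiating `F_x = F_y = 0` with the `a_k` constant gives
`F_xt dt = F_yt dt = 0`. Euler's relation for `F_x` and `F_y`, of degree `n - 1` in `x, y`, adds the
remaining second derivative (`toDelta_smul_eq_zero`). Conversely, over `Γ̄` the substitution `t ↦ t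
+ ε` with the `a_k` fixed maps `F_x` to `F_x + ε F_xt = 0`, and `F_y` likewise. It is therefore a
tangent vector of `Δ̄` along the fibres of `π` on which `dt` takes the value 1
(`exists_tangentVector`), so `g dt = 0` forces `g` to vanish on `Γ̄`.

The pullback to `Γ̄` of the differential of the coordinate of `P(W)` generates the other sheaf
freely over `Γ̄`, so it has the same annihilator over `Δ̄`. On both sides the change of coordinate
`s = 1/t` multiplies the generator by `-s²`. Sheaves with corresponding local generators and the
same relations are isomorphic (`LocallyGenerated.nonempty_iso`).

For `π` to exist, the functions vanishing on `Δ` must vanish on `Δ̄` as a scheme. On `Δ̄` the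
universal form is divisible by `(T - t)²` over the ring of functions, and an equation of the
discriminant is a polynomial identity in `t` and the coefficients of the cofactor. It thus holds
over every ring (`eval₂_coeff_eq_zero`), so no reducedness of `Δ̄` is needed. -/

noncomputable section

namespace OpenSwallowtail

open Scheme.Modules

/-! ### Sections of sheaves of modules -/

section Sections

variable {X : Scheme.{u}}

/-- Restriction of functions from `U` to a smaller open subset `V`. -/
def ores {V U : X.Opens} (h : V ≤ U) : Γ(X, U) →+* Γ(X, V) :=
  (X.presheaf.map (homOfLE h).op).hom

/-- Restriction of sections of a sheaf of modules from `U` to a smaller open subset `V`. -/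
def mres (M : X.Modules) {V U : X.Opens} (h : V ≤ U) : Γ(M, U) →+ Γ(M, V) :=
  (M.presheaf.map (homOfLE h).op).hom

@[simp]
lemma ores_refl {U : X.Opens} (s : Γ(X, U)) : ores le_rfl s = s := by
  change (X.presheaf.map (𝟙 _)).hom s = s
  simp

@[simp]
lemma ores_ores {W V U : X.Opens} (h : V ≤ U) (h' : W ≤ V) (s : Γ(X, U)) :
    ores h' (ores h s) = ores (h'.trans h) s := by
  change (X.presheaf.map (homOfLE h').op).hom ((X.presheaf.map (homOfLE h).op).hom s) = _
  rw [← CommRingCat.comp_apply, ← X.presheaf.map_comp]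
  rfl

@[simp]
lemma mres_refl (M : X.Modules) {U : X.Opens} (s : Γ(M, U)) : mres M le_rfl s = s := by
  change (M.presheaf.map (𝟙 _)).hom s = s
  simp

@[simp]
lemma mres_mres (M : X.Modules) {W V U : X.Opens} (h : V ≤ U) (h' : W ≤ V) (s : Γ(M, U)) :
    mres M h' (mres M h s) = mres M (h'.trans h) s := by
  change (M.presheaf.map (homOfLE h').op).hom ((M.presheaf.map (homOfLE h).op).hom s) = _
  rw [← AddCommGrpCat.comp_apply, ← M.presheaf.map_comp]
  rfl

@[simp]
lemma mres_smul (M : X.Modules) {V U : X.Opens} (h : V ≤ U) (g : Γ(X, U)) (s : Γ(M, U)) :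
    mres M h (g • s) = ores h g • mres M h s :=
  Scheme.Modules.map_smul M (homOfLE h) g s

lemma app_mres {M N : X.Modules} (φ : M ⟶ N) {V U : X.Opens} (h : V ≤ U) (s : Γ(M, U)) :
    φ.app V (mres M h s) = mres N h (φ.app U s) :=
  ConcreteCategory.congr_hom (φ.mapPresheaf.naturality (homOfLE h).op) s

lemma sections_ext (M : X.Modules) {U : X.Opens} {s t : Γ(M, U)}
    (H : ∀ x ∈ U, ∃ (V : X.Opens) (h : V ≤ U), x ∈ V ∧ mres M h s = mres M h t) : s = t := by
  choose V h hx e using H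
  refine TopCat.Sheaf.eq_of_locally_eq' ⟨M.presheaf, M.isSheaf⟩
    (fun x : U => V x.1 x.2) U (fun x => homOfLE (h x.1 x.2)) ?_ s t (fun x => e x.1 x.2)
  intro x hxU
  exact Opens.mem_iSup.mpr ⟨⟨x, hxU⟩, hx x hxU⟩

lemma sections_glue (M : X.Modules) {ι : Type u} {U : X.Opens} (V : ι → X.Opens)
    (h : ∀ i, V i ≤ U) (hU : U ≤ iSup V) (s : ∀ i, Γ(M, V i))
    (H : ∀ i j, mres M inf_le_left (s i) = mres M (inf_le_right : V i ⊓ V j ≤ V j) (s j)) :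
    ∃ t : Γ(M, U), ∀ i, mres M (h i) t = s i := by
  obtain ⟨t, ht, -⟩ := TopCat.Sheaf.existsUnique_gluing' ⟨M.presheaf, M.isSheaf⟩ V U
    (fun i => homOfLE (h i)) hU s H
  exact ⟨t, ht⟩

/-- A morphism of sheaves of modules from its action on sections. -/
def modulesHomMk {M N : X.Modules} (φ : ∀ U : X.Opens, Γ(M, U) →+ Γ(N, U))
    (hsmul : ∀ U (g : Γ(X, U)) s, φ U (g • s) = g • φ U s)
    (hres : ∀ {V U : X.Opens} (h : V ≤ U) s, φ V (mres M h s) = mres N h (φ U s)) : M ⟶ N :=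
  ⟨PresheafOfModules.homMk (M₁ := M.val) (M₂ := N.val)
    { app := fun U => AddCommGrpCat.ofHom (φ U.unop)
      naturality := fun U V f => by
        ext s
        exact hres (leOfHom f.unop) s }
    (fun U g s => hsmul U.unop g s)⟩

/-! ### Sheaves of modules generated locally by given sections -/

/-- Every section of `N` is locally on `U` a multiple of the section `e`. -/
def GeneratesOn (N : X.Modules) {U : X.Opens} (e : Γ(N, U)) : Prop :=
  ∀ (V : X.Opens) (s : Γ(N, V)) (x : X), x ∈ V → x ∈ U → ∃ (W : X.Opens) (hV : W ≤ V) (hU : W ≤ U)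
    (g : Γ(X, W)), x ∈ W ∧ mres N hV s = g • mres N hU e

/-- The sections `e j` generate `N` on open subsets which cover the scheme. -/
def LocallyGenerated (N : X.Modules) {ι : Type} (U : ι → X.Opens) (e : ∀ j, Γ(N, U j)) : Prop :=
  (∀ x, ∃ j, x ∈ U j) ∧ ∀ j, GeneratesOn N (e j)

variable {M N : X.Modules} {ι : Type} {U : ι → X.Opens} {e : ∀ j, Γ(N, U j)}

lemma LocallyGenerated.exists_eq_smul (hN : LocallyGenerated N U e) (V : X.Opens) (s : Γ(N, V))
    (x : X) (hx : x ∈ V) : ∃ (W : X.Opens) (hV : W ≤ V) (j : ι) (hU : W ≤ U j)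
      (g : Γ(X, W)), x ∈ W ∧ mres N hV s = g • mres N hU (e j) := by
  obtain ⟨j, hj⟩ := hN.1 x
  obtain ⟨W, hV, hU, h⟩ := hN.2 j V s x hx hj
  exact ⟨W, hV, j, hU, h⟩

lemma LocallyGenerated.hom_ext (hN : LocallyGenerated N U e) {φ ψ : N ⟶ M}
    (H : ∀ j, φ.app (U j) (e j) = ψ.app (U j) (e j)) : φ = ψ := by
  ext V s
  refine sections_ext M fun x hx => ?_
  obtain ⟨W, hV, j, hU, g, hxW, hs⟩ := hN.exists_eq_smul V s x hx
  refine ⟨W, hV, hxW, ?_⟩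
  rw [← app_mres, ← app_mres, hs, Hom.app_smul, Hom.app_smul, app_mres, app_mres, H]

variable (m : ∀ j, Γ(M, U j))

/-- The section `t` of `M` is obtained from the section `s` of `N` by replacing the generators `e j`
by the sections `m j`. -/
def Corresponds (e : ∀ j, Γ(N, U j)) (m : ∀ j, Γ(M, U j)) {V : X.Opens} (s : Γ(N, V))
    (t : Γ(M, V)) : Prop :=
  ∀ (W : X.Opens) (hV : W ≤ V) (j : ι) (hU : W ≤ U j) (g : Γ(X, W)),
    mres N hV s = g • mres N hU (e j) → mres M hV t = g • mres M hU (m j)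

variable {m}

lemma LocallyGenerated.corresponds_unique (hN : LocallyGenerated N U e) {V : X.Opens}
    {s : Γ(N, V)} {t t' : Γ(M, V)} (h : Corresponds e m s t) (h' : Corresponds e m s t') :
    t = t' := by
  refine sections_ext M fun x hx => ?_
  obtain ⟨W, hV, j, hU, g, hxW, hs⟩ := hN.exists_eq_smul V s x hx
  exact ⟨W, hV, hxW, by rw [h W hV j hU g hs, h' W hV j hU g hs]⟩

/-- Since `hm` carries every relation among the `e j` to the `m j`, any two local expressions of `s`
produce the same section of `M`. One expression near each point therefore suffices. -/
lemma corresponds_of_locally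
    (hm : ∀ (j k : ι) (W : X.Opens) (hj : W ≤ U j) (hk : W ≤ U k) (g h : Γ(X, W)),
      g • mres N hj (e j) = h • mres N hk (e k) → g • mres M hj (m j) = h • mres M hk (m k))
    {V : X.Opens} {s : Γ(N, V)} {t : Γ(M, V)}
    (H : ∀ x ∈ V, ∃ (W : X.Opens) (hV : W ≤ V) (j : ι) (hU : W ≤ U j) (g : Γ(X, W)), x ∈ W ∧
      mres N hV s = g • mres N hU (e j) ∧ mres M hV t = g • mres M hU (m j)) :
    Corresponds e m s t := by
  intro W hV j hU g hs
  refine sections_ext M fun x hx => ?_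
  obtain ⟨W', hV', j', hU', g', hx', hs', ht'⟩ := H x (hV hx)
  refine ⟨W ⊓ W', inf_le_left, ⟨hx, hx'⟩, ?_⟩
  have h1 := congrArg (mres N (inf_le_left : W ⊓ W' ≤ W)) hs
  have h2 := congrArg (mres N (inf_le_right : W ⊓ W' ≤ W')) hs'
  have h3 := congrArg (mres M (inf_le_right : W ⊓ W' ≤ W')) ht'
  simp only [mres_mres, mres_smul] at h1 h2 h3 ⊢
  rw [h3]
  exact hm _ _ _ _ _ _ _ (h2.symm.trans h1)

lemma LocallyGenerated.exists_corresponds (hN : LocallyGenerated N U e)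
    (hm : ∀ (j k : ι) (W : X.Opens) (hj : W ≤ U j) (hk : W ≤ U k) (g h : Γ(X, W)),
      g • mres N hj (e j) = h • mres N hk (e k) → g • mres M hj (m j) = h • mres M hk (m k))
    {V : X.Opens} (s : Γ(N, V)) : ∃ t : Γ(M, V), Corresponds e m s t := by
  have H := hN.exists_eq_smul V s
  choose W hV j hU g hxW hs using H
  obtain ⟨t, ht⟩ := sections_glue M (U := V) (fun x : V => W x.1 x.2) (fun x => hV x.1 x.2)
    (fun x hx => Opens.mem_iSup.mpr ⟨⟨x, hx⟩, hxW x hx⟩)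
    (fun x => g x.1 x.2 • mres M (hU x.1 x.2) (m (j x.1 x.2))) (by
      intro x y
      simp only [mres_smul, mres_mres]
      apply hm
      have h1 := congrArg (mres N (inf_le_left : W x.1 x.2 ⊓ W y.1 y.2 ≤ _)) (hs x.1 x.2)
      have h2 := congrArg (mres N (inf_le_right : W x.1 x.2 ⊓ W y.1 y.2 ≤ _)) (hs y.1 y.2)
      simp only [mres_smul, mres_mres] at h1 h2
      exact h1.symm.trans h2)
  exact ⟨t, corresponds_of_locally hm fun x hx =>
    ⟨W x hx, hV x hx, j x hx, hU x hx, g x hx, hxW x hx, hs x hx, ht ⟨x, hx⟩⟩⟩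

/-- A morphism out of a locally generated sheaf of modules may be prescribed on the generators as
soon as this respects the relations between them. -/
theorem LocallyGenerated.exists_hom (hN : LocallyGenerated N U e)
    (hm : ∀ (j k : ι) (W : X.Opens) (hj : W ≤ U j) (hk : W ≤ U k) (g h : Γ(X, W)),
      g • mres N hj (e j) = h • mres N hk (e k) → g • mres M hj (m j) = h • mres M hk (m k)) :
    ∃ φ : N ⟶ M, ∀ j, φ.app (U j) (e j) = m j := by
  have key (V : X.Opens) (s : Γ(N, V)) : ∃ t : Γ(M, V), Corresponds e m s t :=
    hN.exists_corresponds hm s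
  choose φ hφ using key
  refine ⟨modulesHomMk (fun V => AddMonoidHom.mk' (φ V) fun s s' => ?_) (fun V g s => ?_)
    (fun {V V'} h s => ?_), fun j => ?_⟩
  · refine hN.corresponds_unique (hφ _ _) (corresponds_of_locally hm fun x hx => ?_)
    obtain ⟨W, hV, j, hU, g, hxW, hs⟩ := hN.exists_eq_smul V s x hx
    -- The second section is expanded in the same generator `e j` as the first, so that the
    -- coefficients can be added.
    obtain ⟨W', hV', hU', g', hxW', hs'⟩ := hN.2 j W (mres N hV s') x hxW (hU hxW)
    rw [mres_mres] at hs'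
    have h1 := congrArg (mres N hV') hs
    rw [mres_mres, mres_smul, mres_mres] at h1
    refine ⟨W', hV'.trans hV, j, hU', ores hV' g + g', hxW', ?_, ?_⟩
    · rw [map_add, h1, hs', add_smul]
    · rw [map_add, hφ V s _ _ j hU' _ h1, hφ V s' _ _ j hU' g' hs', add_smul]
  · refine hN.corresponds_unique (hφ _ _) (corresponds_of_locally hm fun x hx => ?_)
    obtain ⟨W, hV, j, hU, a, hxW, hs⟩ := hN.exists_eq_smul V s x hx
    refine ⟨W, hV, j, hU, ores hV g * a, hxW, ?_, ?_⟩
    · rw [mres_smul, hs, mul_smul]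
    · exact (mres_smul _ _ _ _).trans (by rw [mul_smul]; exact congrArg _ (hφ V s W hV j hU a hs))
  · refine hN.corresponds_unique (hφ _ _) fun W hV j hU g hs => ?_
    rw [mres_mres] at hs ⊢
    exact hφ V' s W _ j hU g hs
  · refine hN.corresponds_unique (hφ _ _) fun W hV k hU g hs => ?_
    simpa using hm j k W hV hU 1 g (by simpa using hs)

end Sections

end OpenSwallowtail

namespace OpenSwallowtail

open Scheme.Modules

/-! ### Inverse images of sheaves of modules, reached through the adjunction. -/

section Pullback

variable {X Y : Scheme.{u}}

/-- The section `e` freely generates `L` on `U`. -/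
def FreelyGenerates (L : Y.Modules) {U : Y.Opens} (e : Γ(L, U)) : Prop :=
  ∀ (V : Y.Opens) (h : V ≤ U) (s : Γ(L, V)), ∃! g : Γ(Y, V), s = g • mres L h e

variable (q : X ⟶ Y)

lemma preimage_le {V U : Y.Opens} (h : V ≤ U) : q ⁻¹ᵁ V ≤ q ⁻¹ᵁ U := fun _ hx => h hx

lemma app_ores {V U : Y.Opens} (h : V ≤ U) (g : Γ(Y, U)) :
    (q.app V).hom (ores h g) = ores (preimage_le q h) ((q.app U).hom g) :=
  ConcreteCategory.congr_hom (q.naturality (homOfLE h).op) g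

/-- The inverse image of a section. -/
def pullbackSection (L : Y.Modules) {U : Y.Opens} (e : Γ(L, U)) :
    Γ((pullback q).obj L, q ⁻¹ᵁ U) :=
  ((pullbackPushforwardAdjunction q).unit.app L).app U e

variable {q} {L : Y.Modules}

lemma pullbackSection_smul {U : Y.Opens} (g : Γ(Y, U)) (e : Γ(L, U)) :
    pullbackSection q L (g • e) = (q.app U).hom g • pullbackSection q L e :=
  Hom.app_smul _ _ _

lemma pullbackSection_mres {V U : Y.Opens} (h : V ≤ U) (e : Γ(L, U)) :
    pullbackSection q L (mres L h e) =
      mres ((pullback q).obj L) (preimage_le q h) (pullbackSection q L e) :=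
  app_mres ((pullbackPushforwardAdjunction q).unit.app L) h e

/-- The inverse image enters only as a left adjoint, so its sections are handled through morphisms
out of it. These are determined, and in the next lemma constructed, by their effect on inverse
images of sections. -/
lemma pullback_hom_ext {M : X.Modules} {φ ψ : (pullback q).obj L ⟶ M}
    (H : ∀ (U : Y.Opens) (e : Γ(L, U)),
      φ.app _ (pullbackSection q L e) = ψ.app _ (pullbackSection q L e)) : φ = ψ := by
  apply ((pullbackPushforwardAdjunction q).homEquiv _ _).injective
  rw [Adjunction.homEquiv_unit, Adjunction.homEquiv_unit]
  ext U e
  exact H U e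

lemma pullback_exists_hom {M : X.Modules} (θ : L ⟶ (pushforward q).obj M) :
    ∃ φ : (pullback q).obj L ⟶ M, ∀ (U : Y.Opens) (e : Γ(L, U)),
      φ.app _ (pullbackSection q L e) = (show Γ(M, q ⁻¹ᵁ U) from θ.app U e) := by
  refine ⟨((pullbackPushforwardAdjunction q).homEquiv _ _).symm θ, fun U e => ?_⟩
  have h := ((pullbackPushforwardAdjunction q).homEquiv _ _).apply_symm_apply θ
  rw [Adjunction.homEquiv_unit] at h
  exact ConcreteCategory.congr_hom (congrArg (fun φ => φ.app U) h) e

end Pullback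

/-! ### Restriction of a sheaf of modules to an open subset, followed by direct image. -/

section Restrict

variable {X : Scheme.{u}} (Z : X.Opens)

/-- The sheaf of modules `V ↦ Γ(M, V ∩ Z)`. -/
def restrictPush (M : X.Modules) : X.Modules := (pushforward Z.ι).obj (M.restrict Z.ι)

lemma image_preimage_le (V : X.Opens) : Z.ι ''ᵁ (Z.ι ⁻¹ᵁ V) ≤ V := Z.ι.image_preimage_le V

lemma image_preimage_le' (V : X.Opens) : Z.ι ''ᵁ (Z.ι ⁻¹ᵁ V) ≤ Z := Z.ι_image_le _

lemma le_image_preimage {V : X.Opens} (h : V ≤ Z) : V ≤ Z.ι ''ᵁ (Z.ι ⁻¹ᵁ V) :=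
  fun x hx => ⟨⟨x, h hx⟩, hx, rfl⟩

variable {M : X.Modules}

/-- Sections of `restrictPush Z M` are sections of `M` on a smaller open subset. -/
def restrictPushEquiv (V : X.Opens) : Γ(restrictPush Z M, V) ≃+ Γ(M, Z.ι ''ᵁ (Z.ι ⁻¹ᵁ V)) :=
  AddEquiv.refl _

lemma restrictPushEquiv_smul {V : X.Opens} (g : Γ(X, V)) (s : Γ(restrictPush Z M, V)) :
    restrictPushEquiv Z V (g • s) =
      ores (image_preimage_le Z V) g • restrictPushEquiv Z V s := by
  change (show Γ(M, Z.ι ''ᵁ (Z.ι ⁻¹ᵁ V)) from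
    (Z.ι.appIso (Z.ι ⁻¹ᵁ V)).inv.hom ((Z.ι.app V).hom g) • restrictPushEquiv Z V s) = _
  rw [Scheme.Opens.ι_appIso, Scheme.Opens.ι_app]
  rfl

lemma restrictPushEquiv_mres {V U : X.Opens} (h : V ≤ U) (s : Γ(restrictPush Z M, U)) :
    restrictPushEquiv Z V (mres _ h s) =
      mres M (Scheme.Hom.image_mono _ (preimage_le Z.ι h)) (restrictPushEquiv Z U s) := rfl

/-- Restriction of sections, as a morphism of sheaves of modules. -/
def toRestrictPush (M : X.Modules) : M ⟶ restrictPush Z M :=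
  modulesHomMk (fun V => (restrictPushEquiv Z V).symm.toAddMonoidHom.comp
      (mres M (image_preimage_le Z V)))
    (fun V g s => (restrictPushEquiv Z V).injective <| by
      simp [restrictPushEquiv_smul])
    (fun {V U} h s => (restrictPushEquiv Z V).injective <| by
      simp [restrictPushEquiv_mres])

lemma toRestrictPush_app {V : X.Opens} (s : Γ(M, V)) :
    restrictPushEquiv Z V ((toRestrictPush Z M).app V s) = mres M (image_preimage_le Z V) s := rfl

/-- The structure sheaf as a sheaf of modules: its sections are functions. -/
def structureModuleEquiv (X : Scheme.{u}) (V : X.Opens) : Γ(structureModule X, V) ≃+ Γ(X, V) :=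
  AddEquiv.refl _

lemma structureModuleEquiv_smul {V : X.Opens} (g : Γ(X, V)) (s : Γ(structureModule X, V)) :
    structureModuleEquiv X V (g • s) = g * structureModuleEquiv X V s := rfl

lemma structureModuleEquiv_mres {V U : X.Opens} (h : V ≤ U) (s : Γ(structureModule X, U)) :
    structureModuleEquiv X V (mres _ h s) = ores h (structureModuleEquiv X U s) := rfl

variable {Z} in
/-- Multiplication with a section `e` of `M` on `Z`. -/
def restrictPushMul (e : Γ(M, Z)) : restrictPush Z (structureModule X) ⟶ restrictPush Z M :=
  modulesHomMk (fun V => (restrictPushEquiv Z V).symm.toAddMonoidHom.comp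
      (AddMonoidHom.mk' (fun g => structureModuleEquiv X _ (restrictPushEquiv Z V g) •
        mres M (image_preimage_le' Z V) e) fun g h => by simp [add_smul]))
    (fun V g s => (restrictPushEquiv Z V).injective <| by
      simp [restrictPushEquiv_smul, structureModuleEquiv_smul, mul_smul])
    (fun {V U} h s => (restrictPushEquiv Z V).injective <| by
      simp [restrictPushEquiv_mres, structureModuleEquiv_mres])

variable {Z} in
lemma restrictPushMul_app (e : Γ(M, Z)) {V : X.Opens}
    (g : Γ(restrictPush Z (structureModule X), V)) :
    restrictPushEquiv Z V ((restrictPushMul e).app V g) =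
      structureModuleEquiv X _ (restrictPushEquiv Z V g) • mres M (image_preimage_le' Z V) e := rfl

end Restrict

/-! ### Free generators pull back to free generators. -/

section PullbackFree

variable {X Y : Scheme.{u}} {q : X ⟶ Y} {L : Y.Modules} {U : Y.Opens} {e : Γ(L, U)}

lemma image_preimage_preimage_le (q : X ⟶ Y) (U V : Y.Opens) :
    (q ⁻¹ᵁ U).ι ''ᵁ ((q ⁻¹ᵁ U).ι ⁻¹ᵁ (q ⁻¹ᵁ V)) ≤ q ⁻¹ᵁ (V ⊓ U) :=
  fun _ hx => ⟨image_preimage_le (q ⁻¹ᵁ U) (q ⁻¹ᵁ V) hx, image_preimage_le' (q ⁻¹ᵁ U) _ hx⟩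

/-- The morphism `ψ` reads off the coefficient of a section with respect to the inverse image of
`e`. On `L` itself this is the pullback of the coefficient with respect to `e` over `V ⊓ U`, which
is linear because the coefficient is unique; the adjunction extends it to the inverse image. -/
lemma FreelyGenerates.exists_coordinate (he : FreelyGenerates L e) :
    ∃ ψ : (pullback q).obj L ⟶ restrictPush (q ⁻¹ᵁ U) (structureModule X),
      ∀ (V : Y.Opens) (s : Γ(L, V)) (g : Γ(Y, V ⊓ U)),
        mres L inf_le_left s = g • mres L inf_le_right e →
        structureModuleEquiv X _ (restrictPushEquiv _ _ (ψ.app _ (pullbackSection q L s))) =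
          ores (image_preimage_preimage_le q U V) ((q.app (V ⊓ U)).hom g) := by
  have H (V : Y.Opens) (s : Γ(L, V)) := he (V ⊓ U) inf_le_right (mres L inf_le_left s)
  choose c hc huniq using H
  have hu {V : Y.Opens} {s : Γ(L, V)} {g : Γ(Y, V ⊓ U)}
    (h : mres L inf_le_left s = g • mres L inf_le_right e) : c V s = g := (huniq V s g h).symm
  let E (V : Y.Opens) : Γ((pushforward q).obj (restrictPush (q ⁻¹ᵁ U) (structureModule X)), V) ≃+
      Γ(X, (q ⁻¹ᵁ U).ι ''ᵁ ((q ⁻¹ᵁ U).ι ⁻¹ᵁ (q ⁻¹ᵁ V))) :=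
    (restrictPushEquiv (q ⁻¹ᵁ U) (q ⁻¹ᵁ V)).trans (structureModuleEquiv X _)
  have Esmul (V : Y.Opens) (g : Γ(Y, V)) (s) : E V (g • s) =
      ores (image_preimage_le _ _) ((q.app V).hom g) * E V s := by
    refine (congrArg (structureModuleEquiv X _) (restrictPushEquiv_smul (q ⁻¹ᵁ U)
      ((q.app V).hom g) s)).trans ?_
    rfl
  have Eres {V V' : Y.Opens} (h : V ≤ V') (s) : E V (mres _ h s) =
      ores (Scheme.Hom.image_mono _ (preimage_le _ (preimage_le q h))) (E V' s) := rfl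
  let θ : L ⟶ (pushforward q).obj (restrictPush (q ⁻¹ᵁ U) (structureModule X)) :=
    modulesHomMk (fun V => (E V).symm.toAddMonoidHom.comp (AddMonoidHom.mk'
        (fun s => ores (image_preimage_preimage_le q U V) ((q.app (V ⊓ U)).hom (c V s)))
        fun s t => by
          rw [← map_add, ← map_add]
          congr 2
          exact hu (by rw [map_add, hc, hc, add_smul])))
      (fun V g s => (E V).injective <| by
        rw [Esmul]
        simp only [AddEquiv.toAddMonoidHom_eq_coe, AddMonoidHom.coe_comp, AddMonoidHom.coe_coe,
          Function.comp_apply, AddMonoidHom.mk'_apply, AddEquiv.apply_symm_apply]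
        rw [hu (g := ores inf_le_left g * c V s) (by rw [mres_smul, hc, mul_smul]), map_mul,
          map_mul, app_ores, ores_ores])
      (fun {V V'} h s => (E V).injective <| by
        rw [Eres]
        simp only [AddEquiv.toAddMonoidHom_eq_coe, AddMonoidHom.coe_comp, AddMonoidHom.coe_coe,
          Function.comp_apply, AddMonoidHom.mk'_apply, AddEquiv.apply_symm_apply]
        have h1 := congrArg (mres L (inf_le_inf_right U h)) (hc V' s)
        simp only [mres_mres, mres_smul] at h1
        rw [hu (g := ores (inf_le_inf_right U h) (c V' s)) (by rw [mres_mres, h1]), app_ores,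
          ores_ores, ores_ores])
  obtain ⟨ψ, hψ⟩ := pullback_exists_hom θ
  refine ⟨ψ, fun V s g hg => ?_⟩
  rw [hψ, ← hu hg]
  exact (E V).apply_symm_apply _

/-- The inverse image of a free generator is a free generator. -/
theorem FreelyGenerates.pullback (he : FreelyGenerates L e) :
    FreelyGenerates ((pullback q).obj L) (pullbackSection q L e) := by
  obtain ⟨ψ, hψ⟩ := he.exists_coordinate (q := q)
  have h1 : structureModuleEquiv X _ (restrictPushEquiv _ _ (ψ.app _ (pullbackSection q L e))) =
      1 := by
    rw [hψ U e 1 (by rw [one_smul])]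
    simp
  -- Coefficient times generator recovers the section over `q ⁻¹ᵁ U`; it is enough to test inverse
  -- images of sections of `L`. This yields existence of coefficients below, and `h1` yields
  -- uniqueness.
  have h2 : toRestrictPush _ _ = ψ ≫ restrictPushMul (pullbackSection q L e) := by
    refine pullback_hom_ext fun V s => (restrictPushEquiv _ _).injective ?_
    rw [toRestrictPush_app, Hom.comp_app]
    refine Eq.trans ?_ (restrictPushMul_app _ _).symm
    obtain ⟨g, hg, -⟩ := he (V ⊓ U) inf_le_right (mres L inf_le_left s)
    refine Eq.trans ?_ (congrArg (· • mres _ (image_preimage_le' _ _) (pullbackSection q L e))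
      (hψ V s g hg).symm)
    have h3 := congrArg (pullbackSection q L) hg
    rw [pullbackSection_smul, pullbackSection_mres, pullbackSection_mres] at h3
    have h4 := congrArg (mres _ (image_preimage_preimage_le q U V)) h3
    rw [mres_smul, mres_mres, mres_mres] at h4
    exact h4
  intro V hV s
  refine ⟨ores (le_image_preimage _ hV)
    (structureModuleEquiv X _ (restrictPushEquiv _ _ (ψ.app _ s))), ?_, fun g hg => ?_⟩
  · have h5 : mres _ (image_preimage_le _ V) s = structureModuleEquiv X _
        (restrictPushEquiv _ _ (ψ.app _ s)) • mres _ (image_preimage_le' _ V)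
          (pullbackSection q L e) :=
      congrArg (fun φ => restrictPushEquiv _ _ (φ.app V s)) h2
    have h6 := congrArg (mres _ (le_image_preimage _ hV)) h5
    simpa using h6
  · subst hg
    rw [Hom.app_smul, restrictPushEquiv_smul, structureModuleEquiv_smul, app_mres,
      restrictPushEquiv_mres, structureModuleEquiv_mres, h1]
    simp

end PullbackFree

end OpenSwallowtail

namespace OpenSwallowtail

open Scheme.Modules

/-! ### From local generators to line bundles and isomorphisms. -/

section LineBundle

variable {X : Scheme.{u}} {M N : X.Modules}

/-- A free generator of `M` on `U` trivializes the restriction of `M` to `U`. -/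
lemma FreelyGenerates.nonempty_iso {U : X.Opens} {e : Γ(M, U)} (he : FreelyGenerates M e) :
    Nonempty (M.restrict U.ι ≅ structureModule U.toScheme) := by
  have hsmul (P : X.Modules) {V : U.toScheme.Opens} (g : Γ(U.toScheme, V))
      (s : Γ(P.restrict U.ι, V)) : (P.restrictAppIso U.ι V).hom (g • s) =
        (show Γ(P, U.ι ''ᵁ V) from (show Γ(X, U.ι ''ᵁ V) from g) •
          (P.restrictAppIso U.ι V).hom s) := by
    change (show Γ(P, U.ι ''ᵁ V) from (U.ι.appIso V).inv.hom g •
      (P.restrictAppIso U.ι V).hom s) = _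
    rw [Scheme.Opens.ι_appIso]
    rfl
  let φ : (structureModule X).restrict U.ι ⟶ M.restrict U.ι :=
    modulesHomMk (fun V => AddMonoidHom.mk' (fun g : Γ(structureModule X, U.ι ''ᵁ V) =>
        (show Γ(M, U.ι ''ᵁ V) from
          structureModuleEquiv X _ g • mres M (U.ι_image_le V) e))
        (fun g h => add_smul (R := Γ(X, U.ι ''ᵁ V)) g h (mres M (U.ι_image_le V) e)))
      (fun V g s => by
        refine Eq.trans ?_ (hsmul M g _).symm
        refine (congrArg (fun a : Γ(X, U.ι ''ᵁ V) => a • mres M (U.ι_image_le V) e)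
          ((hsmul (structureModule X) g s).trans rfl)).trans ?_
        exact mul_smul _ _ _)
      (fun {V V'} h s => by
        refine Eq.trans ?_ (mres_smul M (Scheme.Hom.image_mono _ h) _ _).symm
        rw [mres_mres]
        rfl)
  have hφ : IsIso φ := by
    rw [Hom.isIso_iff_isIso_app]
    intro V
    rw [ConcreteCategory.isIso_iff_bijective]
    have := he _ (U.ι_image_le V)
    refine ⟨fun g h hgh => ?_, fun s => ?_⟩
    · exact (this (φ.app V g)).unique rfl hgh
    · obtain ⟨g, hg, -⟩ := this s
      exact ⟨g, hg.symm⟩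
  exact ⟨(asIso φ).symm ≪≫ restrictUnitIso U.ι⟩

lemma isLineBundle_of_freelyGenerates {ι : Type*} (U : ι → X.Opens) (e : ∀ j, Γ(M, U j))
    (hU : ∀ x, ∃ j, x ∈ U j) (he : ∀ j, FreelyGenerates M (e j)) : IsLineBundle M := by
  intro x
  obtain ⟨j, hj⟩ := hU x
  exact ⟨U j, hj, (he j).nonempty_iso⟩

/-- Two sheaves of modules which are locally generated by sections subject to the same relations are
isomorphic. -/
theorem LocallyGenerated.nonempty_iso {ι : Type} {U : ι → X.Opens} {e : ∀ j, Γ(N, U j)}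
    {m : ∀ j, Γ(M, U j)} (hN : LocallyGenerated N U e) (hM : LocallyGenerated M U m)
    (H : ∀ (j k : ι) (W : X.Opens) (hj : W ≤ U j) (hk : W ≤ U k) (g h : Γ(X, W)),
      g • mres N hj (e j) = h • mres N hk (e k) ↔ g • mres M hj (m j) = h • mres M hk (m k)) :
    Nonempty (N ≅ M) := by
  obtain ⟨φ, hφ⟩ := hN.exists_hom (m := m) fun j k W hj hk g h => (H j k W hj hk g h).1
  obtain ⟨ψ, hψ⟩ := hM.exists_hom (m := e) fun j k W hj hk g h => (H j k W hj hk g h).2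
  refine ⟨⟨φ, ψ, hN.hom_ext fun j => ?_, hM.hom_ext fun j => ?_⟩⟩
  · rw [Hom.comp_app, AddCommGrpCat.comp_apply, hφ, hψ]
    rfl
  · rw [Hom.comp_app, AddCommGrpCat.comp_apply, hψ, hφ]
    rfl

end LineBundle

end OpenSwallowtail

namespace OpenSwallowtail

open Scheme.Modules

/-! ### The sheaf of relative differentials: generators, and detection of nonzero sections. -/

section Differentials

variable {X Y : Scheme.{u}} (f : X ⟶ Y)

/-! ### The structure morphism of the presheaf inverse image -/

lemma unit_pullbackStructure (W : Y.Opens) :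
    ((TopCat.Presheaf.pullbackPushforwardAdjunction CommRingCat.{u} f.base).unit.app
      Y.presheaf).app (.op W) ≫ (pullbackStructure f).app (.op (f ⁻¹ᵁ W)) = f.app W := by
  have h := ((TopCat.Presheaf.pullbackPushforwardAdjunction CommRingCat.{u} f.base).homEquiv
    Y.presheaf X.presheaf).apply_symm_apply f.c
  rw [Adjunction.homEquiv_unit] at h
  exact congrArg (fun φ => φ.app (.op W)) h

/-- Functions pulled back from `Y` lie in the image of the presheaf inverse image, so their
differentials vanish. -/
lemma exists_pullbackStructure_eq {U : X.Opens} {W : Y.Opens} (h : U ≤ f ⁻¹ᵁ W) (a : Γ(Y, W)) :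
    ∃ b, ((pullbackStructure f).app (.op U)).hom b = ores h ((f.app W).hom a) := by
  refine ⟨(((TopCat.Presheaf.pullback CommRingCat.{u} f.base).obj Y.presheaf).map
    (homOfLE h).op).hom ((((TopCat.Presheaf.pullbackPushforwardAdjunction CommRingCat.{u}
      f.base).unit.app Y.presheaf).app (.op W)).hom a), ?_⟩
  rw [← unit_pullbackStructure]
  exact ConcreteCategory.congr_hom ((pullbackStructure f).naturality (homOfLE h).op) _

/-- This reduces the vanishing of a derivation on the presheaf inverse image to its vanishing on the
image of `f.stalkMap`. It is checked on sections coming from open subsets of `Y`, of which the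
presheaf inverse image is a colimit. -/
lemma pullbackStructure_germ {U : X.Opens} {x : X} (hx : x ∈ U) :
    (pullbackStructure f).app (.op U) ≫ X.presheaf.germ U x hx =
      TopCat.Presheaf.germToPullbackStalk CommRingCat f.base Y.presheaf U x hx ≫ f.stalkMap x := by
  refine TopCat.Presheaf.pullback_obj_obj_ext (.op U) fun V hV => ?_
  rw [TopCat.Presheaf.pullbackPushforwardAdjunction_unit_pullback_map_germToPullbackStalk_assoc,
    (pullbackStructure f).naturality_assoc (homOfLE hV).op]
  have h := unit_pullbackStructure f V
  rw [reassoc_of% h, TopCat.Presheaf.germ_res]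
  exact (Scheme.Hom.germ_stalkMap f V x (hV hx)).symm

/-! ### Differentials of functions -/

/-- The module of differentials of the ring of functions on `U` over the presheaf inverse image of the
structure sheaf. -/
abbrev PreOmega (U : X.Opens) : ModuleCat.{u} Γ(X, U) :=
  CommRingCat.KaehlerDifferential ((pullbackStructure f).app (.op U))

/-- The canonical map from the differentials of the ring of functions on `U` to the sections of the
sheaf of differentials. -/
def toOmega (U : X.Opens) : PreOmega f U →ₗ[Γ(X, U)] Γ(Omega f, U) :=
  (((PresheafOfModules.sheafificationAdjunction (𝟙 X.ringCatSheaf.obj)).unit.app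
    (presheafDifferentials f)).app (.op U)).hom

/-- Restriction of differentials. -/
def preOmegaRes {V U : X.Opens} (h : V ≤ U) : PreOmega f U →+ PreOmega f V :=
  ((presheafDifferentials f).presheaf.map (homOfLE h).op).hom

variable {f}

/-- The differential of a function. -/
abbrev preD {U : X.Opens} (b : Γ(X, U)) : PreOmega f U := CommRingCat.KaehlerDifferential.d b

lemma preOmegaRes_d {V U : X.Opens} (h : V ≤ U) (b : Γ(X, U)) :
    preOmegaRes f h (preD b) = preD (ores h b) :=
  PresheafOfModules.DifferentialsConstruction.relativeDifferentials'_map_d _ _ _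

lemma preOmegaRes_smul {V U : X.Opens} (h : V ≤ U) (g : Γ(X, U)) (w : PreOmega f U) :
    preOmegaRes f h (g • w) = ores h g • preOmegaRes f h w :=
  (presheafDifferentials f).map_smul (homOfLE h).op g w

lemma mres_toOmega {V U : X.Opens} (h : V ≤ U) (w : PreOmega f U) :
    mres _ h (toOmega f U w) = toOmega f V (preOmegaRes f h w) :=
  (ConcreteCategory.congr_hom ((CategoryTheory.toSheafify (Opens.grothendieckTopology X)
    (presheafDifferentials f).presheaf).naturality (homOfLE h).op) w).symm

lemma toOmega_locally_surjective {V : X.Opens} (s : Γ(Omega f, V)) {x : X} (hx : x ∈ V) :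
    ∃ (W : X.Opens) (h : W ≤ V) (w : PreOmega f W), x ∈ W ∧ mres _ h s = toOmega f W w := by
  obtain ⟨W, i, ⟨w, hw⟩, hxW⟩ := Presheaf.imageSieve_mem (Opens.grothendieckTopology X)
    (CategoryTheory.toSheafify (Opens.grothendieckTopology X)
    (presheafDifferentials f).presheaf) (U := .op V) s x hx
  exact ⟨W, leOfHom i, w, hxW, hw.symm⟩

lemma toOmega_locally_injective {V : X.Opens} {w : PreOmega f V}
    (hw : toOmega f V w = 0) {x : X} (hx : x ∈ V) :
    ∃ (W : X.Opens) (h : W ≤ V), x ∈ W ∧ preOmegaRes f h w = 0 := by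
  obtain ⟨W, i, h, hxW⟩ := Presheaf.equalizerSieve_mem (Opens.grothendieckTopology X)
    (CategoryTheory.toSheafify (Opens.grothendieckTopology X)
    (presheafDifferentials f).presheaf) (X := .op V) w 0 (hw.trans (map_zero (toOmega f V)).symm)
      x hx
  exact ⟨W, leOfHom i, hxW, h.trans (map_zero _)⟩

variable (f) in
/-- The differential of a function, as a section of the sheaf of relative differentials. -/
def dOmega {U : X.Opens} (b : Γ(X, U)) : Γ(Omega f, U) := toOmega f U (preD b)

lemma dOmega_add {U : X.Opens} (a b : Γ(X, U)) : dOmega f (a + b) = dOmega f a + dOmega f b := by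
  rw [dOmega, dOmega, dOmega, ← map_add]
  exact congrArg _ (ModuleCat.Derivation.d_add _ _ _)

lemma dOmega_mul {U : X.Opens} (a b : Γ(X, U)) :
    dOmega f (a * b) = a • dOmega f b + b • dOmega f a := by
  rw [dOmega, dOmega, dOmega, ← _root_.map_smul, ← _root_.map_smul, ← map_add]
  exact congrArg _ (ModuleCat.Derivation.d_mul _ _ _)

lemma mres_dOmega {V U : X.Opens} (h : V ≤ U) (b : Γ(X, U)) :
    mres _ h (dOmega f b) = dOmega f (ores h b) := by
  rw [dOmega, mres_toOmega, preOmegaRes_d]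
  rfl

lemma dOmega_app {U : X.Opens} {W : Y.Opens} (h : U ≤ f ⁻¹ᵁ W) (a : Γ(Y, W)) :
    dOmega f (ores h ((f.app W).hom a)) = 0 := by
  obtain ⟨b, hb⟩ := exists_pullbackStructure_eq f h a
  rw [← hb, dOmega, ← map_zero (toOmega f U)]
  exact congrArg _ (ModuleCat.Derivation.d_map _ _)

lemma dOmega_zero {U : X.Opens} : dOmega f (0 : Γ(X, U)) = 0 := by
  simpa using dOmega_add (f := f) (0 : Γ(X, U)) 0

lemma dOmega_one {U : X.Opens} : dOmega f (1 : Γ(X, U)) = 0 := by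
  simpa using dOmega_mul (f := f) (1 : Γ(X, U)) 1

lemma span_range_preD (U : X.Opens) :
    Submodule.span Γ(X, U) (Set.range (preD (f := f) (U := U))) = ⊤ := by
  let := ((pullbackStructure f).app (.op U)).hom.toAlgebra
  exact KaehlerDifferential.span_range_derivation _ Γ(X, U)

/-! ### Generators of the sheaf of differentials -/

/-- By the Leibniz rule the functions on `C` whose differential is a multiple of `dt` form a
subring, and it contains the generators. A function `b` on a smaller open subset is locally a
fraction `c / m` of functions on `C`, and then `db = m⁻¹ (dc - b dm)`. -/
lemma exists_dOmega_eq_smul {C : X.Opens} (hC : IsAffineOpen C) {W : Y.Opens}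
    (hCW : C ≤ f ⁻¹ᵁ W) (t : Γ(X, C))
    (hgen : Subring.closure (insert t (Set.range fun a => ores hCW ((f.app W).hom a))) = ⊤)
    {V : X.Opens} (b : Γ(X, V)) {x : X} (hxV : x ∈ V) (hxC : x ∈ C) :
    ∃ (W' : X.Opens) (_ : W' ≤ V) (_ : W' ≤ C) (g : Γ(X, W')), x ∈ W' ∧
      mres _ ‹W' ≤ V› (dOmega f b) = g • mres _ ‹W' ≤ C› (dOmega f t) := by
  have key (c : Γ(X, C)) : ∃ g : Γ(X, C), dOmega f c = g • dOmega f t := by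
    have hc : c ∈ Subring.closure (insert t (Set.range fun a => ores hCW ((f.app W).hom a))) := by
      rw [hgen]; trivial
    induction hc using Subring.closure_induction with
    | mem c hc =>
      rcases hc with rfl | ⟨a, rfl⟩
      · exact ⟨1, (one_smul _ _).symm⟩
      · exact ⟨0, by rw [zero_smul]; exact dOmega_app hCW a⟩
    | zero => exact ⟨0, by rw [zero_smul, dOmega_zero]⟩
    | one => exact ⟨0, by rw [zero_smul, dOmega_one]⟩
    | add a b _ _ ha hb =>
      obtain ⟨g, hg⟩ := ha
      obtain ⟨h, hh⟩ := hb
      exact ⟨g + h, by rw [dOmega_add, hg, hh, add_smul]⟩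
    | neg a _ ha =>
      obtain ⟨g, hg⟩ := ha
      refine ⟨-g, ?_⟩
      have := dOmega_add (f := f) a (-a)
      rw [add_neg_cancel, dOmega_zero, hg] at this
      rw [neg_smul]
      exact (neg_eq_of_add_eq_zero_right this.symm).symm
    | mul a b _ _ ha hb =>
      obtain ⟨g, hg⟩ := ha
      obtain ⟨h, hh⟩ := hb
      exact ⟨a * h + b * g, by rw [dOmega_mul, hg, hh, add_smul, mul_smul, mul_smul]⟩
  obtain ⟨h, hle, hxh⟩ := hC.exists_basicOpen_le (V := V) ⟨x, hxV⟩ hxC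
  have hleC := X.basicOpen_le h
  have := hC.isLocalization_basicOpen h
  obtain ⟨⟨c, m⟩, hcm⟩ := IsLocalization.surj (Submonoid.powers h) (ores hle b)
  have hcm' : ores hle b * ores hleC m.1 = ores hleC c := hcm
  obtain ⟨u, hu⟩ : IsUnit (ores hleC m.1) := IsLocalization.map_units _ m
  obtain ⟨g, hg⟩ := key c
  obtain ⟨g', hg'⟩ := key m.1
  refine ⟨X.basicOpen h, hle, hleC, (↑u⁻¹ : Γ(X, X.basicOpen h)) *
    (ores hleC g - ores hle b * ores hleC g'), hxh, ?_⟩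
  have h1 := congrArg (dOmega f) hcm'
  rw [dOmega_mul, ← mres_dOmega, ← mres_dOmega, ← mres_dOmega, hg, hg', mres_smul, mres_smul,
    ← hu] at h1
  rw [mul_smul, sub_smul, ← h1, mul_smul, add_sub_cancel_left, smul_smul, Units.inv_mul, one_smul]

/-- On an affine open subset whose functions are generated by a function `t` and functions from the
base, the sheaf of relative differentials is generated by the differential of `t`. -/
theorem exists_eq_smul_dOmega {C : X.Opens} (hC : IsAffineOpen C) {W : Y.Opens}
    (hCW : C ≤ f ⁻¹ᵁ W) (t : Γ(X, C))
    (hgen : Subring.closure (insert t (Set.range fun a => ores hCW ((f.app W).hom a))) = ⊤) :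
    GeneratesOn (Omega f) (dOmega f t) := by
  intro V s x hxV hxC
  obtain ⟨V', hV', w, hx, hw⟩ := toOmega_locally_surjective s hxV
  suffices ∃ (W' : X.Opens) (_ : W' ≤ V') (_ : W' ≤ C) (g : Γ(X, W')), x ∈ W' ∧
      mres _ ‹W' ≤ V'› (toOmega f V' w) = g • mres _ ‹W' ≤ C› (dOmega f t) by
    obtain ⟨W', h1, h2, g, hxW', hg⟩ := this
    exact ⟨W', h1.trans hV', h2, g, hxW', by rw [← hg, ← hw, mres_mres]⟩
  clear hw
  have hspan : w ∈ Submodule.span Γ(X, V') (Set.range (preD (f := f) (U := V'))) := by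
    rw [span_range_preD]; trivial
  induction hspan using Submodule.span_induction with
  | mem w hw =>
    obtain ⟨b, rfl⟩ := hw
    exact exists_dOmega_eq_smul hC hCW t hgen b hx hxC
  | zero => exact ⟨V' ⊓ C, inf_le_left, inf_le_right, 0, ⟨hx, hxC⟩, by simp⟩
  | add w w' _ _ h h' =>
    obtain ⟨W₁, h1, h2, g, hx1, hg⟩ := h
    obtain ⟨W₂, h3, h4, g', hx2, hg'⟩ := h'
    refine ⟨W₁ ⊓ W₂, inf_le_left.trans h1, inf_le_left.trans h2,
      ores inf_le_left g + ores inf_le_right g', ⟨hx1, hx2⟩, ?_⟩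
    have e1 := congrArg (mres _ (inf_le_left : W₁ ⊓ W₂ ≤ W₁)) hg
    have e2 := congrArg (mres _ (inf_le_right : W₁ ⊓ W₂ ≤ W₂)) hg'
    simp only [mres_mres, mres_smul] at e1 e2
    rw [map_add, map_add, e1, e2, add_smul]
  | smul a w _ h =>
    obtain ⟨W₁, h1, h2, g, hx1, hg⟩ := h
    exact ⟨W₁, h1, h2, ores h1 a * g, hx1, by rw [_root_.map_smul, mres_smul, hg, mul_smul]⟩

/-! ### Relations in the sheaf of differentials -/

lemma exists_moduleCat {A R : Type u} [CommRing A] [CommRing R] (ρ : A →+* R) :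
    ∃ (M : ModuleCat.{u} A) (φ : R ≃+ M), ∀ (a : A) (r : R), φ (ρ a * r) = a • φ r :=
  let := Module.compHom R ρ
  ⟨ModuleCat.of A R, AddEquiv.refl R, fun _ _ => rfl⟩

open TrivSqZeroExt in
/-- A tangent vector of `X` along the fibres of `f`, with values in a ring `R`, detects that a multiple of a
differential does not vanish. -/
theorem mul_snd_eq_zero_of_smul_dOmega_eq_zero {R : Type u} [CommRing R] {x : X}
    (E : X.presheaf.stalk x →+* TrivSqZeroExt R R)
    (hE : ∀ a, E ((f.stalkMap x).hom a) = inl (fst (E ((f.stalkMap x).hom a))))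
    {V : X.Opens} (hx : x ∈ V) (g t : Γ(X, V)) (h : g • dOmega f t = 0) :
    fst (E ((X.presheaf.germ V x hx).hom g)) * snd (E ((X.presheaf.germ V x hx).hom t)) = 0 := by
  rw [dOmega, ← _root_.map_smul] at h
  -- A relation in the associated sheaf already holds in the presheaf near `x`, where the universal
  -- property of Kähler differentials applies.
  obtain ⟨W, hW, hxW, hw⟩ := toOmega_locally_injective h hx
  rw [preOmegaRes_smul, preOmegaRes_d] at hw
  let ρ : Γ(X, W) →+* TrivSqZeroExt R R := E.comp (X.presheaf.germ W x hxW).hom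
  obtain ⟨M, φ, hφ⟩ := exists_moduleCat ((fstHom ℤ R R).toRingHom.comp ρ)
  have hfst (c : Γ(X, V)) : ρ (ores hW c) = E ((X.presheaf.germ V x hx).hom c) :=
    congrArg E (TopCat.Presheaf.germ_res_apply X.presheaf (homOfLE hW) x hxW c)
  -- The `ε`-component of a ring homomorphism to `R[ε]` is a derivation into `R`, which is a module
  -- through the first component. It kills the base by `hE`.
  let D : M.Derivation ((pullbackStructure f).app (.op W)) :=
    ModuleCat.Derivation.mk (M := M) (fun b => φ (snd (ρ b)))
      (fun b b' => by rw [map_add, snd_add, map_add])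
      (fun b b' => by
        rw [← hφ, ← hφ, ← map_add, map_mul, snd_mul]
        simp [mul_comm])
      (fun a => by
        have h2 := ConcreteCategory.congr_hom (pullbackStructure_germ f hxW) a
        rw [map_eq_zero_iff φ φ.injective]
        change snd (E ((X.presheaf.germ W x hxW).hom _)) = (0 : R)
        refine (congrArg (fun c => snd (E c)) h2).trans ?_
        exact (congrArg snd (hE _)).trans (snd_inl _ _))
  have h1 := congrArg D.desc hw
  rw [_root_.map_smul, map_zero, ModuleCat.Derivation.desc_d] at h1
  change _ • φ (snd (ρ (ores hW t))) = 0 at h1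
  rw [← hφ, map_eq_zero_iff φ φ.injective, hfst] at h1
  refine Eq.trans ?_ h1
  rw [← hfst]
  rfl

end Differentials

end OpenSwallowtail

namespace OpenSwallowtail

attribute [local instance] MvPolynomial.gradedAlgebra

/-! ### Functions on the standard charts of projective space. -/

section ProjSpace

variable {K : Type u} [Field K] {ι : Type}

/-- With weights 0 and 1 this covers ordinary scaling as well as scaling only the `a_k` or only `x,
y`, as needed for changes of chart. -/
lemma eval₂_of_isWeightedHomogeneous {σ : Type*} {R : Type*} [CommRing R] (g : K →+* R) (x : σ → R)
    (u : R) {w : σ → ℕ} {D : MvPolynomial σ K} {d : ℕ} (hD : IsWeightedHomogeneous w D d) :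
    eval₂ g (fun k => u ^ w k * x k) D = u ^ d * eval₂ g x D := by
  rw [eval₂_eq, eval₂_eq, Finset.mul_sum]
  refine Finset.sum_congr rfl fun m hm => ?_
  have h := hD (mem_support_iff.1 hm)
  rw [Finsupp.weight_apply, Finsupp.sum] at h
  simp_rw [mul_pow, Finset.prod_mul_distrib, ← pow_mul]
  rw [Finset.prod_pow_eq_pow_sum, ← h]
  simp_rw [smul_eq_mul, mul_comm (w _)]
  ring

namespace ProjSpace

/-- The inclusion of constants into the ring of functions on an open subset. -/
def const (U : (ProjSpace K ι).Opens) : K →+* Γ(ProjSpace K ι, U) :=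
  (ores (le_top : U ≤ ⊤)).comp ((Scheme.ΓSpecIso (CommRingCat.of K)).inv ≫
    (toSpec K ι).appTop).hom

/-- The homogeneous localization at a coordinate. -/
abbrev AwayX (K : Type u) [Field K] {ι : Type} (i : ι) : Type u :=
  HomogeneousLocalization.Away (homogeneousSubmodule ι K) (X i)

variable (K) in
lemma X_mem (i : ι) : (X i : MvPolynomial ι K) ∈ homogeneousSubmodule ι K 1 := isHomogeneous_X K i

variable (K) in
lemma isAffineOpen_chart (i : ι) : IsAffineOpen (chart K i) :=
  Proj.isAffineOpen_basicOpen (homogeneousSubmodule ι K) (X i) (X_mem K i) zero_lt_one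

/-- The embedding into the localization. -/
def awayVal (i : ι) : AwayX K i →+* Localization.Away (X i : MvPolynomial ι K) := algebraMap _ _

variable (K) in
/-- The constants. -/
def awayConst (i : ι) : K →+* AwayX K i :=
  (HomogeneousLocalization.fromZeroRingHom _ _).comp (algebraMap K (homogeneousSubmodule ι K 0))

/-- The fraction `D / X_i ^ d`, for a homogeneous polynomial `D` of degree `d`. -/
def awayFrac (i : ι) (d : ℕ) (D : MvPolynomial ι K) (hD : D ∈ homogeneousSubmodule ι K (d • 1)) :
    AwayX K i :=
  HomogeneousLocalization.Away.mk (homogeneousSubmodule ι K) (X_mem K i) d D hD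

variable (K) in
/-- The fraction `X_k / X_i`. -/
def awayRatio (i k : ι) : AwayX K i := awayFrac i 1 (X k) (X_mem K k)

lemma awayVal_injective (i : ι) : Function.Injective (awayVal (K := K) i) :=
  HomogeneousLocalization.val_injective _

lemma awayVal_awayConst (i : ι) (c : K) :
    awayVal i (awayConst K i c) = algebraMap (MvPolynomial ι K) _ (C c) :=
  Localization.mk_one_eq_algebraMap _

lemma awayVal_awayFrac (i : ι) (d : ℕ) (D : MvPolynomial ι K)
    (hD : D ∈ homogeneousSubmodule ι K (d • 1)) :
    algebraMap (MvPolynomial ι K) _ (X i) ^ d * awayVal i (awayFrac i d D hD) =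
      algebraMap _ _ D := by
  change _ * HomogeneousLocalization.val (awayFrac i d D hD) = _
  rw [awayFrac, HomogeneousLocalization.Away.val_mk, Localization.mk_eq_mk', ← map_pow, mul_comm]
  exact IsLocalization.mk'_spec _ D (⟨X i ^ d, d, rfl⟩ : Submonoid.powers (X i : MvPolynomial ι K))

/-- Multiplied by the unit `X_i ^ d` of the localization, both sides become `D`: by homogeneity the
power is distributed over the variables, and `X_i · (X_k / X_i) = X_k`. -/
lemma awayFrac_eq_eval₂ (i : ι) (d : ℕ) (D : MvPolynomial ι K)
    (hD : D ∈ homogeneousSubmodule ι K (d • 1)) :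
    awayFrac i d D hD = eval₂ (awayConst K i) (awayRatio K i) D := by
  have hu : IsUnit (algebraMap (MvPolynomial ι K) (Localization.Away (X i : MvPolynomial ι K))
      (X i)) := IsLocalization.Away.algebraMap_isUnit _
  apply awayVal_injective
  apply (hu.pow d).mul_left_cancel
  have hD' : IsWeightedHomogeneous (1 : ι → ℕ) D d := by
    rw [smul_eq_mul, mul_one] at hD
    exact hD
  rw [awayVal_awayFrac, eval₂_comp_left, ← eval₂_of_isWeightedHomogeneous _ _ _ hD']
  have e := eval₂_comp_left
    (algebraMap (MvPolynomial ι K) (Localization.Away (X i : MvPolynomial ι K))) C X D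
  rw [eval₂_eta] at e
  rw [e]
  congr 1
  ext k
  have := awayVal_awayFrac i 1 (X k) (X_mem K k)
  simpa [awayRatio] using this.symm

variable (K) in
/-- The ring of functions on a chart. -/
def chartEquiv (i : ι) : AwayX K i ≃+* Γ(ProjSpace K ι, chart K i) :=
  (Proj.basicOpenIsoAway (homogeneousSubmodule ι K) (X i) (X_mem K i)
    zero_lt_one).commRingCatIsoToRingEquiv

lemma chartEquiv_awayRatio (i k : ι) : chartEquiv K i (awayRatio K i k) = ratio K i k := rfl

variable (K) in
/-- The map from a chart to the spectrum of its ring of functions. -/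
def chartToSpec (i : ι) : (chart K i).toScheme ⟶ Spec (CommRingCat.of (AwayX K i)) :=
  Proj.basicOpenToSpec (homogeneousSubmodule ι K) (X i)

lemma chart_ι_toSpec (i : ι) : (chart K i).ι ≫ toSpec K ι =
    chartToSpec K i ≫
      Spec.map (CommRingCat.ofHom (awayConst K i)) := by
  have h2 := Proj.awayι_toSpecZero (homogeneousSubmodule ι K) (X i) (X_mem K i) zero_lt_one
  rw [← Proj.basicOpenIsoSpec_inv_ι, Category.assoc, Iso.inv_comp_eq,
    Proj.basicOpenIsoSpec_hom] at h2
  refine (reassoc_of% h2) _ |>.trans ?_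
  rw [← Spec.map_comp]
  rfl

lemma chartEquiv_awayConst (i : ι) (c : K) :
    chartEquiv K i (awayConst K i c) = const (chart K i) c := by
  have h3 := congrArg Scheme.Hom.appTop (chart_ι_toSpec (K := K) i)
  rw [Scheme.Hom.comp_appTop, Scheme.Hom.comp_appTop] at h3
  have h4 := Proj.basicOpenToSpec_app_top (homogeneousSubmodule ι K) (X i)
  have h5 := Scheme.ΓSpecIso_inv_naturality (CommRingCat.ofHom (awayConst K i))
  have h6 : (chart K i).ι.appTop ≫ (chart K i).topIso.hom =
      (ProjSpace K ι).presheaf.map (homOfLE (le_top : chart K i ≤ ⊤)).op := by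
    simp [Scheme.Opens.topIso, Scheme.Hom.appTop]
    rfl
  let a : CommRingCat.of (AwayX K i) ⟶ Γ(ProjSpace K ι, chart K i) :=
    Proj.awayToSection (homogeneousSubmodule ι K) (X i)
  have h8 : (Scheme.ΓSpecIso (CommRingCat.of (AwayX K i))).inv ≫
      (chartToSpec K i).appTop ≫ (chart K i).topIso.hom = a := by
    rw [Iso.inv_comp_eq, ← Iso.eq_comp_inv]
    exact h4.trans (Category.assoc _ _ _).symm
  have h7 : (Scheme.ΓSpecIso (CommRingCat.of K)).inv ≫ (toSpec K ι).appTop ≫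
      (ProjSpace K ι).presheaf.map (homOfLE (le_top : chart K i ≤ ⊤)).op =
        CommRingCat.ofHom (awayConst K i) ≫ a := by
    rw [← h6, reassoc_of% h3, ← reassoc_of% h5, h8]
  exact (ConcreteCategory.congr_hom h7 c).symm

lemma exists_eq_eval₂ (i : ι) (g : Γ(ProjSpace K ι, chart K i)) :
    ∃ d D, D ∈ homogeneousSubmodule ι K d ∧ g = eval₂ (const _) (ratio K i) D := by
  obtain ⟨z, rfl⟩ := (chartEquiv K i).surjective g
  obtain ⟨d, D, hD, rfl⟩ := HomogeneousLocalization.Away.mk_surjective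
    (homogeneousSubmodule ι K) (X_mem K i) z
  refine ⟨d • 1, D, hD, ?_⟩
  change chartEquiv K i (awayFrac i d D hD) = _
  rw [awayFrac_eq_eval₂]
  refine (eval₂_comp_left (chartEquiv K i).toRingHom _ _ _).trans ?_
  congr 1
  ext c
  exact chartEquiv_awayConst i c

/-- Evaluation at `v` sends `X_i` to 1, so it extends to the localization at `X_i`. -/
lemma exists_hom_of_chart {R : Type u} [CommRing R] (c : K →+* R) (v : ι → R) (i : ι)
    (hv : v i = 1) : ∃ φ : Γ(ProjSpace K ι, chart K i) →+* R,
      (∀ a, φ (const _ a) = c a) ∧ ∀ k, φ (ratio K i k) = v k := by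
  have hu : IsUnit (eval₂Hom c v (X i)) := by simp [hv]
  let ψ : Localization.Away (X i : MvPolynomial ι K) →+* R :=
    IsLocalization.Away.lift (X i : MvPolynomial ι K) hu
  have hψ (D : MvPolynomial ι K) : ψ (algebraMap _ _ D) = eval₂ c v D :=
    IsLocalization.Away.lift_eq _ hu D
  refine ⟨(ψ.comp (awayVal i)).comp ((chartEquiv K i).symm : _ →+* AwayX K i),
    fun a => ?_, fun k => ?_⟩
  · rw [← chartEquiv_awayConst]
    simp [awayVal_awayConst, hψ]
  · rw [← chartEquiv_awayRatio]
    have := congrArg ψ (awayVal_awayFrac i 1 (X k) (X_mem K k))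
    simpa [hψ, hv, awayRatio] using this

lemma iSup_chart : ⨆ i, chart K (ι := ι) i = ⊤ := by
  refine Proj.iSup_basicOpen_eq_top' (homogeneousSubmodule ι K) X
    (fun i => ⟨1, isHomogeneous_X K i⟩) ?_
  rw [eq_top_iff]
  rintro p -
  induction p using MvPolynomial.induction_on with
  | C a => exact Subalgebra.algebraMap_mem _ (algebraMap K (homogeneousSubmodule ι K 0) a)
  | add p q hp hq => exact add_mem hp hq
  | mul_X p i hp => exact mul_mem hp (Algebra.subset_adjoin ⟨i, rfl⟩)

end ProjSpace

end ProjSpace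

end OpenSwallowtail

namespace OpenSwallowtail

attribute [local instance] MvPolynomial.gradedAlgebra

open ProjSpace Limits

/-! ### Charts of the product and their rings of functions. -/

section Product

/-- The subring generated by both images receives compatible maps from `B` and `C`. The induced map
from `P` to it, followed by the inclusion, is the identity by uniqueness. -/
lemma ringHom_closure_eq_top_of_isPushout {A B C P : CommRingCat.{u}} {f : A ⟶ B} {g : A ⟶ C}
    {inl : B ⟶ P} {inr : C ⟶ P} (h : IsPushout f g inl inr) :
    Subring.closure (Set.range inl.hom ∪ Set.range inr.hom) = ⊤ := by
  set S := Subring.closure (Set.range inl.hom ∪ Set.range inr.hom) with hS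
  let l : B ⟶ CommRingCat.of S := CommRingCat.ofHom (inl.hom.codRestrict S fun b =>
    Subring.subset_closure (Or.inl ⟨b, rfl⟩))
  let r : C ⟶ CommRingCat.of S := CommRingCat.ofHom (inr.hom.codRestrict S fun b =>
    Subring.subset_closure (Or.inr ⟨b, rfl⟩))
  have hlr : f ≫ l = g ≫ r := by
    refine CommRingCat.hom_ext (RingHom.ext fun a => Subtype.ext ?_)
    exact ConcreteCategory.congr_hom h.w a
  have hid : h.desc l r hlr ≫ CommRingCat.ofHom S.subtype = 𝟙 P := by
    apply h.hom_ext
    · rw [h.inl_desc_assoc, Category.comp_id]; rfl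
    · rw [h.inr_desc_assoc, Category.comp_id]; rfl
  rw [eq_top_iff]
  rintro p -
  rw [← show S.subtype ((h.desc l r hlr).hom p) = p from ConcreteCategory.congr_hom hid p]
  exact Subtype.property _

lemma exists_ringHom_of_isPushout {A B C P : CommRingCat.{u}} {f : A ⟶ B} {g : A ⟶ C}
    {inl : B ⟶ P} {inr : C ⟶ P} (h : IsPushout f g inl inr) {R : Type u} [CommRing R]
    (φ : B →+* R) (ψ : C →+* R) (w : φ.comp f.hom = ψ.comp g.hom) :
    ∃ Φ : P →+* R, (∀ b, Φ (inl.hom b) = φ b) ∧ ∀ c, Φ (inr.hom c) = ψ c := by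
  have w' : f ≫ CommRingCat.ofHom φ = g ≫ CommRingCat.ofHom ψ := CommRingCat.hom_ext w
  exact ⟨(h.desc _ _ w').hom, fun b => ConcreteCategory.congr_hom (h.inl_desc _ _ w') b,
    fun c => ConcreteCategory.congr_hom (h.inr_desc _ _ w') c⟩

variable (K : Type u) [Field K] (n : ℕ) (i : Fin (n + 1)) (j : Fin 2)

/-- Functions on a chart of `P(V)` as functions on a chart of `P`. -/
def fromPV : Γ(PV K n, chart K i) →+* Γ(PP K n, PPchart K n i j) :=
  (ores inf_le_left).comp ((prV K n).app (chart K i)).hom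

/-- Functions on a chart of `P(W)` as functions on a chart of `P`. -/
def fromPW : Γ(PW K, chart K j) →+* Γ(PP K n, PPchart K n i j) :=
  (ores inf_le_right).comp ((prW K n).app (chart K j)).hom

lemma isPullback_prV_prW : IsPullback (prV K n) (prW K n) (toSpec K (Fin (n + 1)))
    (toSpec K (Fin 2)) := IsPullback.of_hasPullback _ _

lemma isAffineOpen_PPchart : IsAffineOpen (PPchart K n i j) := by
  have h := Scheme.Hom.isPullback_resLE (isPullback_prV_prW K n)
    (US := ⊤) (UT := chart K j) (UX := chart K i) (UY := PPchart K n i j) le_top le_top rfl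
  have : IsAffine (chart K i).toScheme := isAffineOpen_chart K i
  have : IsAffine (chart K j).toScheme := isAffineOpen_chart K j
  have : IsAffine (⊤ : (Spec (CommRingCat.of K)).Opens).toScheme := isAffineOpen_top _
  exact .of_isIso h.isoPullback.hom

lemma isPushout_PPchart : IsPushout
    ((toSpec K (Fin (n + 1))).appLE ⊤ (chart K i) le_top)
    ((toSpec K (Fin 2)).appLE ⊤ (chart K j) le_top)
    ((prV K n).appLE (chart K i) (PPchart K n i j) inf_le_left)
    ((prW K n).appLE (chart K j) (PPchart K n i j) inf_le_right) :=
  (isIso_pushoutSection_iff (isPullback_prV_prW K n) le_top le_top rfl).1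
    (isIso_pushoutSection_of_isAffineOpen (isPullback_prV_prW K n) le_top le_top rfl
      (isAffineOpen_top _) (isAffineOpen_chart K j) (isAffineOpen_chart K i))

variable {K n}

lemma ores_PPconst {V U : (PP K n).Opens} (h : V ≤ U) (c : K) :
    ores h (PPconst K n U c) = PPconst K n V c := by
  change ores h (ores le_top _) = ores le_top _
  rw [ores_ores]

lemma fromPW_const (c : K) : fromPW K n i j (const _ c) = PPconst K n _ c := by
  change ores _ (((prW K n).app _).hom (ores le_top _)) = ores le_top _
  rw [app_ores, ores_ores]
  rfl

lemma fromPV_const (c : K) : fromPV K n i j (const _ c) = PPconst K n _ c := by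
  have h := congrArg Scheme.Hom.appTop (isPullback_prV_prW K n).w
  change ores _ (((prV K n).app _).hom (ores le_top _)) = ores le_top
    ((((Scheme.ΓSpecIso (CommRingCat.of K)).inv ≫ (prW K n ≫ toSpec K (Fin 2)).appTop)).hom c)
  rw [app_ores, ores_ores, ← h]
  rfl

lemma fromPV_ratio (k : Fin (n + 1)) :
    fromPV K n i j (ratio K i k) = PPcoord K n i j (Sum.inl k) := rfl

lemma fromPW_ratio (k : Fin 2) :
    fromPW K n i j (ratio K j k) = PPcoord K n i j (Sum.inr k) := rfl

lemma ratio_self {ι : Type} (i : ι) : ratio K i i = 1 := by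
  rw [← chartEquiv_awayRatio, ← map_one (chartEquiv K i)]
  congr 1
  apply awayVal_injective
  have hu : IsUnit (algebraMap (MvPolynomial ι K) (Localization.Away (X i : MvPolynomial ι K))
      (X i)) := IsLocalization.Away.algebraMap_isUnit _
  have := awayVal_awayFrac i 1 (X i) (X_mem K i)
  rw [pow_one] at this
  rw [map_one]
  exact hu.mul_left_cancel (this.trans (mul_one _).symm)

@[simp]
lemma PPcoord_inr_self : PPcoord K n i j (Sum.inr j) = 1 := by
  rw [← fromPW_ratio, ratio_self, map_one]

lemma fromPV_eval₂ (D : MvPolynomial (Fin (n + 1)) K) :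
    fromPV K n i j (eval₂ (const _) (ratio K i) D) = dehomogenize (rename Sum.inl D) i j := by
  rw [eval₂_comp_left, dehomogenize, eval₂_rename]
  congr 1
  ext c
  exact fromPV_const i j c

lemma fromPW_eval₂ (D : MvPolynomial (Fin 2) K) :
    fromPW K n i j (eval₂ (const _) (ratio K j) D) = dehomogenize (rename Sum.inr D) i j := by
  rw [eval₂_comp_left, dehomogenize, eval₂_rename]
  congr 1
  ext c
  exact fromPW_const i j c

lemma exists_eq_dehomogenize (g : Γ(PP K n, PPchart K n i j)) :
    ∃ G, g = dehomogenize G i j := by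
  have hg : g ∈ Subring.closure (Set.range (fromPV K n i j) ∪ Set.range (fromPW K n i j)) := by
    have := ringHom_closure_eq_top_of_isPushout (isPushout_PPchart K n i j)
    exact this.ge trivial
  suffices h : Subring.closure (Set.range (fromPV K n i j) ∪ Set.range (fromPW K n i j)) ≤
      (eval₂Hom (PPconst K n _) (PPcoord K n i j)).range by
    obtain ⟨G, hG⟩ := h hg
    exact ⟨G, hG.symm⟩
  rw [Subring.closure_le]
  rintro _ (⟨a, rfl⟩ | ⟨a, rfl⟩)
  · obtain ⟨-, D, -, rfl⟩ := exists_eq_eval₂ i a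
    exact ⟨_, (fromPV_eval₂ i j D).symm⟩
  · obtain ⟨-, D, -, rfl⟩ := exists_eq_eval₂ j a
    exact ⟨_, (fromPW_eval₂ i j D).symm⟩

/-- Functions on a chart are generated by the functions from `P(V)` and the affine coordinate of
`P(W)`. -/
lemma closure_eq_top_of_ne {j' : Fin 2} (hj : j' ≠ j) :
    Subring.closure (insert (PPcoord K n i j (Sum.inr j')) (Set.range (fromPV K n i j))) = ⊤ := by
  rw [eq_top_iff]
  rintro g -
  obtain ⟨G, rfl⟩ := exists_eq_dehomogenize i j g
  rw [dehomogenize]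
  have hV (a) : fromPV K n i j a ∈
      Subring.closure (insert (PPcoord K n i j (Sum.inr j')) (Set.range (fromPV K n i j))) :=
    Subring.subset_closure (Or.inr ⟨a, rfl⟩)
  induction G using MvPolynomial.induction_on with
  | C c => rw [eval₂_C, ← fromPV_const]; exact hV _
  | add p q hp hq => rw [eval₂_add]; exact add_mem hp hq
  | mul_X p k hp =>
    rw [eval₂_mul, eval₂_X]
    refine mul_mem hp ?_
    rcases k with k | k
    · rw [← fromPV_ratio]; exact hV _
    · by_cases hk : k = j
      · rw [hk, PPcoord_inr_self]; exact one_mem _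
      · have : k = j' := by omega
        rw [this]; exact Subring.subset_closure (Or.inl rfl)

lemma exists_hom_of_PPchart {R : Type u} [CommRing R] (φ : Γ(PV K n, chart K i) →+* R)
    (v : Fin 2 → R) (hj : v j = 1) : ∃ Φ : Γ(PP K n, PPchart K n i j) →+* R,
      (∀ a, Φ (fromPV K n i j a) = φ a) ∧ ∀ k, Φ (PPcoord K n i j (Sum.inr k)) = v k := by
  obtain ⟨ψ, hψ, hψ'⟩ := exists_hom_of_chart (φ.comp (const _)) v j hj
  obtain ⟨Φ, h1, h2⟩ := exists_ringHom_of_isPushout (isPushout_PPchart K n i j) φ ψ (by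
    refine RingHom.ext fun a => ?_
    obtain ⟨c, rfl⟩ := (Scheme.ΓSpecIso (CommRingCat.of K)).commRingCatIsoToRingEquiv.symm.surjective a
    exact (hψ c).symm)
  exact ⟨Φ, h1, fun k => (h2 _).trans (hψ' k)⟩

variable (K n) in
lemma exists_mem_PPchart (x : PP K n) : ∃ i j, x ∈ PPchart K n i j := by
  obtain ⟨i, hi⟩ := Opens.mem_iSup.1 ((iSup_chart (K := K)).ge (Opens.mem_top (prV K n x)))
  obtain ⟨j, hj⟩ := Opens.mem_iSup.1 ((iSup_chart (K := K)).ge (Opens.mem_top (prW K n x)))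
  exact ⟨i, j, hi, hj⟩

end Product

end OpenSwallowtail

namespace OpenSwallowtail

attribute [local instance] MvPolynomial.gradedAlgebra

open ProjSpace Limits

/-! ### Changes of chart, and the ideal sheaf of bihomogeneous equations on a chart. -/

section Transition

variable {K : Type u} [Field K] {ι : Type}

/-- The homogeneous prime ideal of a point of projective space. -/
def primeIdeal (p : ProjSpace K ι) : Ideal (MvPolynomial ι K) :=
  (ProjectiveSpectrum.asHomogeneousIdeal (𝒜 := homogeneousSubmodule ι K) p).toIdeal

instance (p : ProjSpace K ι) : (primeIdeal p).IsPrime :=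
  ProjectiveSpectrum.isPrime (𝒜 := homogeneousSubmodule ι K) p

/-- The value of a function at a point. -/
def evalAt {U : (ProjSpace K ι).Opens} (p : U) :
    Γ(ProjSpace K ι, U) →+* Localization.AtPrime (primeIdeal p.1) where
  toFun g := HomogeneousLocalization.val (𝒜 := homogeneousSubmodule ι K) (g.1 p)
  map_one' := HomogeneousLocalization.val_one
  map_zero' := HomogeneousLocalization.val_zero
  map_add' _ _ := HomogeneousLocalization.val_add _ _
  map_mul' _ _ := HomogeneousLocalization.val_mul _ _

lemma evalAt_ext {U : (ProjSpace K ι).Opens} {g h : Γ(ProjSpace K ι, U)}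
    (H : ∀ p, evalAt p g = evalAt p h) : g = h :=
  Subtype.ext (funext fun p => HomogeneousLocalization.val_injective _ (H p))

lemma isUnit_X_of_mem_chart (i : ι) (p : ProjSpace K ι) (h : p ∈ chart K i) :
    IsUnit (algebraMap (MvPolynomial ι K) (Localization.AtPrime (primeIdeal p)) (X i)) :=
  IsLocalization.map_units _ (⟨X i, h⟩ : (primeIdeal p).primeCompl)

lemma mul_evalAt_ratio (i k : ι) {U : (ProjSpace K ι).Opens} (h : U ≤ chart K i) (p : U) :
    algebraMap (MvPolynomial ι K) (Localization.AtPrime (primeIdeal p.1)) (X i) *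
      evalAt p (ores h (ratio K i k)) = algebraMap (MvPolynomial ι K) _ (X k) := by
  have hp : Submonoid.powers (X i : MvPolynomial ι K) ≤
      (primeIdeal p.1).primeCompl.comap (RingHom.id (MvPolynomial ι K)) :=
    Submonoid.powers_le.mpr (h p.2)
  have a : evalAt p (ores h (ratio K i k)) = IsLocalization.map
      (Localization.AtPrime (primeIdeal p.1)) (RingHom.id _) hp (awayVal i (awayRatio K i k)) :=
    ProjectiveSpectrum.Proj.awayToSection_apply (𝒜 := homogeneousSubmodule ι K) (X i)
      (awayRatio K i k) ⟨p.1, h p.2⟩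
  have c := congrArg (IsLocalization.map (Localization.AtPrime (primeIdeal p.1))
    (RingHom.id (MvPolynomial ι K)) hp) (awayVal_awayFrac i 1 (X k) (X_mem K k))
  rw [pow_one, map_mul, IsLocalization.map_eq, IsLocalization.map_eq] at c
  exact (congrArg _ a).trans c

/-- Compared in the local rings of points, where `X i` is a unit and both sides times `X i` equal `X
k`. -/
lemma ores_ratio (i i' k : ι) {U : (ProjSpace K ι).Opens} (h : U ≤ chart K i)
    (h' : U ≤ chart K i') :
    ores h (ratio K i k) = ores h (ratio K i i') * ores h' (ratio K i' k) := by
  refine evalAt_ext fun p => (isUnit_X_of_mem_chart i p.1 (h p.2)).mul_left_cancel ?_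
  rw [mul_evalAt_ratio, map_mul, ← mul_assoc, mul_evalAt_ratio, mul_evalAt_ratio]

variable (K) in
lemma isSeparated_toSpec : IsSeparated (toSpec K ι) := by
  have : IsSeparated (Proj.toSpecZero (homogeneousSubmodule ι K)) := inferInstance
  exact MorphismProperty.comp_mem _ _ _ this inferInstance

/-- Separatedness makes the intersection of a chart with an affine open subset affine, as
`mem_ideal_map_opens_ι` requires. -/
instance (n : ℕ) : (PP K n).IsSeparated := by
  have h1 := isSeparated_toSpec K (ι := Fin (n + 1))
  have h2 := isSeparated_toSpec K (ι := Fin 2)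
  have h : IsSeparated (prV K n) :=
    inferInstanceAs (IsSeparated (pullback.fst (toSpec K (Fin (n + 1))) (toSpec K (Fin 2))))
  constructor
  rw [← terminal.comp_from (prV K n ≫ toSpec K (Fin (n + 1)))]
  infer_instance

variable {n : ℕ}

lemma PPchart_le_left (i : Fin (n + 1)) (j : Fin 2) :
    PPchart K n i j ≤ prV K n ⁻¹ᵁ chart K i := inf_le_left

lemma PPchart_le_right (i : Fin (n + 1)) (j : Fin 2) :
    PPchart K n i j ≤ prW K n ⁻¹ᵁ chart K j := inf_le_right

lemma ores_PPcoord_inl (i i' : Fin (n + 1)) (j j' : Fin 2) {U : (PP K n).Opens}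
    (h : U ≤ PPchart K n i j) (h' : U ≤ PPchart K n i' j') (k) :
    ores h (PPcoord K n i j (.inl k)) =
      ores h (PPcoord K n i j (.inl i')) * ores h' (PPcoord K n i' j' (.inl k)) := by
  have hU : U ≤ prV K n ⁻¹ᵁ (chart K i ⊓ chart K i') :=
    le_inf (h.trans (PPchart_le_left i j)) (h'.trans (PPchart_le_left i' j'))
  let F := (ores hU).comp ((prV K n).app (chart K i ⊓ chart K i')).hom
  have hF {l} (hl : chart K i ⊓ chart K i' ≤ chart K l) (k) (m) (hm : U ≤ PPchart K n l m) :
      F (ores hl (ratio K l k)) = ores hm (PPcoord K n l m (.inl k)) := by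
    refine (congrArg (ores hU) (app_ores _ _ _)).trans ?_
    exact (ores_ores _ _ _).trans (ores_ores _ _ _).symm
  rw [← hF inf_le_left, ← hF inf_le_left, ← hF inf_le_right, ← map_mul, ← ores_ratio]

lemma ores_PPcoord_inr (i i' : Fin (n + 1)) (j j' : Fin 2) {U : (PP K n).Opens}
    (h : U ≤ PPchart K n i j) (h' : U ≤ PPchart K n i' j') (k) :
    ores h (PPcoord K n i j (.inr k)) =
      ores h (PPcoord K n i j (.inr j')) * ores h' (PPcoord K n i' j' (.inr k)) := by
  have hU : U ≤ prW K n ⁻¹ᵁ (chart K j ⊓ chart K j') :=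
    le_inf (h.trans (PPchart_le_right i j)) (h'.trans (PPchart_le_right i' j'))
  let F := (ores hU).comp ((prW K n).app (chart K j ⊓ chart K j')).hom
  have hF {l} (hl : chart K j ⊓ chart K j' ≤ chart K l) (k) (m) (hm : U ≤ PPchart K n m l) :
      F (ores hl (ratio K l k)) = ores hm (PPcoord K n m l (.inr k)) := by
    refine (congrArg (ores hU) (app_ores _ _ _)).trans ?_
    exact (ores_ores _ _ _).trans (ores_ores _ _ _).symm
  rw [← hF inf_le_left, ← hF inf_le_left, ← hF inf_le_right, ← map_mul, ← ores_ratio]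

/-- Bihomogeneous polynomials. -/
def IsBihomogeneous (G : MvPolynomial (Fin (n + 1) ⊕ Fin 2) K) (d e : ℕ) : Prop :=
  IsWeightedHomogeneous (Sum.elim 1 0 : _ → ℕ) G d ∧
    IsWeightedHomogeneous (Sum.elim 0 1 : _ → ℕ) G e

/-- The coordinates of the two charts differ by one common factor on the `a_k` and another on `x,
y`. Homogeneity is used once for each grading. -/
lemma ores_dehomogenize {G : MvPolynomial (Fin (n + 1) ⊕ Fin 2) K} {d e : ℕ}
    (hG : IsBihomogeneous G d e) (i i' : Fin (n + 1)) (j j' : Fin 2) {U : (PP K n).Opens}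
    (h : U ≤ PPchart K n i j)
    (h' : U ≤ PPchart K n i' j') : ores h (dehomogenize G i j) =
      ores h (PPcoord K n i j (.inl i')) ^ d * (ores h (PPcoord K n i j (.inr j')) ^ e *
        ores h' (dehomogenize G i' j')) := by
  rw [dehomogenize, dehomogenize, eval₂_comp_left, eval₂_comp_left,
    ← eval₂_of_isWeightedHomogeneous _ _ _ hG.2, ← eval₂_of_isWeightedHomogeneous _ _ _ hG.1]
  congr 1
  · ext c
    exact (ores_PPconst h c).trans (ores_PPconst h' c).symm
  · ext (k | k)
    · simpa using ores_PPcoord_inl i i' j j' h h' k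
    · simpa using ores_PPcoord_inr i i' j j' h h' k

section IdealSheaf

/-- The ideal sheaf on the left is the largest one whose restriction to `A` is given by `I`;
membership is tested on the affine set `A ⊓ V`. The set `W` is kept variable so that it may be
written as `V ⊓ A`, or as `A` when `V = A`. -/
lemma mem_ideal_map_opens_ι {X : Scheme.{u}} [X.IsSeparated] {A : X.Opens} (hA : IsAffineOpen A)
    (I : Ideal Γ(X, A)) (V : X.affineOpens) (W : X.Opens) (hV : W ≤ V.1) (hWA : W ≤ A)
    (hW : W = A.ι ''ᵁ A.ι ⁻¹ᵁ V.1) (g : Γ(X, V)) :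
    g ∈ ((Scheme.IdealSheafData.ofIdealTop (I.map A.topIso.inv.hom)).map A.ι).ideal V ↔
      ores hV g ∈ I.map (ores hWA) := by
  subst hW
  have : IsAffine A.toScheme := hA
  have hVA : IsAffineOpen (A.ι ⁻¹ᵁ V.1) := by
    rw [← A.ι.isAffineOpen_iff_of_isOpenImmersion, Scheme.Hom.image_preimage_eq_opensRange_inf,
      Scheme.Opens.opensRange_ι]
    exact hA.inf V.2
  have : QuasiCompact A.ι := inferInstance
  rw [Scheme.IdealSheafData.ideal_map _ _ V hVA, Scheme.IdealSheafData.ofIdealTop_ideal,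
    Ideal.map_map, Ideal.mem_comap]
  have e : RingHom.comp (A.toScheme.presheaf.map (homOfLE le_top : A.ι ⁻¹ᵁ V.1 ⟶ ⊤).op).hom
      A.topIso.inv.hom = ores hWA := by
    rw [← CommRingCat.hom_comp, Scheme.Opens.topIso_inv]
    refine congrArg CommRingCat.Hom.hom ((X.presheaf.map_comp _ _).symm.trans ?_)
    rfl
  rw [e]
  rfl

variable (S : Set (MvPolynomial (Fin (n + 1) ⊕ Fin 2) K))

variable (K n) in
/-- The charts of `P` as affine open subsets. -/
def PPaffine (i : Fin (n + 1)) (j : Fin 2) : (PP K n).affineOpens :=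
  ⟨PPchart K n i j, isAffineOpen_PPchart K n i j⟩

variable (K n) in
lemma iSup_PPaffine : ⨆ ij : Fin (n + 1) × Fin 2, (PPaffine K n ij.1 ij.2 : (PP K n).Opens) = ⊤ := by
  rw [eq_top_iff]
  intro x _
  obtain ⟨i, j, h⟩ := exists_mem_PPchart K n x
  exact Opens.mem_iSup.2 ⟨(i, j), h⟩

/-- The ideal generated by dehomogenizations. -/
def chartIdeal (i : Fin (n + 1)) (j : Fin 2) : Ideal Γ(PP K n, PPchart K n i j) :=
  Ideal.span ((fun G => dehomogenize G i j) '' S)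

lemma idealSheaf_ideal_le (i : Fin (n + 1)) (j : Fin 2) :
    (idealSheaf S).ideal (PPaffine K n i j) ≤ chartIdeal S i j := by
  refine (Scheme.IdealSheafData.ideal_ofIdeals_le _ _).trans
    ((iInf_le _ i).trans ((iInf_le _ j).trans ((iInf_le _ le_rfl).trans (le_of_eq ?_))))
  refine congrArg Ideal.span (Set.image_congr fun G _ => ?_)
  exact ores_refl _

/-- The ideal sheaf of the closure of a closed subscheme of a chart. -/
def chartIdealSheaf (i : Fin (n + 1)) (j : Fin 2) : (PP K n).IdealSheafData :=
  (Scheme.IdealSheafData.ofIdealTop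
    ((chartIdeal S i j).map (PPchart K n i j).topIso.inv.hom)).map (PPchart K n i j).ι

lemma mem_chartIdealSheaf (i : Fin (n + 1)) (j : Fin 2) (V : (PP K n).affineOpens)
    (g : Γ(PP K n, V)) : g ∈ (chartIdealSheaf S i j).ideal V ↔
      ores inf_le_left g ∈ (chartIdeal S i j).map
        (ores (inf_le_right : V.1 ⊓ PPchart K n i j ≤ PPchart K n i j)) :=
  mem_ideal_map_opens_ι (isAffineOpen_PPchart K n i j) _ V _ _ _
    (by rw [Scheme.Hom.image_preimage_eq_opensRange_inf, Scheme.Opens.opensRange_ι, inf_comm]) g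

lemma chartIdealSheaf_ideal (i : Fin (n + 1)) (j : Fin 2) :
    (chartIdealSheaf S i j).ideal (PPaffine K n i j) = chartIdeal S i j := by
  ext g
  refine (mem_ideal_map_opens_ι (isAffineOpen_PPchart K n i j) _ (PPaffine K n i j) _ le_rfl le_rfl
    (by rw [Scheme.Hom.image_preimage_eq_opensRange_inf, Scheme.Opens.opensRange_ι]; exact (inf_idem _).symm) g).trans ?_
  have e (g : Γ(PP K n, PPchart K n i j)) : ores (le_refl (PPchart K n i j)) g ∈
      (chartIdeal S i j).map (ores (le_refl (PPchart K n i j))) ↔ g ∈ chartIdeal S i j := by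
    rw [show ores (le_refl (PPchart K n i j)) = RingHom.id _ from RingHom.ext fun _ => ores_refl _,
      Ideal.map_id, RingHom.id_apply]
  exact e g

variable {S}

lemma chartIdeal_le (hS : ∀ G ∈ S, ∃ d e, IsBihomogeneous G d e) (i i' : Fin (n + 1)) (j j' : Fin 2) :
    chartIdeal S i j ≤ (chartIdealSheaf S i' j').ideal (PPaffine K n i j) := by
  refine Ideal.span_le.2 ?_
  rintro _ ⟨G, hG, rfl⟩
  refine (mem_chartIdealSheaf S i' j' (PPaffine K n i j) _).2 ?_
  obtain ⟨d, e, h⟩ := hS G hG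
  change ores (inf_le_left : PPchart K n i j ⊓ PPchart K n i' j' ≤ PPchart K n i j) _ ∈ _
  rw [ores_dehomogenize h i i' j j' inf_le_left inf_le_right]
  exact Ideal.mul_mem_left _ _ (Ideal.mul_mem_left _ _ (Ideal.mem_map_of_mem _
    (Ideal.subset_span ⟨G, hG, rfl⟩)))

/-- The definition directly gives only an upper bound. For the other inclusion, let `J` be the
intersection of the ideal sheaves of the closures of the subschemes given on the single charts. It
lies below the defining family of ideals, hence below `idealSheaf S`. On each chart it contains the
dehomogenized equations, because a change of chart multiplies them by functions. -/
lemma idealSheaf_ideal (hS : ∀ G ∈ S, ∃ d e, IsBihomogeneous G d e) (i : Fin (n + 1)) (j : Fin 2) :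
    (idealSheaf S).ideal (PPaffine K n i j) = chartIdeal S i j := by
  refine (idealSheaf_ideal_le S i j).antisymm ?_
  let J : (PP K n).IdealSheafData := ⨅ ij : Fin (n + 1) × Fin 2, chartIdealSheaf S ij.1 ij.2
  have hJ (V) : J.ideal V = ⨅ ij : Fin (n + 1) × Fin 2, (chartIdealSheaf S ij.1 ij.2).ideal V := by
    rw [Scheme.IdealSheafData.ideal_iInf, iInf_apply]
  have hle : J ≤ idealSheaf S := by
    rw [idealSheaf, Scheme.IdealSheafData.le_ofIdeals_iff]
    intro U
    refine le_iInf fun i => le_iInf fun j => le_iInf fun h => ?_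
    rw [hJ]
    refine (iInf_le _ (i, j)).trans ?_
    rw [← Scheme.IdealSheafData.map_ideal _ (show U ≤ PPaffine K n i j from h),
      chartIdealSheaf_ideal]
    exact ((Ideal.map_span _ _).trans (congrArg _ (Set.image_comp _ _ _).symm)).le
  refine le_trans ?_ (hle (PPaffine K n i j))
  rw [hJ]
  exact le_iInf fun ij => chartIdeal_le hS _ _ _ _

end IdealSheaf

end Transition

end OpenSwallowtail

namespace OpenSwallowtail

attribute [local instance] MvPolynomial.gradedAlgebra

open ProjSpace Limits

/-! ### Equations and charts of the two incidence varieties. -/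

section Incidence

/-- The commutator of two derivations is a derivation, and this one kills all variables. -/
lemma pderiv_pderiv_comm {R σ : Type*} [CommRing R] (a b : σ) (G : MvPolynomial σ R) :
    pderiv a (pderiv b G) = pderiv b (pderiv a G) := by
  have h : ⁅pderiv (R := R) a, pderiv (R := R) b⁆ = 0 := by
    refine MvPolynomial.derivation_ext fun k => ?_
    classical
    simp [Derivation.commutator_apply, pderiv_X, Pi.single_apply, apply_ite]
  have := congrArg (fun D : Derivation R (MvPolynomial σ R) (MvPolynomial σ R) => D G) h
  rwa [Derivation.commutator_apply, Derivation.zero_apply, sub_eq_zero] at this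

variable {K : Type u} [Field K] {n : ℕ} (i : Fin (n + 1)) (j : Fin 2)

section Dehomogenize

variable (G H : MvPolynomial (Fin (n + 1) ⊕ Fin 2) K)

lemma dehomogenize_add : dehomogenize (G + H) i j = dehomogenize G i j + dehomogenize H i j :=
  eval₂_add ..

lemma dehomogenize_mul : dehomogenize (G * H) i j = dehomogenize G i j * dehomogenize H i j :=
  eval₂_mul ..

lemma dehomogenize_C (c : K) : dehomogenize (n := n) (C c) i j = PPconst K n _ c := eval₂_C ..

lemma dehomogenize_X (k : Fin (n + 1) ⊕ Fin 2) :
    dehomogenize (X k : MvPolynomial _ K) i j = PPcoord K n i j k := eval₂_X ..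

end Dehomogenize

variable (K n) in
lemma isBihomogeneous_universalForm : IsBihomogeneous (universalForm K n) 1 n := by
  constructor
  · refine IsWeightedHomogeneous.sum _ _ _ fun i _ => ?_
    have h1 := isWeightedHomogeneous_X K (Sum.elim 1 0 : Fin (n + 1) ⊕ Fin 2 → ℕ) (Sum.inl i)
    have h2 := (isWeightedHomogeneous_X K (Sum.elim 1 0 : Fin (n + 1) ⊕ Fin 2 → ℕ) (Sum.inr 0)).pow
      (n - (i : ℕ))
    have h3 := (isWeightedHomogeneous_X K (Sum.elim 1 0 : Fin (n + 1) ⊕ Fin 2 → ℕ) (Sum.inr 1)).pow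
      (i : ℕ)
    simpa using (h1.mul h2).mul h3
  · refine IsWeightedHomogeneous.sum _ _ _ fun i _ => ?_
    have h1 := isWeightedHomogeneous_X K (Sum.elim 0 1 : Fin (n + 1) ⊕ Fin 2 → ℕ) (Sum.inl i)
    have h2 := (isWeightedHomogeneous_X K (Sum.elim 0 1 : Fin (n + 1) ⊕ Fin 2 → ℕ) (Sum.inr 0)).pow
      (n - (i : ℕ))
    have h3 := (isWeightedHomogeneous_X K (Sum.elim 0 1 : Fin (n + 1) ⊕ Fin 2 → ℕ) (Sum.inr 1)).pow
      (i : ℕ)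
    have := (h1.mul h2).mul h3
    simp only [Sum.elim_inl, Sum.elim_inr, Pi.zero_apply, Pi.one_apply, zero_add, smul_eq_mul,
      mul_one] at this
    rwa [Nat.sub_add_cancel (Nat.lt_succ_iff.1 i.2)] at this

lemma IsBihomogeneous.pderiv_inr {G : MvPolynomial (Fin (n + 1) ⊕ Fin 2) K} {d e : ℕ}
    (h : IsBihomogeneous G d e) (he : 1 ≤ e) (a : Fin 2) :
    IsBihomogeneous (pderiv (Sum.inr a) G) d (e - 1) :=
  ⟨h.1.pderiv (by simp), h.2.pderiv (by simp; omega)⟩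

lemma IsBihomogeneous.euler {G : MvPolynomial (Fin (n + 1) ⊕ Fin 2) K} {d e : ℕ}
    (h : IsBihomogeneous G d e) :
    ∑ a : Fin 2, X (Sum.inr a) * pderiv (Sum.inr a) G = e • G := by
  simpa using h.2.sum_weight_X_mul_pderiv

/-- Euler's relation `e G = x G_x + y G_y`, with `e` invertible in characteristic zero. -/
lemma IsBihomogeneous.dehomogenize_mem [CharZero K] {G : MvPolynomial (Fin (n + 1) ⊕ Fin 2) K}
    {d e : ℕ} (h : IsBihomogeneous G d e) (he : e ≠ 0) (I : Ideal Γ(PP K n, PPchart K n i j))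
    (hI : ∀ a, dehomogenize (pderiv (Sum.inr a) G) i j ∈ I) : dehomogenize G i j ∈ I := by
  have h1 : G = C ((e : K)⁻¹) * ∑ a : Fin 2, X (Sum.inr a) * pderiv (Sum.inr a) G := by
    rw [h.euler, nsmul_eq_mul, ← mul_assoc, ← map_natCast (C : K →+* _), ← map_mul,
      inv_mul_cancel₀ (Nat.cast_ne_zero.2 he), map_one, one_mul]
  rw [h1, dehomogenize_mul, Fin.sum_univ_two, dehomogenize_add, dehomogenize_mul, dehomogenize_mul]
  exact I.mul_mem_left _ (add_mem (I.mul_mem_left _ (hI 0)) (I.mul_mem_left _ (hI 1)))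

variable (K n) in
/-- The first derivatives of the universal form. -/
def deltaEquations : Set (MvPolynomial (Fin (n + 1) ⊕ Fin 2) K) :=
  {pderiv (Sum.inr 0) (universalForm K n), pderiv (Sum.inr 1) (universalForm K n)}

variable (K n) in
/-- The second derivatives of the universal form. -/
def gammaEquations : Set (MvPolynomial (Fin (n + 1) ⊕ Fin 2) K) :=
  {pderiv (Sum.inr 0) (pderiv (Sum.inr 0) (universalForm K n)),
    pderiv (Sum.inr 0) (pderiv (Sum.inr 1) (universalForm K n)),
    pderiv (Sum.inr 1) (pderiv (Sum.inr 1) (universalForm K n))}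

lemma mem_deltaEquations {G : MvPolynomial (Fin (n + 1) ⊕ Fin 2) K} :
    G ∈ deltaEquations K n ↔ ∃ a, G = pderiv (Sum.inr a) (universalForm K n) := by
  rw [Fin.exists_fin_two]; rfl

lemma mem_gammaEquations {G : MvPolynomial (Fin (n + 1) ⊕ Fin 2) K} :
    G ∈ gammaEquations K n ↔
      ∃ a b, G = pderiv (Sum.inr b) (pderiv (Sum.inr a) (universalForm K n)) := by
  constructor
  · rintro (h | h | h)
    · exact ⟨0, 0, h⟩
    · exact ⟨1, 0, h⟩
    · exact ⟨1, 1, h⟩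
  · rintro ⟨a, b, rfl⟩
    fin_cases a <;> fin_cases b
    · exact Or.inl rfl
    · exact Or.inr (Or.inl (pderiv_pderiv_comm _ _ _))
    · exact Or.inr (Or.inl rfl)
    · exact Or.inr (Or.inr rfl)

lemma idealDeltaBar_ideal (hn : 2 ≤ n) :
    (idealDeltaBar K n).ideal (PPaffine K n i j) = chartIdeal (deltaEquations K n) i j := by
  refine idealSheaf_ideal (fun G hG => ?_) i j
  obtain ⟨a, rfl⟩ := mem_deltaEquations.1 hG
  exact ⟨_, _, (isBihomogeneous_universalForm K n).pderiv_inr (by omega) a⟩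

lemma idealGammaBar_ideal (hn : 2 ≤ n) :
    (idealGammaBar K n).ideal (PPaffine K n i j) = chartIdeal (gammaEquations K n) i j := by
  refine idealSheaf_ideal (fun G hG => ?_) i j
  obtain ⟨a, b, rfl⟩ := mem_gammaEquations.1 hG
  exact ⟨_, _, ((isBihomogeneous_universalForm K n).pderiv_inr (by omega) a).pderiv_inr
    (by omega) b⟩

lemma chartIdeal_delta_le_gamma [CharZero K] (hn : 2 ≤ n) :
    chartIdeal (deltaEquations K n) i j ≤ chartIdeal (gammaEquations K n) i j := by
  refine Ideal.span_le.2 ?_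
  rintro _ ⟨G, hG, rfl⟩
  obtain ⟨a, rfl⟩ := mem_deltaEquations.1 hG
  exact ((isBihomogeneous_universalForm K n).pderiv_inr (by omega) a).dehomogenize_mem i j
    (by omega) _ fun b => Ideal.subset_span ⟨_, mem_gammaEquations.2 ⟨a, b, rfl⟩, rfl⟩

variable (K) in
lemma idealDeltaBar_le_idealGammaBar [CharZero K] (hn : 2 ≤ n) :
    idealDeltaBar K n ≤ idealGammaBar K n := by
  refine Scheme.IdealSheafData.le_of_iSup_eq_top
    (fun ij : Fin (n + 1) × Fin 2 => PPaffine K n ij.1 ij.2) (iSup_PPaffine K n) fun ij => ?_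
  rw [idealDeltaBar_ideal _ _ hn, idealGammaBar_ideal _ _ hn]
  exact chartIdeal_delta_le_gamma _ _ hn

variable (K n) in
/-- The charts of the incidence variety. -/
def deltaChart : (DeltaBar K n).Opens := DeltaBar.incl K n ⁻¹ᵁ PPchart K n i j

/-- Restriction of functions to the incidence variety. -/
def toDelta : Γ(PP K n, PPchart K n i j) →+* Γ(DeltaBar K n, deltaChart K n i j) :=
  ((DeltaBar.incl K n).app _).hom

instance : IsClosedImmersion (DeltaBar.incl K n) :=
  inferInstanceAs (IsClosedImmersion (idealDeltaBar K n).subschemeι)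

instance : IsClosedImmersion (GammaBar.incl K n) :=
  inferInstanceAs (IsClosedImmersion (idealGammaBar K n).subschemeι)

instance : IsClosedImmersion (Delta.incl K n) :=
  inferInstanceAs (IsClosedImmersion (Scheme.IdealSheafData.subschemeι _))

variable (K n) in
lemma isAffineOpen_deltaChart : IsAffineOpen (deltaChart K n i j) :=
  (isAffineOpen_PPchart K n i j).preimage _

lemma toDelta_surjective : Function.Surjective (toDelta (K := K) i j) :=
  (idealDeltaBar K n).subschemeι_app_surjective (PPaffine K n i j)

lemma toDelta_eq_zero_iff (hn : 2 ≤ n) (g) :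
    toDelta i j g = 0 ↔ g ∈ chartIdeal (deltaEquations K n) i j := by
  rw [← idealDeltaBar_ideal _ _ hn, ← Scheme.IdealSheafData.ker_subschemeι_app]
  rfl

lemma app_toDelta_eq_zero_iff (hn : 2 ≤ n) (q : GammaBar K n ⟶ DeltaBar K n)
    (hq : q ≫ DeltaBar.incl K n = GammaBar.incl K n) (g) :
    (q.app (deltaChart K n i j)).hom (toDelta i j g) = 0 ↔
      g ∈ chartIdeal (gammaEquations K n) i j := by
  have h : ∀ g : Γ(PP K n, PPchart K n i j), ((GammaBar.incl K n).app (PPchart K n i j)).hom g = 0 ↔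
      g ∈ chartIdeal (gammaEquations K n) i j := fun g => by
    rw [← idealGammaBar_ideal _ _ hn, ← Scheme.IdealSheafData.ker_subschemeι_app]
    rfl
  rw [← hq] at h
  exact h g

end Incidence

end OpenSwallowtail

namespace OpenSwallowtail

/-! ### Discriminant equations over arbitrary rings. -/

section Discriminant

variable {K : Type u} [Field K] {n : ℕ}

/-- The equations of a set which contains all forms parametrized by their factorizations hold for
all factorizations over all rings. -/
lemma eval₂_coeff_eq_zero [Infinite K] (D : MvPolynomial (Fin (n + 1)) K) (σ : Fin (n + 1) → ℕ) (m : ℕ)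
    (hD : ∀ (t : K) (h : Polynomial K), h ≠ 0 → h.natDegree ≤ m →
      eval (fun i => ((Polynomial.X - Polynomial.C t) ^ 2 * h).coeff (σ i)) D = 0)
    {R : Type u} [CommRing R] (c : K →+* R) (t : R) (h : Polynomial R) (hm : h.natDegree ≤ m) :
    eval₂ c (fun i => ((Polynomial.X - Polynomial.C t) ^ 2 * h).coeff (σ i)) D = 0 := by
  let A := MvPolynomial (Option (Fin (m + 1))) K
  let H : Polynomial A := ∑ k : Fin (m + 1), Polynomial.C (X (some k)) * Polynomial.X ^ (k : ℕ)
  let P : Fin (n + 1) → A := fun i =>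
    ((Polynomial.X - Polynomial.C (X none)) ^ 2 * H).coeff (σ i)
  have key {S : Type u} [CommRing S] (f : K →+* S) (v : Option (Fin (m + 1)) → S) :
      eval₂ f v (eval₂ C P D) = eval₂ f (fun i => ((Polynomial.X - Polynomial.C (v none)) ^ 2 *
        ∑ k : Fin (m + 1), Polynomial.C (v (some k)) * Polynomial.X ^ (k : ℕ)).coeff (σ i)) D := by
    have h1 := eval₂_comp_left (eval₂Hom f v) (C : K →+* A) P D
    rw [coe_eval₂Hom] at h1
    rw [h1]
    congr 1
    · ext a
      simp
    · funext i
      rw [Function.comp_apply, ← coe_eval₂Hom, ← Polynomial.coeff_map]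
      simp [H, Polynomial.map_sum]
  -- The hypothesis concerns nonzero cofactors only. The factor `X (some 0)` leaves to check the
  -- points whose cofactor has nonzero constant term, and it is cancelled afterwards since `A` is a
  -- domain.
  have hQ : eval₂ C P D * X (some 0) = 0 := by
    refine MvPolynomial.funext fun v => ?_
    rw [map_mul, map_zero, eval_X]
    by_cases h0 : v (some 0) = 0
    · rw [h0, mul_zero]
    · rw [← eval₂_id, key, eval₂_id]
      refine mul_eq_zero_of_left (hD _ _ ?_ ?_) _
      · intro h
        apply h0
        have := congrArg (fun p => Polynomial.coeff p 0) h
        simpa [Polynomial.finsetSum_coeff, Fin.sum_univ_succ] using this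
      · exact Polynomial.natDegree_sum_le_of_forall_le _ _ fun k _ =>
          (Polynomial.natDegree_C_mul_X_pow_le _ _).trans (Nat.lt_succ_iff.1 k.2)
  have hQ0 : eval₂ C P D = 0 := (mul_eq_zero.1 hQ).resolve_right (X_ne_zero _)
  have e := key c (fun k => k.elim t fun k : Fin (m + 1) => h.coeff k)
  rw [hQ0, eval₂_zero] at e
  rw [h.as_sum_range' (m + 1) (by omega), ← Fin.sum_univ_eq_sum_range]
  simpa [Polynomial.C_mul_X_pow_eq_monomial] using e.symm

/-- The exponents of the affine coordinate in the dehomogenized universal form. -/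
def expo (n : ℕ) (j : Fin 2) (i : Fin (n + 1)) : ℕ := if j = 1 then n - i else i

lemma exists_expo_eq (j : Fin 2) {k : ℕ} (hk : k ≤ n) : ∃ i, expo n j i = k := by
  by_cases hj : j = 1
  · exact ⟨⟨n - k, by omega⟩, by simp [expo, hj]; omega⟩
  · exact ⟨⟨k, by omega⟩, by simp [expo, hj]⟩

lemma expo_injective (j : Fin 2) : Function.Injective (expo n j) := by
  intro a b h
  unfold expo at h
  split_ifs at h
  · omega
  · omega

lemma expo_le (j : Fin 2) (i : Fin (n + 1)) : expo n j i ≤ n := by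
  unfold expo
  split_ifs <;> omega

lemma formOf_expo_one (f : Polynomial K) :
    formOf (fun i => f.coeff (expo n 1 i)) = f.homogenize n := by
  rw [formOf, Polynomial.homogenize, Finset.Nat.sum_antidiagonal_eq_sum_range_succ_mk,
    ← Finset.sum_range_reflect, ← Fin.sum_univ_eq_sum_range]
  refine Finset.sum_congr rfl fun i _ => ?_
  have h1 : n.succ - 1 - (i : ℕ) = n - i := by omega
  have h2 : n - (n - (i : ℕ)) = i := by omega
  rw [Finsupp.update_eq_add_single (by simp), monomial_add_single, h1, h2,
    ← C_mul_X_pow_eq_monomial, expo, if_pos rfl]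

lemma formOf_expo_zero (f : Polynomial K) :
    formOf (fun i => f.coeff (expo n 0 i)) = rename Fin.rev (f.homogenize n) := by
  rw [formOf, Polynomial.homogenize, Finset.Nat.sum_antidiagonal_eq_sum_range_succ_mk,
    map_sum, ← Fin.sum_univ_eq_sum_range (fun k => rename Fin.rev (monomial _ (f.coeff k)))]
  refine Finset.sum_congr rfl fun i _ => ?_
  rw [Finsupp.update_eq_add_single (by simp), monomial_add_single,
    ← C_mul_X_pow_eq_monomial, map_mul, map_mul, map_pow, map_pow, rename_X, rename_X, rename_C]
  rw [expo, if_neg (by decide), show Fin.rev (0 : Fin 2) = 1 from rfl,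
    show Fin.rev (1 : Fin 2) = 0 from rfl]
  ring

lemma homogenize_sq_mul (t : K) (h : Polynomial K) (hn : 2 ≤ n) (hm : h.natDegree ≤ n - 2) :
    ((Polynomial.X - Polynomial.C t) ^ 2 * h).homogenize n =
      (X 0 - C t * X 1) ^ 2 * h.homogenize (n - 2) := by
  have h1 : (Polynomial.X - Polynomial.C t).natDegree ≤ 1 := by simp
  have e : n = (1 + 1) + (n - 2) := by omega
  conv_lhs => rw [e]
  rw [Polynomial.homogenize_mul _ _ (by simp) hm,
    pow_two, Polynomial.homogenize_mul _ _ h1 h1]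
  simp [pow_two]

lemma eval_coeff_eq_zero_of_mem (hn : 2 ≤ n) {D : MvPolynomial (Fin (n + 1)) K}
    (hD : D ∈ discriminantEquations K n) (j : Fin 2) (t : K) (h : Polynomial K) (h0 : h ≠ 0)
    (hm : h.natDegree ≤ n - 2) :
    eval (fun i => ((Polynomial.X - Polynomial.C t) ^ 2 * h).coeff (expo n j i)) D = 0 := by
  apply hD
  · intro hc
    have hf : (Polynomial.X - Polynomial.C t) ^ 2 * h ≠ 0 :=
      mul_ne_zero (pow_ne_zero _ (Polynomial.X_sub_C_ne_zero t)) h0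
    have hd : ((Polynomial.X - Polynomial.C t) ^ 2 * h).natDegree ≤ n := by
      rw [Polynomial.natDegree_mul (pow_ne_zero _ (Polynomial.X_sub_C_ne_zero t)) h0]
      simp
      omega
    obtain ⟨i, hi⟩ := exists_expo_eq j hd
    have := congrFun hc i
    rw [hi, Pi.zero_apply, Polynomial.coeff_natDegree, Polynomial.leadingCoeff_eq_zero] at this
    exact hf this
  · by_cases hj : j = 1
    · subst hj
      rw [formOf_expo_one, homogenize_sq_mul t h hn hm]
      exact ⟨t, 1, Or.inr one_ne_zero, by simp⟩
    · obtain rfl : j = 0 := by omega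
      rw [formOf_expo_zero, homogenize_sq_mul t h hn hm]
      -- The linear form `t x - y` of this root is the negative of `y - t x`; squaring removes the
      -- sign.
      refine ⟨1, t, Or.inl one_ne_zero, ?_⟩
      rw [map_mul, map_pow, map_sub, map_mul, rename_X, rename_X, rename_C]
      refine Dvd.intro _ (congrArg (· * _) ?_)
      simp only [Fin.rev_zero, show Fin.rev (1 : Fin 2) = 0 from rfl, map_one]
      change _ = (X 1 - _) ^ 2
      ring

/-- The universal form in an affine coordinate of `P(W)`. -/
def specialize {R : Type*} [CommRing R] (c : K →+* R) (α : Fin (n + 1) → R) (j : Fin 2) :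
    MvPolynomial (Fin (n + 1) ⊕ Fin 2) K →+* Polynomial R :=
  eval₂Hom (Polynomial.C.comp c)
    (Sum.elim (fun i => Polynomial.C (α i)) fun k => if k = j then 1 else Polynomial.X)

section Specialize

variable {R : Type*} [CommRing R] (c : K →+* R) (α : Fin (n + 1) → R) (j : Fin 2)

lemma specialize_universalForm :
    specialize c α j (universalForm K n) = ∑ i, Polynomial.C (α i) * Polynomial.X ^ expo n j i := by
  rw [universalForm, map_sum]
  refine Finset.sum_congr rfl fun i _ => ?_
  by_cases hj : j = 1
  · simp [specialize, expo, hj]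
  · obtain rfl : j = 0 := by omega
    simp [specialize, expo]

lemma derivative_specialize {j' : Fin 2} (hj : j' ≠ j) (G : MvPolynomial (Fin (n + 1) ⊕ Fin 2) K) :
    Polynomial.derivative (specialize c α j G) = specialize c α j (pderiv (Sum.inr j') G) := by
  induction G using MvPolynomial.induction_on with
  | C a => simp [specialize]
  | add p q hp hq => simp only [map_add, hp, hq]
  | mul_X p k hp =>
    rw [map_mul, Polynomial.derivative_mul, hp, pderiv_mul, map_add, map_mul, map_mul]
    congr 2
    rcases k with k | k
    · rw [pderiv_X_of_ne (by simp)]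
      simp [specialize]
    · by_cases hk : k = j
      · rw [pderiv_X_of_ne (by simp [hk, hj.symm])]
        simp [specialize, hk]
      · obtain rfl : k = j' := by omega
        simp [specialize, hk]

lemma eval_specialize (v : Fin (n + 1) ⊕ Fin 2 → R) (hv : v (Sum.inr j) = 1) {j' : Fin 2}
    (hj : j' ≠ j) (G : MvPolynomial (Fin (n + 1) ⊕ Fin 2) K) :
    (specialize c (v ∘ Sum.inl) j G).eval (v (Sum.inr j')) = eval₂ c v G := by
  have := eval₂_comp_left (Polynomial.evalRingHom (v (Sum.inr j'))) (Polynomial.C.comp c)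
    (Sum.elim (fun i => Polynomial.C ((v ∘ Sum.inl) i)) fun k => if k = j then 1 else Polynomial.X) G
  refine this.trans ?_
  congr 1
  · ext a
    simp
  · ext (k | k)
    · simp
    · by_cases hk : k = j
      · simp [hk, hv]
      · obtain rfl : k = j' := by omega
        simp [hk]

end Specialize

/-- Valid over any ring: for `f = (X - t) g` one has `f'(t) = g(t)`, so the root can be split off
twice. The degree of the cofactor is exact when it is nonzero because `(X - t)²` is monic. -/
lemma exists_eq_sq_mul {R : Type*} [CommRing R] (f : Polynomial R) (t : R) (h0 : f.eval t = 0)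
    (h1 : f.derivative.eval t = 0) : ∃ h : Polynomial R,
      f = (Polynomial.X - Polynomial.C t) ^ 2 * h ∧ h.natDegree ≤ f.natDegree - 2 := by
  nontriviality R
  obtain ⟨g, rfl⟩ := Polynomial.dvd_iff_isRoot.2 h0
  have hg : g.eval t = 0 := by simpa using h1
  obtain ⟨h, rfl⟩ := Polynomial.dvd_iff_isRoot.2 hg
  refine ⟨h, by ring, ?_⟩
  by_cases hh : h = 0
  · simp [hh]
  · rw [← mul_assoc, ← pow_two, ((Polynomial.monic_X_sub_C t).pow 2).natDegree_mul' hh,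
      (Polynomial.monic_X_sub_C t).natDegree_pow]
    simp

/-- Euler's relation gives `F = 0` from `F_x = F_y = 0`, as `n` is invertible. The affine form then
vanishes together with its derivative at the root, is divisible by `(X - t)²` over `R`, and the
polynomial identity `eval₂_coeff_eq_zero` applies. As `R` may have nilpotents, this will serve for
the scheme `Δ̄` and not merely for its points. -/
theorem eval₂_eq_zero_of_mem_discriminantEquations [CharZero K] (hn : 2 ≤ n)
    {D : MvPolynomial (Fin (n + 1)) K} (hD : D ∈ discriminantEquations K n)
    {R : Type u} [CommRing R] (c : K →+* R) (v : Fin (n + 1) ⊕ Fin 2 → R) (j : Fin 2)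
    (hv : v (Sum.inr j) = 1)
    (h : ∀ a, eval₂ c v (pderiv (Sum.inr a) (universalForm K n)) = 0) :
    eval₂ c (v ∘ Sum.inl) D = 0 := by
  obtain ⟨j', hj⟩ : ∃ j' : Fin 2, j' ≠ j := exists_ne j
  set f := specialize c (v ∘ Sum.inl) j (universalForm K n) with hf
  have hF : eval₂ c v (universalForm K n) = 0 := by
    have e := congrArg (eval₂Hom c v) (isBihomogeneous_universalForm K n).euler
    rw [Fin.sum_univ_two, map_add, map_mul, map_mul, map_nsmul] at e
    simp only [coe_eval₂Hom, h, mul_zero, add_zero, nsmul_eq_mul] at e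
    rw [← map_natCast c] at e
    have hu : IsUnit (c (n : K)) := (IsUnit.mk0 (n : K) (by simp; omega)).map c
    exact hu.mul_right_eq_zero.1 e.symm
  have h0 : f.eval (v (Sum.inr j')) = 0 := by rw [hf, eval_specialize c j v hv hj, hF]
  have h1 : f.derivative.eval (v (Sum.inr j')) = 0 := by
    rw [hf, derivative_specialize c _ j hj, eval_specialize c j v hv hj, h]
  obtain ⟨g, hg, hd⟩ := exists_eq_sq_mul f _ h0 h1
  have hfd : f.natDegree ≤ n := by
    rw [hf, specialize_universalForm]
    exact Polynomial.natDegree_sum_le_of_forall_le _ _ fun i _ =>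
      (Polynomial.natDegree_C_mul_X_pow_le _ _).trans (expo_le j i)
  have hα : v ∘ Sum.inl = fun i =>
      ((Polynomial.X - Polynomial.C (v (Sum.inr j'))) ^ 2 * g).coeff (expo n j i) := by
    funext i
    rw [← hg, hf, specialize_universalForm, Polynomial.finsetSum_coeff]
    simp [Polynomial.coeff_C_mul, Polynomial.coeff_X_pow, (expo_injective (n := n) j).eq_iff]
  rw [hα]
  exact eval₂_coeff_eq_zero D (expo n j) (n - 2)
    (fun t h h0 hm => eval_coeff_eq_zero_of_mem hn hD j t h h0 hm) c _ g (hd.trans (by omega))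

end Discriminant

end OpenSwallowtail

namespace OpenSwallowtail

attribute [local instance] MvPolynomial.gradedAlgebra

open ProjSpace

/-! ### Rational points of projective space. -/

section PointsOfProjSpace

variable {K : Type u} [Field K] {ι : Type}

lemma algebraMap_pow_mul_evalAt_awayFrac (i : ι) (d : ℕ) (D : MvPolynomial ι K)
    (hD : D ∈ homogeneousSubmodule ι K (d • 1)) (p : chart K i) :
    algebraMap (MvPolynomial ι K) (Localization.AtPrime (primeIdeal p.1)) (X i) ^ d *
      evalAt p (chartEquiv K i (awayFrac i d D hD)) = algebraMap (MvPolynomial ι K) _ D := by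
  have hp : Submonoid.powers (X i : MvPolynomial ι K) ≤
      (primeIdeal p.1).primeCompl.comap (RingHom.id (MvPolynomial ι K)) :=
    Submonoid.powers_le.mpr p.2
  have a : evalAt p (chartEquiv K i (awayFrac i d D hD)) = IsLocalization.map
      (Localization.AtPrime (primeIdeal p.1)) (RingHom.id _) hp (awayVal i (awayFrac i d D hD)) :=
    ProjectiveSpectrum.Proj.awayToSection_apply (𝒜 := homogeneousSubmodule ι K) (X i)
      (awayFrac i d D hD) ⟨p.1, p.2⟩
  have c := congrArg (IsLocalization.map (Localization.AtPrime (primeIdeal p.1))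
    (RingHom.id (MvPolynomial ι K)) hp) (awayVal_awayFrac i d D hD)
  rw [map_mul, map_pow, IsLocalization.map_eq, IsLocalization.map_eq] at c
  exact (congrArg _ a).trans c

lemma mem_basicOpen_of_isUnit_evalAt {U : (ProjSpace K ι).Opens} (p : U) (g : Γ(ProjSpace K ι, U))
    (h : IsUnit (evalAt p g)) : p.1 ∈ (ProjSpace K ι).basicOpen g := by
  rw [Scheme.mem_basicOpen _ _ _ p.2]
  have h1 : IsUnit (g.1 p) :=
    (HomogeneousLocalization.isUnit_iff_isUnit_val (𝒜 := homogeneousSubmodule ι K)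
      (𝔭 := primeIdeal p.1) _).1 h
  have h2 := Proj.stalkIso'_germ (𝒜 := homogeneousSubmodule ι K) U p.1 p.2 g
  exact (MulEquiv.isUnit_map (Proj.stalkIso' (homogeneousSubmodule ι K) p.1)).1
    ((congrArg IsUnit h2).mpr h1)

/-- The point of projective space with given homogeneous coordinates. -/
def pointOf (c : ι → K) (i : ι) (hc : c i ≠ 0) : ProjSpace K ι :=
  let p : ProjectiveSpectrum (homogeneousSubmodule ι K) :=
    { asHomogeneousIdeal := (RingHom.ker (eval c)).homogeneousCore (homogeneousSubmodule ι K)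
      isPrime := Ideal.IsPrime.homogeneousCore (RingHom.ker_isPrime _)
      not_irrelevant_le := fun h => by
        have h1 : (X i : MvPolynomial ι K) ∈
            HomogeneousIdeal.irrelevant (homogeneousSubmodule ι K) := by
          rw [HomogeneousIdeal.mem_irrelevant_iff]
          exact DirectSum.decompose_of_mem_ne (homogeneousSubmodule ι K) (X_mem K i) one_ne_zero
        have h2 := Ideal.toIdeal_homogeneousCore_le _ _ (h h1)
        rw [RingHom.mem_ker, eval_X] at h2
        exact hc h2 }
  p

lemma mem_primeIdeal_pointOf (c : ι → K) (i : ι) (hc : c i ≠ 0) {d : ℕ} {D : MvPolynomial ι K}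
    (hD : D.IsHomogeneous d) : D ∈ primeIdeal (pointOf c i hc) ↔ eval c D = 0 :=
  ⟨fun h => Ideal.toIdeal_homogeneousCore_le _ _ h,
    fun h => Ideal.mem_homogeneousCore_of_homogeneous_of_mem ⟨d, hD⟩ h⟩

lemma pointOf_mem_chart (c : ι → K) (i : ι) (hc : c i ≠ 0) : pointOf c i hc ∈ chart K i := by
  intro h
  have := (mem_primeIdeal_pointOf c i hc (isHomogeneous_X K i)).1 h
  rw [eval_X] at this
  exact hc this

lemma eval_smul_eq_sum (c : ι → K) (l : K) (D : MvPolynomial ι K) :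
    eval (fun k => l * c k) D =
      ∑ d ∈ Finset.range (D.totalDegree + 1), l ^ d * eval c (homogeneousComponent d D) := by
  conv_lhs => rw [← sum_homogeneousComponent D]
  rw [map_sum]
  refine Finset.sum_congr rfl fun d _ => ?_
  have := eval₂_of_isWeightedHomogeneous (RingHom.id K) c l (homogeneousComponent_isHomogeneous d D)
  simpa [eval₂_id] using this

/-- On the line through `c` the polynomial `D` is a polynomial in `l` whose coefficients are the
values of the homogeneous components. An extra factor `Polynomial.X` takes care of `l = 0`. -/
lemma eval_homogeneousComponent_eq_zero [Infinite K] (c : ι → K) (D : MvPolynomial ι K)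
    (h : ∀ l : K, l ≠ 0 → eval (fun k => l * c k) D = 0) (d : ℕ) :
    eval c (homogeneousComponent d D) = 0 := by
  by_cases hd : D.totalDegree < d
  · rw [homogeneousComponent_eq_zero _ _ hd, map_zero]
  let q : Polynomial K := ∑ d ∈ Finset.range (D.totalDegree + 1),
    Polynomial.C (eval c (homogeneousComponent d D)) * Polynomial.X ^ d
  have hq : q * Polynomial.X = 0 := by
    refine Polynomial.funext fun l => ?_
    by_cases hl : l = 0
    · simp [hl]
    · have := h l hl
      rw [eval_smul_eq_sum] at this
      simp only [q, Polynomial.eval_mul, Polynomial.eval_finsetSum, Polynomial.eval_C,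
        Polynomial.eval_pow, Polynomial.eval_X, Polynomial.eval_zero]
      simp_rw [mul_comm (eval c _)]
      rw [this, zero_mul]
  have hq0 : q = 0 := (mul_eq_zero.1 hq).resolve_right Polynomial.X_ne_zero
  have := congrArg (fun p => Polynomial.coeff p d) hq0
  simpa [q, Polynomial.finsetSum_coeff, Polynomial.coeff_C_mul, Polynomial.coeff_X_pow,
    Nat.lt_succ_iff, not_lt.1 hd] using this

lemma mem_primeIdeal_of_homogeneousComponent (p : ProjSpace K ι) (D : MvPolynomial ι K)
    (h : ∀ d, homogeneousComponent d D ∈ primeIdeal p) : D ∈ primeIdeal p := by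
  rw [← sum_homogeneousComponent D]
  exact Ideal.sum_mem _ fun d _ => h d

end PointsOfProjSpace

/-! ### The projection of `Δ̄` factors through `Δ`. -/

section

lemma functions_ext {X : Scheme.{u}} {U : X.Opens} {s t : Γ(X, U)}
    (H : ∀ x ∈ U, ∃ (V : X.Opens) (h : V ≤ U), x ∈ V ∧ ores h s = ores h t) : s = t := by
  choose V h hx e using H
  refine TopCat.Sheaf.eq_of_locally_eq' X.sheaf
    (fun x : U => V x.1 x.2) U (fun x => homOfLE (h x.1 x.2)) ?_ s t (fun x => e x.1 x.2)
  intro x hxU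
  exact Opens.mem_iSup.mpr ⟨⟨x, hxU⟩, hx x hxU⟩

lemma notMem_basicOpen_of_mem_vanishingIdeal {X : Scheme.{u}} {Z : Closeds X} {U : X.affineOpens}
    {g : Γ(X, U)} (hg : g ∈ (Scheme.IdealSheafData.vanishingIdeal Z).ideal U) {x : X} (hx : x ∈ Z) :
    x ∉ X.basicOpen g := by
  have h : x ∈ X.zeroLocus (U := U.1) ((Scheme.IdealSheafData.vanishingIdeal Z).ideal U) := by
    apply Scheme.IdealSheafData.supportSet_subset_zeroLocus
    have : x ∈ (Scheme.IdealSheafData.vanishingIdeal Z).support := by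
      rw [← SetLike.mem_coe, Scheme.IdealSheafData.coe_support_vanishingIdeal]
      exact hx
    exact this
  exact (Scheme.mem_zeroLocus_iff _ _ _).1 h g hg

variable {K : Type u} [Field K] {n : ℕ}

lemma hasRootOfMultiplicity_smul {c : Fin (n + 1) → K} {k : ℕ}
    (h : HasRootOfMultiplicity (formOf c) k) (l : K) :
    HasRootOfMultiplicity (formOf fun i => l * c i) k := by
  obtain ⟨α, β, h0, h⟩ := h
  refine ⟨α, β, h0, ?_⟩
  have : formOf (fun i => l * c i) = C l * formOf c := by
    simp only [formOf, Finset.mul_sum, map_mul, mul_assoc]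
  rw [this]
  exact h.mul_left _

/-- The discriminant equations are not assumed homogeneous. As the root condition is invariant under
scaling, each homogeneous component vanishes at `c` as well. -/
lemma pointOf_mem_discriminantLocus [Infinite K] (c : Fin (n + 1) → K) (i : Fin (n + 1))
    (hi : c i ≠ 0) (h : HasRootOfMultiplicity (formOf c) 2) :
    pointOf c i hi ∈ discriminantLocus K n := by
  intro D hD
  refine mem_primeIdeal_of_homogeneousComponent _ _ fun d => ?_
  rw [mem_primeIdeal_pointOf c i hi (homogeneousComponent_isHomogeneous d D)]
  refine eval_homogeneousComponent_eq_zero c D (fun l hl => ?_) d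
  exact hD _ (fun h0 => mul_ne_zero hl hi (congrFun h0 i)) (hasRootOfMultiplicity_smul h l)

variable (K) in
/-- The charts of `P(V)` as affine open subsets. -/
def PVaffine (i : Fin (n + 1)) : (PV K n).affineOpens := ⟨chart K i, isAffineOpen_chart K i⟩

lemma exists_eq_eval₂_of_mem_vanishingIdeal [Infinite K] (i : Fin (n + 1))
    (g : Γ(PV K n, chart K i)) (hg : g ∈
      (Scheme.IdealSheafData.vanishingIdeal (discriminantLocus K n)).ideal (PVaffine K i)) :
    ∃ D ∈ discriminantEquations K n, g = eval₂ (const _) (ratio K i) D := by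
  obtain ⟨z, rfl⟩ := (chartEquiv K i).surjective g
  obtain ⟨d, D, hD, rfl⟩ := HomogeneousLocalization.Away.mk_surjective
    (homogeneousSubmodule _ K) (X_mem K i) z
  -- The factor `X i` makes the polynomial vanish at the forms with `c i = 0`, which the chart does
  -- not see; on the chart it becomes 1.
  refine ⟨X i * D, fun c hc hroot => ?_, ?_⟩
  · rw [map_mul, eval_X]
    by_cases hi : c i = 0
    · rw [hi, zero_mul]
    · refine mul_eq_zero_of_right _ ?_
      by_contra hne
      have hp := pointOf_mem_chart c i hi
      refine notMem_basicOpen_of_mem_vanishingIdeal hg (pointOf_mem_discriminantLocus c i hi hroot)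
        (mem_basicOpen_of_isUnit_evalAt ⟨_, hp⟩ _ ?_)
      have e := algebraMap_pow_mul_evalAt_awayFrac i d D hD ⟨_, hp⟩
      have hu : IsUnit (algebraMap (MvPolynomial _ K)
          (Localization.AtPrime (primeIdeal (pointOf c i hi))) D) :=
        IsLocalization.map_units _ (⟨D, fun h => hne ((mem_primeIdeal_pointOf c i hi hD).1 h)⟩ :
          (primeIdeal (pointOf c i hi)).primeCompl)
      exact isUnit_of_mul_isUnit_right (e ▸ hu)
  · rw [eval₂_mul, eval₂_X, ratio_self, one_mul]
    change chartEquiv K i (awayFrac i d D hD) = _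
    rw [awayFrac_eq_eval₂]
    refine (eval₂_comp_left (chartEquiv K i).toRingHom _ _ _).trans ?_
    congr 1
    ext c
    exact chartEquiv_awayConst i c

variable (K n) in
/-- The composition `Δ̄ ⟶ P ⟶ P(V)`. -/
def deltaToPV : DeltaBar K n ⟶ PV K n := DeltaBar.incl K n ≫ prV K n

lemma ores_app_deltaToPV (i : Fin (n + 1)) (j : Fin 2) (g : Γ(PV K n, chart K i))
    (h : deltaChart K n i j ≤ deltaToPV K n ⁻¹ᵁ chart K i) :
    ores h (((deltaToPV K n).app (chart K i)).hom g) = toDelta i j (fromPV K n i j g) :=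
  (app_ores (DeltaBar.incl K n) (PPchart_le_left i j) (((prV K n).app (chart K i)).hom g)).symm

lemma deltaChart_le (i : Fin (n + 1)) (j : Fin 2) :
    deltaChart K n i j ≤ deltaToPV K n ⁻¹ᵁ chart K i :=
  preimage_le (DeltaBar.incl K n) (PPchart_le_left i j)

lemma app_deltaToPV_eq_zero [CharZero K] (hn : 2 ≤ n) (i : Fin (n + 1))
    (g : Γ(PV K n, chart K i)) (hg : g ∈
      (Scheme.IdealSheafData.vanishingIdeal (discriminantLocus K n)).ideal (PVaffine K i)) :
    ((deltaToPV K n).app (chart K i)).hom g = 0 := by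
  obtain ⟨D, hD, rfl⟩ := exists_eq_eval₂_of_mem_vanishingIdeal i g hg
  refine functions_ext fun x hx => ?_
  obtain ⟨-, j, -, hj⟩ := exists_mem_PPchart K n (DeltaBar.incl K n x)
  refine ⟨deltaChart K n i j, deltaChart_le i j, ⟨hx, hj⟩, ?_⟩
  rw [ores_app_deltaToPV, map_zero, eval₂_comp_left, eval₂_comp_left]
  have hc : ((toDelta i j).comp (fromPV K n i j)).comp (const _) =
      (toDelta i j).comp (PPconst K n (PPchart K n i j)) := by
    ext a
    exact congrArg (toDelta i j) (fromPV_const i j a)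
  rw [← RingHom.comp_assoc, hc]
  refine eval₂_eq_zero_of_mem_discriminantEquations hn hD _ (toDelta i j ∘ PPcoord K n i j) j
    (by rw [Function.comp_apply, PPcoord_inr_self, map_one]) fun a => ?_
  rw [← eval₂_comp_left]
  exact (toDelta_eq_zero_iff i j hn _).2
    (Ideal.subset_span ⟨_, mem_deltaEquations.2 ⟨a, rfl⟩, rfl⟩)

lemma vanishingIdeal_le_ker [CharZero K] (hn : 2 ≤ n) :
    Scheme.IdealSheafData.vanishingIdeal (discriminantLocus K n) ≤ (deltaToPV K n).ker := by
  rw [Scheme.Hom.ker, Scheme.IdealSheafData.le_ofIdeals_iff]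
  intro U g hg
  rw [RingHom.mem_ker]
  refine functions_ext fun x hx => ?_
  obtain ⟨i, -, hi, -⟩ := exists_mem_PPchart K n (DeltaBar.incl K n x)
  -- The affine set `U` need not lie in a chart. On an affine `W` inside `U` and a chart, the
  -- vanishing ideal is extended from the chart.
  obtain ⟨_, ⟨W, hW, rfl⟩, hxW, hWU⟩ := (PV K n).isBasis_affineOpens.exists_subset_of_mem_open
    (show deltaToPV K n x ∈ ((U.1 ⊓ chart K i : (PV K n).Opens) : Set (PV K n)) from ⟨hx, hi⟩)
    (U.1 ⊓ chart K i).isOpen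
  have hU : W ≤ U.1 := hWU.trans inf_le_left
  have hC : W ≤ chart K i := hWU.trans inf_le_right
  refine ⟨deltaToPV K n ⁻¹ᵁ W, preimage_le _ hU, hxW, ?_⟩
  refine (app_ores (deltaToPV K n) hU g).symm.trans (Eq.trans ?_ (map_zero _).symm)
  have h1 : ores hU g ∈ (Scheme.IdealSheafData.vanishingIdeal (discriminantLocus K n)).ideal
      ⟨W, hW⟩ :=
    Scheme.IdealSheafData.ideal_le_comap_ideal (U := ⟨W, hW⟩) (V := U) _ hU hg
  rw [← Scheme.IdealSheafData.map_ideal _ (show (⟨W, hW⟩ : (PV K n).affineOpens) ≤ PVaffine K i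
    from hC)] at h1
  have h2 (I : Ideal Γ(PV K n, chart K i)) (hI : ∀ a ∈ I, ((deltaToPV K n).app _).hom a = 0) :
      I.map (ores hC) ≤ RingHom.ker ((deltaToPV K n).app W).hom := by
    rw [Ideal.map_le_iff_le_comap]
    intro a ha
    refine (app_ores (deltaToPV K n) hC a).trans ?_
    rw [hI a ha, map_zero]
  exact h2 _ (app_deltaToPV_eq_zero hn i) h1

variable (K) in
/-- The projection `Δ̄ ⟶ Δ`. -/
def deltaProj [CharZero K] (hn : 2 ≤ n) : DeltaBar K n ⟶ Delta K n :=
  (deltaToPV K n).toImage ≫ Scheme.IdealSheafData.inclusion (vanishingIdeal_le_ker hn)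

lemma deltaProj_incl [CharZero K] (hn : 2 ≤ n) :
    deltaProj K hn ≫ Delta.incl K n = DeltaBar.incl K n ≫ prV K n := by
  have h := Scheme.IdealSheafData.inclusion_subschemeι (vanishingIdeal_le_ker (K := K) hn)
  exact (Category.assoc _ _ _).trans
    ((congrArg ((deltaToPV K n).toImage ≫ ·) h).trans (deltaToPV K n).toImage_imageι)

end

end OpenSwallowtail

namespace OpenSwallowtail

open Scheme.Modules

/-! ### Tangent vectors with values in a ring, and free generation. -/

section TangentVectors

variable {X Y : Scheme.{u}} (f : X ⟶ Y)

lemma functions_glue {ι : Type u} {U : X.Opens} (V : ι → X.Opens) (h : ∀ i, V i ≤ U)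
    (hU : U ≤ iSup V) (s : ∀ i, Γ(X, V i))
    (H : ∀ i j, ores inf_le_left (s i) = ores (inf_le_right : V i ⊓ V j ≤ V j) (s j)) :
    ∃ t : Γ(X, U), ∀ i, ores (h i) t = s i := by
  obtain ⟨t, ht, -⟩ := TopCat.Sheaf.existsUnique_gluing' X.sheaf V U
    (fun i => homOfLE (h i)) hU s H
  exact ⟨t, ht⟩

/-- A trivial annihilator makes the local coefficients unique, so they glue. -/
lemma GeneratesOn.freelyGenerates {M : X.Modules} {U : X.Opens} {e : Γ(M, U)}
    (he : GeneratesOn M e)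
    (h0 : ∀ (V : X.Opens) (h : V ≤ U) (g : Γ(X, V)), g • mres M h e = 0 → g = 0) :
    FreelyGenerates M e := by
  have huniq {V : X.Opens} (h : V ≤ U) {g g' : Γ(X, V)} (hg : g • mres M h e = g' • mres M h e) :
      g = g' := by
    rw [← sub_eq_zero] at hg ⊢
    exact h0 V h _ (by rw [sub_smul, hg])
  intro V h s
  refine existsUnique_of_exists_of_unique ?_ fun g g' hg hg' => huniq h (hg.symm.trans hg')
  choose W hV hU g hx hg using fun x : V => he V s x.1 x.2 (h x.2)
  obtain ⟨t, ht⟩ := functions_glue W hV (fun x hxV => Opens.mem_iSup.2 ⟨⟨x, hxV⟩, hx _⟩) g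
    fun x y => by
      refine huniq (inf_le_left.trans (hU x)) ?_
      have h1 := congrArg (mres M (inf_le_left : W x ⊓ W y ≤ W x)) (hg x)
      have h2 := congrArg (mres M (inf_le_right : W x ⊓ W y ≤ W y)) (hg y)
      simp only [mres_mres, mres_smul] at h1 h2
      exact h1.symm.trans h2
  refine ⟨t, sections_ext M fun x hxV => ⟨W ⟨x, hxV⟩, hV _, hx _, ?_⟩⟩
  rw [hg, mres_smul, ht, mres_mres]

lemma exists_stalk_lift {C : X.Opens} (hC : IsAffineOpen C) {x : X} (hx : x ∈ C) {S : Type*}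
    [CommRing S] (φ : Γ(X, C) →+* S)
    (h : ∀ g, IsUnit ((X.presheaf.germ C x hx).hom g) → IsUnit (φ g)) :
    ∃ E : X.presheaf.stalk x →+* S, ∀ g, E ((X.presheaf.germ C x hx).hom g) = φ g := by
  let := (X.presheaf.germ C x hx).hom.toAlgebra
  have := hC.isLocalization_stalk ⟨x, hx⟩
  refine ⟨IsLocalization.lift (M := (hC.primeIdealOf ⟨x, hx⟩).asIdeal.primeCompl) (g := φ)
    fun y => h _ (IsLocalization.map_units (X.presheaf.stalk x) y), fun g => ?_⟩
  exact IsLocalization.lift_eq _ g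

lemma stalk_hom_ext {C : X.Opens} (hC : IsAffineOpen C) {x : X} (hx : x ∈ C) {S : Type*}
    [CommRing S] (E E' : X.presheaf.stalk x →+* S)
    (h : ∀ g, E ((X.presheaf.germ C x hx).hom g) = E' ((X.presheaf.germ C x hx).hom g)) : E = E' := by
  let := (X.presheaf.germ C x hx).hom.toAlgebra
  have := hC.isLocalization_stalk ⟨x, hx⟩
  exact IsLocalization.ringHom_ext (hC.primeIdealOf ⟨x, hx⟩).asIdeal.primeCompl (RingHom.ext h)

lemma exists_germ_mul_eq {C : X.Opens} (hC : IsAffineOpen C) {x : X} (hx : x ∈ C)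
    (a : X.presheaf.stalk x) : ∃ b s, IsUnit ((X.presheaf.germ C x hx).hom s) ∧
      a * (X.presheaf.germ C x hx).hom s = (X.presheaf.germ C x hx).hom b := by
  let := (X.presheaf.germ C x hx).hom.toAlgebra
  have := hC.isLocalization_stalk ⟨x, hx⟩
  obtain ⟨⟨b, s⟩, h⟩ := IsLocalization.surj (hC.primeIdealOf ⟨x, hx⟩).asIdeal.primeCompl a
  exact ⟨b, s, IsLocalization.map_units (X.presheaf.stalk x) s, h⟩

open TrivSqZeroExt in
/-- If a tangent vector along the fibres of `f` takes the value `1` on `t`, then a multiple of the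
differential of `t` vanishes only if the coefficient does. -/
theorem map_germ_eq_zero_of_smul_dOmega_eq_zero {C : X.Opens} (hC : IsAffineOpen C) {W : Y.Opens}
    (hW : IsAffineOpen W) (hCW : C ≤ f ⁻¹ᵁ W) {x : X} (hx : x ∈ C) {R : Type u} [CommRing R]
    (ψ : X.presheaf.stalk x →+* R) (φ : Γ(X, C) →+* TrivSqZeroExt R R)
    (hφ : ∀ g, fst (φ g) = ψ ((X.presheaf.germ C x hx).hom g))
    (hφW : ∀ b, snd (φ (ores hCW ((f.app W).hom b))) = 0) (t : Γ(X, C)) (ht : snd (φ t) = 1)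
    {U : X.Opens} (hU : U ≤ C) (hxU : x ∈ U) (g : Γ(X, U)) (h : g • dOmega f (ores hU t) = 0) :
    ψ ((X.presheaf.germ U x hxU).hom g) = 0 := by
  -- An element of `R[ε]` is a unit as soon as its first component is, so `φ` extends from `C` to
  -- the local ring at `x`.
  obtain ⟨E, hE⟩ := exists_stalk_lift hC hx φ fun g hg => by
    rw [isUnit_iff_isUnit_fst, hφ]
    exact hg.map ψ
  have hfst : (fstHom ℤ R R).toRingHom.comp E = ψ :=
    stalk_hom_ext hC hx _ _ fun g => by rw [← hφ, ← hE]; rfl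
  have hEf (b) : E ((f.stalkMap x).hom ((Y.presheaf.germ W (f x) (hCW hx)).hom b)) =
      inl (fst (φ (ores hCW ((f.app W).hom b)))) := by
    have e : (f.stalkMap x).hom ((Y.presheaf.germ W (f x) (hCW hx)).hom b) =
        (X.presheaf.germ C x hx).hom (ores hCW ((f.app W).hom b)) := by
      refine (Scheme.Hom.germ_stalkMap_apply f W x (hCW hx) b).trans ?_
      exact (TopCat.Presheaf.germ_res_apply X.presheaf (homOfLE hCW) x hx _).symm
    rw [e, hE]
    exact TrivSqZeroExt.ext (fst_inl _ _).symm ((hφW b).trans (snd_inl _ _).symm)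
  -- A germ on `Y` is a quotient `b / s` of functions on `W`. The images of `b` and `s` have no
  -- `ε`-component and that of `s` is a unit, so the quotient has none either.
  have key (a) : E ((f.stalkMap x).hom a) = inl (fst (E ((f.stalkMap x).hom a))) := by
    obtain ⟨b, s, hs, e⟩ := exists_germ_mul_eq hW (hCW hx) a
    have e1 := congrArg (fun a => E ((f.stalkMap x).hom a)) e
    simp only [map_mul, hEf] at e1
    have hu : IsUnit (fst (φ (ores hCW ((f.app W).hom s)))) := by
      have := (hs.map (f.stalkMap x).hom).map E
      rw [hEf, isUnit_iff_isUnit_fst, fst_inl] at this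
      exact this
    refine TrivSqZeroExt.ext (fst_inl _ _).symm ?_
    have e2 := congrArg snd e1
    rw [snd_mul, snd_inl, snd_inl, fst_inl, smul_zero, zero_add, op_smul_eq_mul] at e2
    rw [snd_inl]
    exact hu.mul_left_eq_zero.1 e2
  have h1 := mul_snd_eq_zero_of_smul_dOmega_eq_zero E key hxU g (ores hU t) h
  have h2 : (X.presheaf.germ U x hxU).hom (ores hU t) = (X.presheaf.germ C x hx).hom t :=
    TopCat.Presheaf.germ_res_apply X.presheaf (homOfLE hU) x hxU t
  rw [h2, hE, ht, mul_one] at h1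
  rw [← hfst]
  exact h1

end TangentVectors

/-! ### Differentials on the projective line. -/

section ProjectiveLine

open ProjSpace

variable {K : Type u} [Field K]

lemma exists_toSpec_app_eq {ι : Type} (U : (ProjSpace K ι).Opens) (h : U ≤ toSpec K ι ⁻¹ᵁ ⊤)
    (c : K) : ∃ b, const U c = ores h (((toSpec K ι).app ⊤).hom b) :=
  ⟨(Scheme.ΓSpecIso (CommRingCat.of K)).inv.hom c, rfl⟩

lemma toSpec_app_eq_const {ι : Type} (U : (ProjSpace K ι).Opens) (h : U ≤ toSpec K ι ⁻¹ᵁ ⊤)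
    (b) : ∃ c : K, ores h (((toSpec K ι).app ⊤).hom b) = const U c := by
  obtain ⟨c, rfl⟩ :=
    (Scheme.ΓSpecIso (CommRingCat.of K)).commRingCatIsoToRingEquiv.symm.surjective b
  exact ⟨c, rfl⟩

variable (K) in
/-- The affine coordinate on a chart of the projective line. -/
def lineCoord (j : Fin 2) : Γ(PW K, chart K j) := ratio K j j.rev

lemma rev_ne (j : Fin 2) : j.rev ≠ j := by
  fin_cases j <;> decide

lemma generatesOn_dOmega_lineCoord (j : Fin 2) :
    GeneratesOn (Omega (toSpec K (Fin 2))) (dOmega _ (lineCoord K j)) := by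
  refine exists_eq_smul_dOmega (isAffineOpen_chart K j) (W := ⊤) le_top _ ?_
  rw [eq_top_iff]
  rintro g -
  obtain ⟨-, D, -, rfl⟩ := exists_eq_eval₂ j g
  induction D using MvPolynomial.induction_on with
  | C c =>
    rw [eval₂_C]
    obtain ⟨b, hb⟩ := exists_toSpec_app_eq (chart K j) le_top c
    exact Subring.subset_closure (Or.inr ⟨b, hb.symm⟩)
  | add p q hp hq => rw [eval₂_add]; exact add_mem hp hq
  | mul_X p k hp =>
    rw [eval₂_mul, eval₂_X]
    refine mul_mem hp ?_
    by_cases hk : k = j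
    · rw [hk, ratio_self]; exact one_mem _
    · have : k = j.rev := by have := rev_ne j; omega
      rw [this]
      exact Subring.subset_closure (Or.inl rfl)

-- The tangent vector `t ↦ t + ε` with values in the local ring at each point of the chart shows
-- that `g dt = 0` kills every germ of `g`.
open TrivSqZeroExt in
theorem freelyGenerates_dOmega_lineCoord (j : Fin 2) :
    FreelyGenerates (Omega (toSpec K (Fin 2))) (dOmega _ (lineCoord K j)) := by
  refine (generatesOn_dOmega_lineCoord j).freelyGenerates fun V h g hg => ?_
  refine TopCat.Presheaf.section_ext (PW K).sheaf V g 0 fun x hx => ?_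
  rw [map_zero]
  let γ := ((PW K).presheaf.germ (chart K j) x (h hx)).hom
  obtain ⟨φ, hc, hr⟩ := exists_hom_of_chart
    (((inlHom ((PW K).presheaf.stalk x) ((PW K).presheaf.stalk x)).comp γ).comp (const _))
    (fun k : Fin 2 => inl (γ (ratio K j k)) + if k = j then 0 else inr 1) j
    (by rw [ratio_self, map_one, if_pos rfl, add_zero, inl_one])
  have hφ : ∀ g, fst (φ g) = γ g := fun g => by
    obtain ⟨-, D, -, rfl⟩ := exists_eq_eval₂ j g
    induction D using MvPolynomial.induction_on with
    | C c => rw [eval₂_C, hc]; rfl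
    | add p q hp hq => rw [eval₂_add, map_add, fst_add, hp, hq, map_add]
    | mul_X p k hp =>
      rw [eval₂_mul, eval₂_X, map_mul, fst_mul, hp, map_mul, hr, fst_add, fst_inl]
      congr 1
      split_ifs <;> simp
  refine map_germ_eq_zero_of_smul_dOmega_eq_zero (toSpec K (Fin 2)) (isAffineOpen_chart K j)
    (isAffineOpen_top _) le_top (h hx) (RingHom.id _) φ hφ (fun b => ?_) (lineCoord K j) ?_ h hx g
    (by rw [← mres_dOmega, hg])
  · obtain ⟨c, hb⟩ := toSpec_app_eq_const (chart K j) le_top b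
    rw [hb, hc]
    rfl
  · rw [lineCoord, hr, if_neg (rev_ne j), snd_add, snd_inl, snd_inr, zero_add]

end ProjectiveLine

end OpenSwallowtail

namespace OpenSwallowtail

open Scheme.Modules ProjSpace

/-! ### The generator `dt` of the differentials of `π` and the relations that it satisfies. -/

section Differentials

variable {K : Type u} [Field K] {n : ℕ}

variable (K n) in
/-- The open subset of the incidence variety on which a coordinate of the root does not vanish. -/
def rootChart (j : Fin 2) : (DeltaBar K n).Opens := rootProj K n ⁻¹ᵁ chart K j

variable (K n) in
/-- The affine coordinate of the root. -/
def rootCoord (j : Fin 2) : Γ(DeltaBar K n, rootChart K n j) :=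
  ((rootProj K n).app _).hom (lineCoord K j)

/-- The affine coordinate of the root on a chart. -/
def chartCoord (i : Fin (n + 1)) (j : Fin 2) : Γ(DeltaBar K n, deltaChart K n i j) :=
  toDelta i j (PPcoord K n i j (Sum.inr j.rev))

lemma deltaChart_le_rootChart (i : Fin (n + 1)) (j : Fin 2) :
    deltaChart K n i j ≤ rootChart K n j :=
  preimage_le (DeltaBar.incl K n) (PPchart_le_right i j)

lemma ores_rootCoord (i : Fin (n + 1)) (j : Fin 2) :
    ores (deltaChart_le_rootChart i j) (rootCoord K n j) = chartCoord i j :=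
  (app_ores (DeltaBar.incl K n) (PPchart_le_right i j)
    (((prW K n).app (chart K j)).hom (lineCoord K j))).symm

lemma exists_mem_deltaChart_of_mem_rootChart {x : DeltaBar K n} {j : Fin 2}
    (h : x ∈ rootChart K n j) : ∃ i, x ∈ deltaChart K n i j := by
  obtain ⟨i, -, hi, -⟩ := exists_mem_PPchart K n (DeltaBar.incl K n x)
  exact ⟨i, hi, h⟩

lemma ores_app_eq_of_comp_eq {X Y Z : Scheme.{u}} {f : X ⟶ Y} {g : Y ⟶ Z} {h : X ⟶ Z}
    (e : f ≫ g = h) {U : Z.Opens} {V : X.Opens} (hV : V ≤ h ⁻¹ᵁ U) (hV' : V ≤ f ⁻¹ᵁ g ⁻¹ᵁ U)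
    (a : Γ(Z, U)) :
    ores hV ((h.app U).hom a) = ores hV' ((f.app (g ⁻¹ᵁ U)).hom ((g.app U).hom a)) := by
  subst e
  rfl

variable {π : DeltaBar K n ⟶ Delta K n}
  (hπ : π ≫ Delta.incl K n = DeltaBar.incl K n ≫ prV K n)

section

include hπ

lemma deltaChart_le_preimage (i : Fin (n + 1)) (j : Fin 2) :
    deltaChart K n i j ≤ π ⁻¹ᵁ Delta.incl K n ⁻¹ᵁ chart K i := by
  have h : deltaChart K n i j ≤ (DeltaBar.incl K n ≫ prV K n) ⁻¹ᵁ chart K i := deltaChart_le i j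
  rw [← hπ] at h
  exact h

lemma toDelta_fromPV (i : Fin (n + 1)) (j : Fin 2) (a : Γ(PV K n, chart K i)) :
    toDelta i j (fromPV K n i j a) = ores (deltaChart_le_preimage hπ i j)
      ((π.app (Delta.incl K n ⁻¹ᵁ chart K i)).hom (((Delta.incl K n).app (chart K i)).hom a)) := by
  rw [← ores_app_deltaToPV i j a (deltaChart_le i j)]
  exact ores_app_eq_of_comp_eq hπ _ _ a

lemma dOmega_toDelta_fromPV (i : Fin (n + 1)) (j : Fin 2) (a : Γ(PV K n, chart K i)) :
    dOmega π (toDelta i j (fromPV K n i j a)) = 0 := by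
  rw [toDelta_fromPV hπ]
  exact dOmega_app _ _

/-- The chart of `Δ̄` is closed in that of `P`, whose functions are generated by `t` and functions
from `P(V)`. On `Δ̄` the latter are pulled back along `π`. -/
lemma generatesOn_chartCoord (i : Fin (n + 1)) (j : Fin 2) :
    GeneratesOn (Omega π) (dOmega π (chartCoord i j)) := by
  refine exists_eq_smul_dOmega (isAffineOpen_deltaChart K n i j) (deltaChart_le_preimage hπ i j) _ ?_
  have h := congrArg (Subring.map (toDelta (K := K) i j)) (closure_eq_top_of_ne i j (rev_ne j))
  rw [RingHom.map_closure, ← RingHom.range_eq_map,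
    RingHom.range_eq_top.2 (toDelta_surjective i j)] at h
  rw [eq_top_iff, ← h]
  refine Subring.closure_mono ?_
  rintro _ ⟨a, rfl | ⟨a, rfl⟩, rfl⟩
  · exact Or.inl rfl
  · exact Or.inr ⟨_, (toDelta_fromPV hπ i j a).symm⟩

lemma generatesOn_rootCoord (j : Fin 2) :
    GeneratesOn (Omega π) (dOmega π (rootCoord K n j)) := by
  intro V s x hV hx
  obtain ⟨i, hi⟩ := exists_mem_deltaChart_of_mem_rootChart hx
  obtain ⟨W, hWV, hWC, g, hxW, hg⟩ := generatesOn_chartCoord hπ i j V s x hV hi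
  refine ⟨W, hWV, hWC.trans (deltaChart_le_rootChart i j), g, hxW, ?_⟩
  rw [hg, ← ores_rootCoord, ← mres_dOmega, mres_mres]

/-- The chain rule `dG = G_t dt`: functions from `P(V)` are constants for `π`, and the only affine
coordinate of the root is the one of index `j.rev`. -/
lemma dOmega_toDelta_dehomogenize (i : Fin (n + 1)) (j : Fin 2)
    (G : MvPolynomial (Fin (n + 1) ⊕ Fin 2) K) :
    dOmega π (toDelta i j (dehomogenize G i j)) =
      toDelta i j (dehomogenize (pderiv (Sum.inr j.rev) G) i j) • dOmega π (chartCoord i j) := by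
  induction G using MvPolynomial.induction_on with
  | C a =>
    rw [dehomogenize_C, ← fromPV_const, dOmega_toDelta_fromPV hπ, pderiv_C]
    simp [dehomogenize]
  | add p q hp hq =>
    rw [dehomogenize_add, map_add, dOmega_add, hp, hq, map_add, dehomogenize_add, map_add, add_smul]
  | mul_X p k hp =>
    rw [dehomogenize_mul, map_mul, dOmega_mul, hp, pderiv_mul, dehomogenize_add, dehomogenize_mul,
      dehomogenize_mul, map_add, map_mul, map_mul, add_smul, dehomogenize_X, smul_smul,
      mul_comm (toDelta i j (PPcoord K n i j k)), add_comm, mul_smul (toDelta i j (dehomogenize p i j))]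
    congr 2
    rcases k with k | k
    · rw [pderiv_X_of_ne (by simp), ← fromPV_ratio, dOmega_toDelta_fromPV hπ]
      simp [dehomogenize]
    · by_cases hk : k = j
      · rw [pderiv_X_of_ne (by simp [hk, (rev_ne j).symm]), hk, PPcoord_inr_self, map_one, dOmega_one]
        simp [dehomogenize]
      · obtain rfl : k = j.rev := by have := rev_ne j; omega
        rw [pderiv_X_self]
        simp [dehomogenize, chartCoord]

/-- Differentiating `F_x = F_y = 0` on `Δ̄` shows that the second derivatives involving the index
`j.rev` kill `dt`. For the one taken twice along `j`, Euler's relation for the first derivative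
along `j` is used, where the coordinate of index `j` equals 1. -/
lemma toDelta_smul_eq_zero [CharZero K] (hn : 2 ≤ n) (i : Fin (n + 1)) (j : Fin 2)
    (g : Γ(PP K n, PPchart K n i j)) (hg : g ∈ chartIdeal (gammaEquations K n) i j) :
    toDelta i j g • dOmega π (chartCoord i j) = 0 := by
  have h0 (a : Fin 2) : toDelta (K := K) i j
      (dehomogenize (pderiv (Sum.inr a) (universalForm K n)) i j) = 0 :=
    (toDelta_eq_zero_iff i j hn _).2
      (Ideal.subset_span ⟨_, mem_deltaEquations.2 ⟨a, rfl⟩, rfl⟩)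
  have h1 (a : Fin 2) : toDelta i j (dehomogenize (pderiv (Sum.inr j.rev)
      (pderiv (Sum.inr a) (universalForm K n))) i j) • dOmega π (chartCoord i j) = 0 := by
    rw [← dOmega_toDelta_dehomogenize hπ, h0, dOmega_zero]
  let I : Ideal Γ(PP K n, PPchart K n i j) := Ideal.comap (toDelta i j)
    (LinearMap.ker (LinearMap.toSpanSingleton Γ(DeltaBar K n, deltaChart K n i j) _
      (dOmega π (chartCoord i j))))
  suffices chartIdeal (gammaEquations K n) i j ≤ I from this hg
  refine Ideal.span_le.2 ?_
  rintro _ ⟨G, hG, rfl⟩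
  obtain ⟨a, b, rfl⟩ := mem_gammaEquations.1 hG
  by_cases hb : b = j
  · by_cases ha : a = j
    · rw [ha, hb]
      have e := congrArg (fun G => toDelta i j (dehomogenize G i j) • dOmega π (chartCoord i j))
        (((isBihomogeneous_universalForm K n).pderiv_inr (by omega) j).euler)
      have hs (f : Fin 2 → MvPolynomial (Fin (n + 1) ⊕ Fin 2) K) :
          ∑ a, f a = f j + f j.rev := by
        rw [Fin.sum_univ_two]
        fin_cases j
        · rfl
        · exact add_comm _ _
      rw [hs, nsmul_eq_mul, dehomogenize_mul, map_mul, h0, mul_zero, zero_smul, dehomogenize_add,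
        map_add, add_smul, dehomogenize_mul, dehomogenize_mul, map_mul, map_mul, mul_smul, mul_smul,
        h1, smul_zero, add_zero, dehomogenize_X, PPcoord_inr_self, map_one, one_smul] at e
      exact e
    · obtain rfl : a = j.rev := by have := rev_ne j; omega
      rw [pderiv_pderiv_comm, hb]
      exact h1 j
  · obtain rfl : b = j.rev := by have := rev_ne j; omega
    exact h1 a

end

end Differentials

end OpenSwallowtail

namespace OpenSwallowtail

open Scheme.Modules ProjSpace TrivSqZeroExt

/-! ### The annihilator of `dt` is the ideal of `Γ̄`. -/

lemma eq_zero_of_germ_eq_zero {X : Scheme.{u}} {U : X.Opens} {g : Γ(X, U)}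
    (h : ∀ x hx, (X.presheaf.germ U x hx).hom g = 0) : g = 0 :=
  TopCat.Presheaf.section_ext X.sheaf U g 0 fun x hx => (h x hx).trans (map_zero _).symm

lemma mem_preimage_iff {X Z : Scheme.{u}} (q : Z ⟶ X) (V : X.Opens) (z : Z) :
    z ∈ q ⁻¹ᵁ V ↔ q z ∈ V := Iff.rfl

lemma germ_app_eq_zero_of_smul_dOmega_eq_zero {X Y Z : Scheme.{u}} {f : X ⟶ Y} {q : Z ⟶ X}
    {C : X.Opens} (hC : IsAffineOpen C) {W : Y.Opens} (hW : IsAffineOpen W) (hCW : C ≤ f ⁻¹ᵁ W)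
    {z : Z} (hz : z ∈ q ⁻¹ᵁ C) (φ : Γ(X, C) →+* TrivSqZeroExt (Z.presheaf.stalk z) (Z.presheaf.stalk z))
    (hφ : ∀ g, fst (φ g) = (Z.presheaf.germ (q ⁻¹ᵁ C) z hz).hom ((q.app C).hom g))
    (hφW : ∀ b, snd (φ (ores hCW ((f.app W).hom b))) = 0) (t : Γ(X, C)) (ht : snd (φ t) = 1)
    {V : X.Opens} (hzV : z ∈ q ⁻¹ᵁ V) (g : Γ(X, V))
    (h : ores (inf_le_left : V ⊓ C ≤ V) g •
      dOmega f (ores (inf_le_right : V ⊓ C ≤ C) t) = 0) :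
    (Z.presheaf.germ (q ⁻¹ᵁ V) z hzV).hom ((q.app V).hom g) = 0 := by
  have e := map_germ_eq_zero_of_smul_dOmega_eq_zero f hC hW hCW hz (q.stalkMap z).hom φ
    (fun g => (hφ g).trans (Scheme.Hom.germ_stalkMap_apply q C z hz g).symm) hφW t ht
    inf_le_right ⟨hzV, hz⟩ _ h
  have e' : (X.presheaf.germ (V ⊓ C) (q z) ⟨hzV, hz⟩).hom (ores inf_le_left g) =
      (X.presheaf.germ V (q z) hzV).hom g :=
    TopCat.Presheaf.germ_res_apply X.presheaf (homOfLE inf_le_left) (q z) ⟨hzV, hz⟩ g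
  rw [e'] at e
  exact (Scheme.Hom.germ_stalkMap_apply q V z hzV g).symm.trans e

lemma app_eq_zero_of_germ_eq_zero {X Z : Scheme.{u}} (q : Z ⟶ X) {V : X.Opens} {g : Γ(X, V)}
    (h : ∀ z (hz : z ∈ q ⁻¹ᵁ V),
      (Z.presheaf.germ (q ⁻¹ᵁ V) z hz).hom ((q.app V).hom g) = 0) : (q.app V).hom g = 0 :=
  eq_zero_of_germ_eq_zero h

lemma exists_ringHom_eq_germ_app {X Z : Scheme.{u}} (q : Z ⟶ X) (C : X.Opens) (z : Z)
    (hz : z ∈ q ⁻¹ᵁ C) : ∃ ψ : Γ(X, C) →+* Z.presheaf.stalk z,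
      ∀ g, ψ g = (Z.presheaf.germ (q ⁻¹ᵁ C) z hz).hom ((q.app C).hom g) :=
  ⟨(Z.presheaf.germ (q ⁻¹ᵁ C) z hz).hom.comp (q.app C).hom, fun _ => rfl⟩

section Relations

variable {K : Type u} [Field K] {n : ℕ} (hn : 2 ≤ n)
  {π : DeltaBar K n ⟶ Delta K n} (hπ : π ≫ Delta.incl K n = DeltaBar.incl K n ≫ prV K n)
  {q : GammaBar K n ⟶ DeltaBar K n} (hq : q ≫ DeltaBar.incl K n = GammaBar.incl K n)

include hq in
lemma isClosedImmersion_of_comp_incl : IsClosedImmersion q := by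
  have : IsClosedImmersion (q ≫ DeltaBar.incl K n) := hq ▸ inferInstance
  exact .of_comp q (DeltaBar.incl K n)

variable [CharZero K]

include hn hπ hq in
lemma smul_dOmega_eq_zero_of_app_eq_zero (j : Fin 2) {V : (DeltaBar K n).Opens}
    (h : V ≤ rootChart K n j) (g : Γ(DeltaBar K n, V)) (hg : (q.app V).hom g = 0) :
    g • mres (Omega π) h (dOmega π (rootCoord K n j)) = 0 := by
  have := isClosedImmersion_of_comp_incl hq
  refine sections_ext _ fun x hx => ?_
  obtain ⟨i, hi⟩ := exists_mem_deltaChart_of_mem_rootChart (h hx)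
  obtain ⟨_, ⟨W, hW, rfl⟩, hxW, hWV⟩ := (DeltaBar K n).isBasis_affineOpens.exists_subset_of_mem_open
    (show x ∈ ((V ⊓ deltaChart K n i j : (DeltaBar K n).Opens) : Set (DeltaBar K n)) from ⟨hx, hi⟩)
    (V ⊓ deltaChart K n i j).isOpen
  have hV : W ≤ V := hWV.trans inf_le_left
  have hC : W ≤ deltaChart K n i j := hWV.trans inf_le_right
  refine ⟨W, hV, hxW, ?_⟩
  -- Over `W` the ideal of `Γ̄` is generated by its elements on the whole chart, which lift to
  -- combinations of second derivatives of `F`.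
  have h1 : ores hV g ∈ q.ker.ideal ⟨W, hW⟩ := by
    rw [Scheme.Hom.ker_apply]
    refine (app_ores q hV g).trans ?_
    rw [hg, map_zero]
  rw [← Scheme.IdealSheafData.map_ideal q.ker (V := ⟨_, isAffineOpen_deltaChart K n i j⟩) hC,
    Scheme.Hom.ker_apply] at h1
  let I : Ideal Γ(DeltaBar K n, W) := LinearMap.ker (LinearMap.toSpanSingleton _ _
      (mres (Omega π) hC (dOmega π (chartCoord i j))))
  have h2 : (RingHom.ker (q.app (deltaChart K n i j)).hom).map (ores hC) ≤ I := by
    rw [Ideal.map_le_iff_le_comap]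
    intro a ha
    obtain ⟨b, rfl⟩ := toDelta_surjective i j a
    have hb := (app_toDelta_eq_zero_iff i j hn q hq b).1 ha
    change ores hC (toDelta i j b) • mres (Omega π) hC (dOmega π (chartCoord i j)) = 0
    rw [← mres_smul, toDelta_smul_eq_zero hπ hn i j b hb, map_zero]
  have h3 : ores hV g • mres (Omega π) hC (dOmega π (chartCoord i j)) = 0 := h2 h1
  rw [mres_smul, mres_mres, map_zero, ← h3, ← ores_rootCoord, ← mres_dOmega, mres_mres]

include hn in
/-- The first order deformation of a point of the curve of second derivatives along the fibres of
the projection to `P(V)`. -/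
lemma exists_tangentVector {R : Type u} [CommRing R] (i : Fin (n + 1)) (j : Fin 2)
    (ψ : Γ(DeltaBar K n, deltaChart K n i j) →+* R)
    (hψ : ∀ g ∈ chartIdeal (gammaEquations K n) i j, ψ (toDelta i j g) = 0) :
    ∃ φ : Γ(DeltaBar K n, deltaChart K n i j) →+* TrivSqZeroExt R R,
      (∀ g, fst (φ g) = ψ g) ∧ (∀ a, snd (φ (toDelta i j (fromPV K n i j a))) = 0) ∧
      snd (φ (chartCoord i j)) = 1 := by
  obtain ⟨Φ, hV, hW⟩ := exists_hom_of_PPchart i j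
    ((inlHom R R).comp ((ψ.comp (toDelta i j)).comp (fromPV K n i j)))
    (fun k : Fin 2 => inl (ψ (toDelta i j (PPcoord K n i j (Sum.inr k)))) +
      if k = j then 0 else inr 1)
    (by rw [PPcoord_inr_self, map_one, map_one, if_pos rfl, add_zero, inl_one])
  -- The first order Taylor formula `G(t + ε) = G + ε G_t`.
  have key (G) : Φ (dehomogenize G i j) = inl (ψ (toDelta i j (dehomogenize G i j))) +
      inr (ψ (toDelta i j (dehomogenize (pderiv (Sum.inr j.rev) G) i j))) := by
    induction G using MvPolynomial.induction_on with
    | C a =>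
      rw [dehomogenize_C, ← fromPV_const, hV, pderiv_C]
      simp [dehomogenize]
    | add p q hp hq =>
      rw [dehomogenize_add, map_add Φ, hp, hq, map_add (pderiv _), dehomogenize_add]
      simp only [map_add, inl_add, inr_add]
      abel
    | mul_X p k hp =>
      have hk : Φ (PPcoord K n i j k) = inl (ψ (toDelta i j (PPcoord K n i j k))) +
          inr (ψ (toDelta i j (dehomogenize (pderiv (Sum.inr j.rev) (X k)) i j))) := by
        rcases k with k | k
        · rw [pderiv_X_of_ne (by simp), ← fromPV_ratio, hV]
          simp [dehomogenize]
        · rw [hW]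
          by_cases hk : k = j
          · rw [if_pos hk, pderiv_X_of_ne (by simp [hk, (rev_ne j).symm])]
            simp [dehomogenize]
          · obtain rfl : k = j.rev := by have := rev_ne j; omega
            rw [if_neg hk, pderiv_X_self]
            simp [dehomogenize]
      rw [dehomogenize_mul, map_mul, hp, dehomogenize_X, hk, pderiv_mul, dehomogenize_add,
        dehomogenize_mul, dehomogenize_mul, dehomogenize_X]
      refine TrivSqZeroExt.ext ?_ ?_
      · simp
      · simp
        ring
  -- The equations of `Δ̄` go to first and second derivatives of `F`, all of which vanish under `ψ`;
  -- hence `Φ` descends to `Δ̄`.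
  have hker : RingHom.ker (toDelta (K := K) i j) ≤ RingHom.ker Φ := by
    intro g hg
    have hg := (toDelta_eq_zero_iff i j hn g).1 hg
    suffices chartIdeal (deltaEquations K n) i j ≤ RingHom.ker Φ from this hg
    refine Ideal.span_le.2 ?_
    rintro _ ⟨G, hG, rfl⟩
    obtain ⟨a, rfl⟩ := mem_deltaEquations.1 hG
    rw [SetLike.mem_coe, RingHom.mem_ker, key, hψ _ (chartIdeal_delta_le_gamma i j hn
      (Ideal.subset_span ⟨_, hG, rfl⟩)), hψ _ (Ideal.subset_span
      ⟨_, mem_gammaEquations.2 ⟨a, _, rfl⟩, rfl⟩), inl_zero, inr_zero, add_zero]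
  let φ := (toDelta (K := K) i j).liftOfSurjective (toDelta_surjective i j) ⟨Φ, hker⟩
  have hφ (g) : φ (toDelta i j g) = Φ g :=
    RingHom.liftOfRightInverse_comp_apply _ _ _ ⟨Φ, hker⟩ g
  refine ⟨φ, fun g => ?_, fun a => ?_, ?_⟩
  · obtain ⟨g, rfl⟩ := toDelta_surjective i j g
    obtain ⟨G, rfl⟩ := exists_eq_dehomogenize i j g
    rw [hφ, key]
    simp
  · rw [hφ, hV]
    rfl
  · rw [chartCoord, hφ, hW, if_neg (rev_ne j)]
    simp

include hn hπ hq in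
lemma exists_tangentVector_of_app_eq_zero {R : Type u} [CommRing R] (i : Fin (n + 1)) (j : Fin 2)
    (ψ : Γ(DeltaBar K n, deltaChart K n i j) →+* R)
    (hψ : ∀ g, (q.app (deltaChart K n i j)).hom g = 0 → ψ g = 0) :
    ∃ φ : Γ(DeltaBar K n, deltaChart K n i j) →+* TrivSqZeroExt R R,
      (∀ g, fst (φ g) = ψ g) ∧ (∀ b, snd (φ (ores (deltaChart_le_preimage hπ i j)
        ((π.app (Delta.incl K n ⁻¹ᵁ chart K i)).hom b))) = 0) ∧ snd (φ (chartCoord i j)) = 1 := by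
  have h0 : ∀ g ∈ chartIdeal (gammaEquations K n) i j, ψ (toDelta i j g) = 0 := fun g hg => by
    apply hψ
    exact (app_toDelta_eq_zero_iff i j hn q hq g).2 hg
  have h := exists_tangentVector hn i j ψ h0
  cases h with | intro φ h =>
  refine Exists.intro φ ?_
  refine And.intro h.1 ?_
  refine And.intro ?_ h.2.2
  intro b
  have hs : Function.Surjective ((Delta.incl K n).app (chart K i)).hom :=
    (Delta.incl K n).app_surjective _ (isAffineOpen_chart K i)
  cases hs b with | intro a ha =>
  have e := h.2.1 a
  rw [toDelta_fromPV hπ, ha] at e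
  exact e

-- At each point `z` of `Γ̄` the tangent vector is taken with values in the local ring of `Γ̄`, so
-- that it detects the germ at `z` of the restriction of `g`.
include hn hπ hq in
lemma app_eq_zero_of_smul_dOmega_eq_zero (j : Fin 2) {V : (DeltaBar K n).Opens}
    (h : V ≤ rootChart K n j) (g : Γ(DeltaBar K n, V))
    (hg : g • mres (Omega π) h (dOmega π (rootCoord K n j)) = 0) : (q.app V).hom g = 0 := by
  refine app_eq_zero_of_germ_eq_zero q ?_
  intro z hz
  have hz' := exists_mem_deltaChart_of_mem_rootChart (h ((mem_preimage_iff q V z).1 hz))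
  cases hz' with | intro i hi =>
  rw [← mem_preimage_iff q] at hi
  have hψ := exists_ringHom_eq_germ_app q (deltaChart K n i j) z hi
  cases hψ with | intro ψ hψ =>
  have hψ' (g) (hg : (q.app (deltaChart K n i j)).hom g = 0) : ψ g = 0 := by
    rw [hψ, hg]
    exact RingHom.map_zero _
  have hφ := exists_tangentVector_of_app_eq_zero hn hπ hq i j ψ hψ'
  cases hφ with | intro φ hφ =>
  have e2 := congrArg (mres (Omega π) (inf_le_left : V ⊓ deltaChart K n i j ≤ V)) hg
  rw [mres_smul, mres_mres, map_zero] at e2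
  have hg' : ores (inf_le_left : V ⊓ deltaChart K n i j ≤ V) g •
      dOmega π (ores (inf_le_right : V ⊓ deltaChart K n i j ≤ _) (chartCoord i j)) = 0 := by
    rw [← e2, ← ores_rootCoord, ores_ores, mres_dOmega]
  have hle := deltaChart_le_preimage hπ i j
  have hC := isAffineOpen_deltaChart K n i j
  have hW := (isAffineOpen_chart K i).preimage (Delta.incl K n)
  have e3 := germ_app_eq_zero_of_smul_dOmega_eq_zero hC hW hle hi φ
    (fun g => (hφ.1 g).trans (hψ g)) hφ.2.1 (chartCoord i j) hφ.2.2 hz g hg'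
  exact e3

end Relations

end OpenSwallowtail

namespace OpenSwallowtail

open Scheme.Modules ProjSpace

/-! ### Comparison of the two sheaves. -/

/-- With common transition functions, a relation between two generators becomes a relation for one
of them, that is, a statement about its annihilator. -/
lemma relations_iff {X : Scheme.{u}} {M N : X.Modules} {ι : Type} {U : ι → X.Opens}
    {e : ∀ j, Γ(N, U j)} {m : ∀ j, Γ(M, U j)}
    (h0 : ∀ (j : ι) (W : X.Opens) (hj : W ≤ U j) (g : Γ(X, W)),
      g • mres N hj (e j) = 0 ↔ g • mres M hj (m j) = 0)
    (ht : ∀ (j k : ι) (W : X.Opens) (hj : W ≤ U j) (hk : W ≤ U k), ∃ u : Γ(X, W),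
      mres N hk (e k) = u • mres N hj (e j) ∧ mres M hk (m k) = u • mres M hj (m j))
    (j k : ι) (W : X.Opens) (hj : W ≤ U j) (hk : W ≤ U k) (g h : Γ(X, W)) :
    g • mres N hj (e j) = h • mres N hk (e k) ↔ g • mres M hj (m j) = h • mres M hk (m k) := by
  obtain ⟨u, h1, h2⟩ := ht j k W hj hk
  rw [h1, h2, smul_smul, smul_smul, ← sub_eq_zero, ← sub_smul, h0, sub_smul, sub_eq_zero]

lemma dOmega_eq_neg_sq_smul {X Y : Scheme.{u}} {f : X ⟶ Y} {U : X.Opens} {a b : Γ(X, U)}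
    (h : a * b = 1) : dOmega f b = (-b ^ 2) • dOmega f a := by
  have h1 := congrArg (fun s => b • s) ((dOmega_mul (f := f) a b).symm.trans (h ▸ dOmega_one))
  simp only [smul_add, smul_smul, smul_zero] at h1
  rw [mul_comm b a, h, one_smul, ← pow_two] at h1
  rw [neg_smul]
  exact eq_neg_of_add_eq_zero_left h1

section PushPull

variable {X Z : Scheme.{u}} (q : Z ⟶ X) (L : X.Modules)

/-- The restriction of a section to a closed subscheme, as a section of the direct image. -/
def pushPullSection {U : X.Opens} (e : Γ(L, U)) :
    Γ((pushforward q).obj ((pullback q).obj L), U) :=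
  ((pullbackPushforwardAdjunction q).unit.app L).app U e

variable {q L}

lemma pushPullSection_smul {U : X.Opens} (g : Γ(X, U)) (e : Γ(L, U)) :
    pushPullSection q L (g • e) = g • pushPullSection q L e :=
  Hom.app_smul _ _ _

lemma pushPullSection_mres {V U : X.Opens} (h : V ≤ U) (e : Γ(L, U)) :
    pushPullSection q L (mres L h e) = mres _ h (pushPullSection q L e) :=
  app_mres ((pullbackPushforwardAdjunction q).unit.app L) h e

lemma smul_pushPullSection {U V : X.Opens} (h : V ≤ U) (g : Γ(X, V)) (e : Γ(L, U)) :
    g • mres _ h (pushPullSection q L e) =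
      (show Γ((pushforward q).obj ((pullback q).obj L), V) from
        (q.app V).hom g • mres _ (preimage_le q h) (pullbackSection q L e)) := rfl

lemma FreelyGenerates.smul_pushPullSection_eq_zero_iff {U : X.Opens} {e : Γ(L, U)}
    (he : FreelyGenerates L e) {V : X.Opens} (h : V ≤ U) (g : Γ(X, V)) :
    g • mres _ h (pushPullSection q L e) = 0 ↔ (q.app V).hom g = 0 := by
  rw [smul_pushPullSection]
  change (q.app V).hom g • mres _ (preimage_le q h) (pullbackSection q L e) =
    (0 : Γ((Scheme.Modules.pullback q).obj L, q ⁻¹ᵁ V)) ↔ _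
  refine ⟨fun hg => ?_, fun hg => by rw [hg, zero_smul]⟩
  obtain ⟨_, _, hu⟩ := he.pullback (q := q) _ (preimage_le q h) 0
  exact (hu _ hg.symm).trans (hu 0 (zero_smul _ _).symm).symm

/-- Coefficients are functions on the closed subscheme, and over affine open subsets these lift to
`X`. -/
lemma FreelyGenerates.generatesOn_pushPullSection [IsClosedImmersion q] {U : X.Opens}
    {e : Γ(L, U)} (he : FreelyGenerates L e) : GeneratesOn _ (pushPullSection q L e) := by
  intro V s x hV hU
  obtain ⟨_, ⟨W, hW, rfl⟩, hxW, hWV⟩ := X.isBasis_affineOpens.exists_subset_of_mem_open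
    (show x ∈ ((V ⊓ U : X.Opens) : Set X) from ⟨hV, hU⟩) (V ⊓ U).isOpen
  have hWV' : W ≤ V := hWV.trans inf_le_left
  have hWU : W ≤ U := hWV.trans inf_le_right
  obtain ⟨g', hg', -⟩ := he.pullback (q := q) _ (preimage_le q hWU) (mres _ hWV' s)
  obtain ⟨g, rfl⟩ := q.app_surjective W hW g'
  exact ⟨W, hWV', hWU, g, hxW, hg'⟩

end PushPull

variable {K : Type u} [Field K] {n : ℕ}

lemma ores_lineCoord_mul {j k : Fin 2} (h : j ≠ k) :
    ores inf_le_left (lineCoord K j) * ores (inf_le_right : chart K j ⊓ chart K k ≤ _)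
      (lineCoord K k) = 1 := by
  have hk : j.rev = k := by have := rev_ne j; omega
  have hj : k.rev = j := by have := rev_ne k; omega
  rw [lineCoord, lineCoord, hj, hk, ← ores_ratio j k j inf_le_left inf_le_right, ratio_self, map_one]

lemma dOmega_lineCoord_transition {j k : Fin 2} (h : j ≠ k) :
    mres _ (inf_le_right : chart K j ⊓ chart K k ≤ _)
        (dOmega (toSpec K (Fin 2)) (lineCoord K k)) =
      (-ores (inf_le_right : chart K j ⊓ chart K k ≤ _) (lineCoord K k) ^ 2) •
        mres _ (inf_le_left : chart K j ⊓ chart K k ≤ _) (dOmega (toSpec K (Fin 2)) (lineCoord K j)) := by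
  rw [mres_dOmega, mres_dOmega]
  exact dOmega_eq_neg_sq_smul (ores_lineCoord_mul h)

lemma pullbackSection_transition {X Y : Scheme.{u}} (r : X ⟶ Y) (L : Y.Modules) {U U' : Y.Opens}
    {e : Γ(L, U)} {e' : Γ(L, U')} {u : Γ(Y, U ⊓ U')}
    (h : mres L inf_le_right e' = u • mres L inf_le_left e) {W : X.Opens} (hW : W ≤ r ⁻¹ᵁ U)
    (hW' : W ≤ r ⁻¹ᵁ U') :
    mres _ hW' (pullbackSection r L e') =
      ores (le_inf hW hW' : W ≤ r ⁻¹ᵁ (U ⊓ U')) ((r.app _).hom u) •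
        mres _ hW (pullbackSection r L e) := by
  have h1 := congrArg (fun s => mres _ (le_inf hW hW' : W ≤ r ⁻¹ᵁ (U ⊓ U'))
    (pullbackSection r L s)) h
  simp only [pullbackSection_smul, pullbackSection_mres] at h1
  have h2 := mres_mres ((Scheme.Modules.pullback r).obj L)
    (preimage_le r (inf_le_right : U ⊓ U' ≤ U')) (le_inf hW hW') (pullbackSection r L e')
  have h3 := mres_mres ((Scheme.Modules.pullback r).obj L)
    (preimage_le r (inf_le_left : U ⊓ U' ≤ U)) (le_inf hW hW') (pullbackSection r L e)
  refine h2.symm.trans (h1.trans ((mres_smul _ _ _ _).trans ?_))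
  exact congrArg _ h3

lemma pushPullSection_transition {X Z : Scheme.{u}} (q : Z ⟶ X) (L : X.Modules) {U U' : X.Opens}
    {e : Γ(L, U)} {e' : Γ(L, U')} {W : X.Opens} (hW : W ≤ U) (hW' : W ≤ U') {u : Γ(X, W)}
    (h : mres L hW' e' = u • mres L hW e) :
    mres _ hW' (pushPullSection q L e') = u • mres _ hW (pushPullSection q L e) := by
  rw [← pushPullSection_mres, ← pushPullSection_mres, h, pushPullSection_smul]

lemma dOmega_rootCoord_transition {Y : Scheme.{u}} (π : DeltaBar K n ⟶ Y) {j k : Fin 2}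
    (h : j ≠ k) {W : (DeltaBar K n).Opens} (hj : W ≤ rootChart K n j) (hk : W ≤ rootChart K n k) :
    mres _ hk (dOmega π (rootCoord K n k)) =
      ores (show W ≤ rootProj K n ⁻¹ᵁ (chart K j ⊓ chart K k) from le_inf hj hk)
        (((rootProj K n).app (chart K j ⊓ chart K k)).hom
          (-ores (inf_le_right : chart K j ⊓ chart K k ≤ _) (lineCoord K k) ^ 2)) •
          mres _ hj (dOmega π (rootCoord K n j)) := by
  have hle : W ≤ rootProj K n ⁻¹ᵁ (chart K j ⊓ chart K k) := le_inf hj hk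
  have e (l : Fin 2) (hl : chart K j ⊓ chart K k ≤ chart K l) (hl' : W ≤ rootChart K n l) :
      ores hle (((rootProj K n).app _).hom (ores hl (lineCoord K l))) =
        ores hl' (rootCoord K n l) := by
    rw [app_ores]
    exact ores_ores _ _ _
  have h1 := congrArg (fun s => ores hle (((rootProj K n).app _).hom s)) (ores_lineCoord_mul (K := K) h)
  simp only [map_mul, map_one] at h1
  rw [e j inf_le_left hj, e k inf_le_right hk] at h1
  rw [map_neg, map_neg, map_pow, map_pow, e k inf_le_right hk, mres_dOmega, mres_dOmega]
  exact dOmega_eq_neg_sq_smul h1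

lemma exists_mem_rootChart (x : DeltaBar K n) : ∃ j, x ∈ rootChart K n j := by
  obtain ⟨-, j, -, hj⟩ := exists_mem_PPchart K n (DeltaBar.incl K n x)
  exact ⟨j, hj⟩

variable (K n) in
/-- The inverse image of the differential of the coordinate of the projective line. -/
def rootDifferential (j : Fin 2) :
    Γ((pullback (rootProj K n)).obj (Omega (toSpec K (Fin 2))), rootChart K n j) :=
  pullbackSection (rootProj K n) _ (dOmega _ (lineCoord K j))

lemma freelyGenerates_rootDifferential (j : Fin 2) :
    FreelyGenerates _ (rootDifferential K n j) :=
  (freelyGenerates_dOmega_lineCoord j).pullback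

variable {π : DeltaBar K n ⟶ Delta K n} {q : GammaBar K n ⟶ DeltaBar K n}

/-- Both sheaves are generated on the two charts of the root by sections with annihilator the
functions vanishing on `Γ̄`, and both pairs of generators are related by minus the square of the
coordinate. -/
theorem nonempty_omega_iso [CharZero K] (hn : 2 ≤ n)
    (hπ : π ≫ Delta.incl K n = DeltaBar.incl K n ≫ prV K n)
    (hq : q ≫ DeltaBar.incl K n = GammaBar.incl K n) :
    Nonempty (Omega π ≅ (pushforward q).obj ((pullback q).obj
      ((pullback (rootProj K n)).obj (Omega (toSpec K (Fin 2)))))) := by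
  have := isClosedImmersion_of_comp_incl hq
  refine LocallyGenerated.nonempty_iso (U := rootChart K n)
    (e := fun j => dOmega π (rootCoord K n j))
    (m := fun j => pushPullSection q _ (rootDifferential K n j))
    ⟨exists_mem_rootChart, generatesOn_rootCoord hπ⟩
    ⟨exists_mem_rootChart, fun j =>
      (freelyGenerates_rootDifferential j).generatesOn_pushPullSection⟩
    (relations_iff (fun j W hj g => ?_) fun j k W hj hk => ?_)
  · rw [(freelyGenerates_rootDifferential j).smul_pushPullSection_eq_zero_iff]
    exact ⟨app_eq_zero_of_smul_dOmega_eq_zero hn hπ hq j hj g,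
      smul_dOmega_eq_zero_of_app_eq_zero hn hπ hq j hj g⟩
  · by_cases h : j = k
    · subst h
      exact ⟨1, (one_smul _ _).symm, (one_smul _ _).symm⟩
    · exact ⟨_, dOmega_rootCoord_transition π h hj hk, pushPullSection_transition q _ hj hk
        (pullbackSection_transition (rootProj K n) _ (dOmega_lineCoord_transition h) hj hk)⟩

variable (q) in
theorem isLineBundle_pullback_omega : IsLineBundle ((pullback q).obj
    ((pullback (rootProj K n)).obj (Omega (toSpec K (Fin 2))))) :=
  isLineBundle_of_freelyGenerates (fun j => q ⁻¹ᵁ rootChart K n j)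
    (fun j => pullbackSection q _ (rootDifferential K n j))
    (fun x => (exists_mem_rootChart (q x)).imp fun _ => (mem_preimage_iff q _ x).2)
    fun j => (freelyGenerates_rootDifferential j).pullback

end OpenSwallowtail

end

theorem mainTheorem2 (K : Type u) [Field K] [IsAlgClosed K] [CharZero K] (n : ℕ) (hn : 2 ≤ n) :
    ∃ (π : OpenSwallowtail.DeltaBar K n ⟶ OpenSwallowtail.Delta K n)
      (j : OpenSwallowtail.GammaBar K n ⟶ OpenSwallowtail.DeltaBar K n),
      π ≫ OpenSwallowtail.Delta.incl K n =
          OpenSwallowtail.DeltaBar.incl K n ≫ OpenSwallowtail.prV K n ∧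
      j ≫ OpenSwallowtail.DeltaBar.incl K n = OpenSwallowtail.GammaBar.incl K n ∧
      Nonempty (OpenSwallowtail.Omega π ≅
        (Scheme.Modules.pushforward j).obj ((Scheme.Modules.pullback j).obj
          ((Scheme.Modules.pullback (OpenSwallowtail.rootProj K n)).obj
            (OpenSwallowtail.Omega (OpenSwallowtail.ProjSpace.toSpec K (Fin 2)))))) ∧
      OpenSwallowtail.IsLineBundle ((Scheme.Modules.pullback j).obj
          ((Scheme.Modules.pullback (OpenSwallowtail.rootProj K n)).obj
            (OpenSwallowtail.Omega (OpenSwallowtail.ProjSpace.toSpec K (Fin 2))))) := by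
  have h := OpenSwallowtail.idealDeltaBar_le_idealGammaBar K hn
  have hq : Scheme.IdealSheafData.inclusion h ≫ OpenSwallowtail.DeltaBar.incl K n =
      OpenSwallowtail.GammaBar.incl K n := Scheme.IdealSheafData.inclusion_subschemeι h
  exact ⟨OpenSwallowtail.deltaProj K hn, _, OpenSwallowtail.deltaProj_incl hn, hq,
    OpenSwallowtail.nonempty_omega_iso hn (OpenSwallowtail.deltaProj_incl hn) hq,
    OpenSwallowtail.isLineBundle_pullback_omega _⟩
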